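/- Let $(V,Y,\mathbf 1,\omega)$ be a vertex operator algebra over $\mathbb C$ ($\mathbb Z$-graded, with finite-dimensional homogeneous subspaces $V_{(n)}$ that vanish for $n$ sufficiently negative) and let $(W_1,Y_1),(W_2,Y_2),(W_3,Y_3)$ be $V$-modules: each $W=\coprod_{h\in\mathbb C}W_{(h)}$ is $\mathbb C$-graded by $L(0)$-eigenvalues, $\dim W_{(h)}<\infty$, and $W_{(h)}=0$ when the real part of $h$ is sufficiently small. Here $Y(\omega,x)=\sum_{n\in\mathbb Z}L(n)x^{-n-2}$. For a module $W$ let $W'=\coprod_h W_{(h)}^*$ be the contragredient module, with vertex operators given by $\langle Y'(v,x)w',w\rangle=\langle w',Y(e^{xL(1)}(-x^{-2})^{L(0)}v,x^{-1})w\rangle$. For spaces $A,B,C$ among these modules and contragredient modules let $\mathcal V^{C}_{AB}$ be the vector space of intertwining operators of type $\binom{C}{A\,B}$: linear maps $A\otimes B\to C\{x\}$, $a\otimes b\mapsto\mathcal Y(a,x)b=\sum_{n\in\mathbb C}a_nb\,x^{-n-1}$, such that $a_nb=0$ for $n$ of sufficiently large real part, the Jacobi identity $$x_0^{-1}\delta\!\left(\tfrac{x_1-x_2}{x_0}\right)Y_C(v,x_1)\mathcal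 Y(a,x_2)b-x_0^{-1}\delta\!\left(\tfrac{x_2-x_1}{-x_0}\right)\mathcal Y(a,x_2)Y_B(v,x_1)b=x_2^{-1}\delta\!\left(\tfrac{x_1-x_0}{x_2}\right)\mathcal Y(Y_A(v,x_0)a,x_2)b$$ holds for all $v\in V$, and $\frac{d}{dx}\mathcal Y(a,x)=\mathcal Y(L(-1)a,x)$. For $\zeta\in\mathbb C$, $\mathcal Y(a,e^{\zeta}x)$ denotes the result of replacing $x^s$ by $e^{\zeta s}x^s$ for all $s\in\mathbb C$, and $\mathcal Y(a,x^{-1})$ that of replacing $x^s$ by $x^{-s}$. For $r\in\mathbb Z$ set $$\Omega_r(\mathcal Y)(b,x)a=e^{xL(-1)}\mathcal Y(a,e^{(2r+1)\pi i}x)b,$$ $$\langle A_r(\mathcal Y)(a,x)c',b\rangle=\langle c',\mathcal Y(e^{xL(1)}e^{(2r+1)\pi iL(0)}x^{-2L(0)}a,x^{-1})b\rangle .$$ Then for each integer $r$ there is a linear isomorphism $$B_r:\mathcal V^{W_3}_{W_1W_2}\longrightarrow\mathcal V^{W_1'}_{W_3'W_2}$$ with the following two properties. (1) For every pair of integers $r_2,r_3$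 with $r=r_2-2r_3-1$, the operations $\Omega_{r_3}$, $A_{r_2}$, $\Omega_{r_3}$ define linear isomorphisms $$\mathcal V^{W_3}_{W_1W_2}\xrightarrow{\ \Omega_{r_3}\ }\mathcal V^{W_3}_{W_2W_1}\xrightarrow{\ A_{r_2}\ }\mathcal V^{W_1'}_{W_2W_3'}\xrightarrow{\ \Omega_{r_3}\ }\mathcal V^{W_1'}_{W_3'W_2},$$ and $B_r=\Omega_{r_3}\circ A_{r_2}\circ\Omega_{r_3}$; in particular this composite does not depend on the choice of $r_2$ and $r_3$. (2) For all $\mathcal Y\in\mathcal V^{W_3}_{W_1W_2}$, $w_{(1)}\in W_1$, $w_{(2)}\in W_2$, $w_{(3)}'\in W_3'$, $$\langle B_r(\mathcal Y)(w_{(3)}',x)w_{(2)},w_{(1)}\rangle_{W_1}=\big\langle e^{-x^{-1}L(1)}w_{(3)}',\ \mathcal Y(e^{xL(1)}w_{(1)},x^{-1})\,e^{-xL(1)}e^{(2r+1)\pi iL(0)}x^{-2L(0)}w_{(2)}\big\rangle_{W_3}.$$ -/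

import Mathlib

open scoped Nat

/-!
Vertex operator algebras over `ℂ`, their modules, contragredient modules and intertwining
operators.

A vertex operator map `v ↦ Y(v, x) = ∑ v_n x^{-n-1}` is a linear map into Mathlib's
`VertexOperator ℂ W` (whose values are Laurent series, so that lower truncation is built in).
A formal series `∑_{s ∈ ℂ} f_s x^s` in `W{x}` (arbitrary complex powers, no condition on the
support) is the function `f : ℂ → W` of its coefficients.
-/

noncomputable section

namespace VOA

section Action

variable {V W : Type*} [AddCommGroup V] [Module ℂ V] [AddCommGroup W] [Module ℂ W]

/-- The mode `v_n` of `Y(v, x) = ∑ v_n x^{-n-1}`, linear in `v`. -/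
def mode (Y : V →ₗ[ℂ] VertexOperator ℂ W) (n : ℤ) : V →ₗ[ℂ] Module.End ℂ W :=
  LinearMap.proj n ∘ₗ VertexOperator.ncoeff ∘ₗ Y

/-- The operator `L(n)`: the coefficient of `x^{-n-2}` in `Y(ω, x) = ∑ L(n) x^{-n-2}`,
that is, the mode `ω_{n+1}`. -/
def vir (Y : V →ₗ[ℂ] VertexOperator ℂ W) (ω : V) (n : ℤ) : Module.End ℂ W :=
  mode Y (n + 1) ω

/-- The Jacobi identity
`x₀⁻¹δ((x₁-x₂)/x₀) Y(u,x₁)Y(v,x₂)w - x₀⁻¹δ((x₂-x₁)/(-x₀)) Y(v,x₂)Y(u,x₁)w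
  = x₂⁻¹δ((x₁-x₀)/x₂) Y(Y_V(u,x₀)v,x₂)w`,
as equality of the coefficients of `x₀^{-l-1} x₁^{-m-1} x₂^{-n-1}` for all `l m n`. The sums
have finitely many nonzero terms by lower truncation. -/
def ActionJacobi (YV : V →ₗ[ℂ] VertexOperator ℂ V) (Y : V →ₗ[ℂ] VertexOperator ℂ W) : Prop :=
  ∀ (u v : V) (w : W) (l m n : ℤ),
    (∑ᶠ i : ℕ, ((-1 : ℤ) ^ i * Ring.choose l i) • mode Y (m + l - i) u (mode Y (n + i) v w))
      - (-1 : ℂ) ^ l • (∑ᶠ i : ℕ, ((-1 : ℤ) ^ i * Ring.choose l i) •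
          mode Y (n + l - i) v (mode Y (m + i) u w))
    = ∑ᶠ i : ℕ, Ring.choose m i • mode Y (m + n - i) (mode YV (l + i) u v) w

/-- The Virasoro algebra relations with central charge `c`. -/
def VirasoroRelations (L : ℤ → Module.End ℂ W) (c : ℂ) : Prop :=
  ∀ (m n : ℤ) (w : W),
    L m (L n w) - L n (L m w)
      = ((m : ℂ) - n) • L (m + n) w
        + (if m + n = 0 then (((m : ℂ) ^ 3 - m) / 12 * c) • w else 0)

end Action

/-- The structure of a vertex operator algebra `(V, Y, 1, ω)` on a complex vector space `V`. -/
structure VertexOperatorAlgebra (V : Type*) [AddCommGroup V] [Module ℂ V] where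
  /-- The homogeneous subspace `V_(n)` of weight `n`. -/
  weight : ℤ → Submodule ℂ V
  isInternal : DirectSum.IsInternal weight
  finiteDimensional : ∀ n, FiniteDimensional ℂ (weight n)
  weight_eq_bot : ∃ N : ℤ, ∀ n < N, weight n = ⊥
  /-- The vertex operator map. -/
  Y : V →ₗ[ℂ] VertexOperator ℂ V
  /-- The vacuum vector `1`. -/
  vac : V
  /-- The Virasoro element `ω`. -/
  conf : V
  vac_mem : vac ∈ weight 0
  conf_mem : conf ∈ weight 2
  vac_mode : ∀ (n : ℤ) (v : V), mode Y n vac v = if n = -1 then v else 0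
  creation : ∀ (v : V) (n : ℤ), 0 ≤ n → mode Y n v vac = 0
  creation_neg_one : ∀ v : V, mode Y (-1) v vac = v
  jacobi : ActionJacobi Y Y
  /-- The central charge (rank) of `V`. -/
  rank : ℂ
  virasoro : VirasoroRelations (vir Y conf) rank
  vir_zero : ∀ (n : ℤ), ∀ v ∈ weight n, vir Y conf 0 v = (n : ℂ) • v
  /-- `d/dx Y(v, x) = Y(L(-1)v, x)`. -/
  vir_neg_one : ∀ (v w : V) (n : ℤ),
    mode Y n (vir Y conf (-1) v) w = -(n : ℂ) • mode Y (n - 1) v w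

/-- The structure of a module for the vertex operator algebra `𝓥` on a complex vector space
`W`, graded by complex weights. -/
structure VOAModule {V : Type*} [AddCommGroup V] [Module ℂ V] (𝓥 : VertexOperatorAlgebra V)
    (W : Type*) [AddCommGroup W] [Module ℂ W] where
  /-- The homogeneous subspace `W_(h)` of weight `h`. -/
  weight : ℂ → Submodule ℂ W
  isInternal : DirectSum.IsInternal weight
  finiteDimensional : ∀ h, FiniteDimensional ℂ (weight h)
  weight_eq_bot : ∃ N : ℝ, ∀ h : ℂ, h.re < N → weight h = ⊥
  /-- The vertex operator map. -/
  Y : V →ₗ[ℂ] VertexOperator ℂ W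
  vac_mode : ∀ (n : ℤ) (w : W), mode Y n 𝓥.vac w = if n = -1 then w else 0
  jacobi : ActionJacobi 𝓥.Y Y
  virasoro : VirasoroRelations (vir Y 𝓥.conf) 𝓥.rank
  vir_zero : ∀ (h : ℂ), ∀ w ∈ weight h, vir Y 𝓥.conf 0 w = h • w
  /-- `d/dx Y(v, x) = Y(L(-1)v, x)`. -/
  vir_neg_one : ∀ (v : V) (w : W) (n : ℤ),
    mode Y n (vir 𝓥.Y 𝓥.conf (-1) v) w = -(n : ℂ) • mode Y (n - 1) v w

section Proj

variable {ι E : Type*} [DecidableEq ι] [AddCommGroup E] [Module ℂ E] {A : ι → Submodule ℂ E}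

/-- The projection of a graded space `E = ∐ A i` to its `i`-th homogeneous subspace. -/
def proj (hA : DirectSum.IsInternal A) (i : ι) : E →ₗ[ℂ] E :=
  (A i).subtype ∘ₗ DirectSum.component ℂ ι (fun j => A j) i ∘ₗ
    (LinearEquiv.ofBijective (DirectSum.coeLinearMap A) hA).symm.toLinearMap

theorem proj_mem (hA : DirectSum.IsInternal A) (i : ι) (x : E) : proj hA i x ∈ A i :=
  Subtype.property _

theorem proj_self (hA : DirectSum.IsInternal A) (i : ι) {x : E} (hx : x ∈ A i) :
    proj hA i x = x := by
  have h : (LinearEquiv.ofBijective (DirectSum.coeLinearMap A) hA).symm x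
      = DirectSum.lof ℂ ι (fun j => A j) i ⟨x, hx⟩ := by
    rw [LinearEquiv.symm_apply_eq]
    exact (DirectSum.coeLinearMap_lof A i ⟨x, hx⟩).symm
  show ((DirectSum.component ℂ ι (fun j => A j) i
    ((LinearEquiv.ofBijective (DirectSum.coeLinearMap A) hA).symm x) : A i) : E) = x
  rw [h, DirectSum.component.lof_self]

theorem proj_ne (hA : DirectSum.IsInternal A) {i j : ι} (hij : i ≠ j) {x : E} (hx : x ∈ A i) :
    proj hA j x = 0 := by
  have h : (LinearEquiv.ofBijective (DirectSum.coeLinearMap A) hA).symm x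
      = DirectSum.lof ℂ ι (fun j => A j) i ⟨x, hx⟩ := by
    rw [LinearEquiv.symm_apply_eq]
    exact (DirectSum.coeLinearMap_lof A i ⟨x, hx⟩).symm
  show ((DirectSum.component ℂ ι (fun j => A j) j
    ((LinearEquiv.ofBijective (DirectSum.coeLinearMap A) hA).symm x) : A j) : E) = 0
  rw [h, DirectSum.component.of, dif_neg hij]
  rfl

/-- Induction on the homogeneous decomposition. -/
theorem homog_induction (hA : DirectSum.IsInternal A) {P : E → Prop} (h0 : P 0)
    (hadd : ∀ x y, P x → P y → P (x + y)) (hom : ∀ i, ∀ x ∈ A i, P x) (x : E) : P x := by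
  have hx : x ∈ ⨆ i, A i := by rw [hA.submodule_iSup_eq_top]; trivial
  induction hx using Submodule.iSup_induction' with
  | mem i x hx => exact hom i x hx
  | zero => exact h0
  | add x y _ _ hx hy => exact hadd x y hx hy

theorem proj_finite (hA : DirectSum.IsInternal A) (x : E) : {i | proj hA i x ≠ 0}.Finite := by
  induction x using homog_induction hA with
  | h0 => simp
  | hadd x y hx hy =>
    refine (hx.union hy).subset fun i hi => ?_
    by_contra h
    simp only [Set.mem_union, Set.mem_ofPred_eq, not_or, not_not] at h
    exact hi (by rw [map_add, h.1, h.2, add_zero])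
  | hom i x hx =>
    refine (Set.finite_singleton i).subset fun j hj => ?_
    by_contra h
    exact hj (proj_ne hA (fun e => h e.symm) hx)

/-- If all projections of `x` except the `i`-th vanish, `x` is homogeneous of weight `i`. -/
theorem eq_proj (hA : DirectSum.IsInternal A) (i : ι) {x : E}
    (h : ∀ j, j ≠ i → proj hA j x = 0) : x ∈ A i := by
  set e := LinearEquiv.ofBijective (DirectSum.coeLinearMap A) hA
  have hx : e.symm x = DirectSum.lof ℂ ι (fun j => A j) i (e.symm x i) := by
    refine DFinsupp.ext fun j => ?_
    by_cases hj : j = i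
    · subst hj
      exact (DirectSum.component.lof_self (R := ℂ) (M := fun j => A j) j (e.symm x j)).symm
    · have h1 : e.symm x j = 0 := Subtype.ext (h j hj)
      refine h1.trans ?_
      refine Eq.symm ((DirectSum.component.of (R := ℂ) (M := fun j => A j) j i (e.symm x i)).trans ?_)
      rw [dif_neg (fun e => hj e.symm)]
  rw [← e.apply_symm_apply x, hx]
  show DirectSum.coeLinearMap A _ ∈ A i
  rw [DirectSum.coeLinearMap_lof]
  exact Subtype.property _

theorem proj_comm (hA : DirectSum.IsInternal A) (T : Module.End ℂ E) (c : ι → ℂ)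
    (hT : ∀ i, ∀ x ∈ A i, T x = c i • x) (i : ι) (x : E) :
    proj hA i (T x) = c i • proj hA i x := by
  induction x using homog_induction hA with
  | h0 => simp
  | hadd x y hx hy => simp [hx, hy]
  | hom j x hx =>
    rw [hT j x hx, map_smul]
    by_cases hj : j = i
    · rw [hj]
    · rw [proj_ne hA hj hx, smul_zero, smul_zero]

/-- If an operator acts by distinct scalars on the homogeneous subspaces, its eigenvectors are
homogeneous. -/
theorem mem_of_eigen (hA : DirectSum.IsInternal A) (T : Module.End ℂ E) (c : ι → ℂ)
    (hc : Function.Injective c) (hT : ∀ i, ∀ x ∈ A i, T x = c i • x) (i : ι) (x : E)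
    (hx : T x = c i • x) : x ∈ A i := by
  refine eq_proj hA i fun j hj => ?_
  have h := proj_comm hA T c hT j x
  rw [hx, map_smul, ← sub_eq_zero, ← sub_smul, smul_eq_zero, sub_eq_zero] at h
  exact h.resolve_left fun e => hj (hc e).symm

end Proj

section Contragredient

variable {V : Type*} [AddCommGroup V] [Module ℂ V] {𝓥 : VertexOperatorAlgebra V}
  {W : Type*} [AddCommGroup W] [Module ℂ W]

/-- The operator `L(1)` on `V` lowers weights by one. -/
theorem vir_one_mem {h : ℤ} {v : V} (hv : v ∈ 𝓥.weight h) :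
    vir 𝓥.Y 𝓥.conf 1 v ∈ 𝓥.weight (h - 1) := by
  refine mem_of_eigen 𝓥.isInternal (vir 𝓥.Y 𝓥.conf 0) (fun n : ℤ => (n : ℂ))
    Int.cast_injective 𝓥.vir_zero (h - 1) _ ?_
  have e := 𝓥.virasoro 0 1 v
  rw [𝓥.vir_zero h v hv, map_smul] at e
  simp only [zero_add, Int.cast_zero, Int.cast_one, zero_sub, one_ne_zero, if_false, add_zero,
    sub_eq_iff_eq_add] at e
  rw [e, ← add_smul]
  congr 1
  push_cast
  ring

theorem vir_one_pow_mem {h : ℤ} {v : V} (hv : v ∈ 𝓥.weight h) (k : ℕ) :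
    ((vir 𝓥.Y 𝓥.conf 1) ^ k) v ∈ 𝓥.weight (h - k) := by
  induction k with
  | zero => simpa using hv
  | succ k ih =>
    rw [pow_succ', Module.End.mul_apply]
    have := vir_one_mem ih
    rwa [show h - ((k + 1 : ℕ) : ℤ) = h - k - 1 by push_cast; ring]

/-- For `v` of weight `h`, the mode `v_n` on a module raises weights by `h - n - 1`. -/
theorem VOAModule.mode_mem (M : VOAModule 𝓥 W) {h : ℤ} {v : V} (hv : v ∈ 𝓥.weight h)
    {a : ℂ} {w : W} (hw : w ∈ M.weight a) (n : ℤ) :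
    mode M.Y n v w ∈ M.weight (a + (h - n - 1)) := by
  refine mem_of_eigen M.isInternal (vir M.Y 𝓥.conf 0) (fun a : ℂ => a)
    Function.injective_id M.vir_zero _ _ ?_
  have e := M.jacobi 𝓥.conf v w 0 1 n
  have e1 : ∀ f : ℕ → W, (∀ i, i ≠ 0 → f i = 0) → ∑ᶠ i, f i = f 0 := fun f hf =>
    finsum_eq_single f 0 hf
  rw [e1 _ (fun i hi => by rw [Ring.choose_zero_pos ℤ (Nat.pos_of_ne_zero hi)]; simp),
    e1 _ (fun i hi => by rw [Ring.choose_zero_pos ℤ (Nat.pos_of_ne_zero hi)]; simp),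
    finsum_eq_sum_of_support_subset (s := Finset.range 2) _ (by
      intro i hi
      by_contra h
      simp only [Finset.coe_range, Set.mem_Iio, not_lt] at h
      apply hi
      have : Ring.choose (1 : ℤ) i = 0 := by
        have := Ring.choose_natCast (R := ℤ) 1 i
        rw [Nat.cast_one] at this
        rw [this, Nat.choose_eq_zero_of_lt (by omega)]; rfl
      simp only [this, zero_smul])] at e
  have hA := 𝓥.vir_neg_one
  have hL0 := 𝓥.vir_zero h v hv
  have hL1 := M.vir_neg_one v w (1 + n)
  have hw0 := M.vir_zero a w hw
  simp only [vir] at hL0 hL1 hw0 ⊢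
  norm_num [Finset.sum_range_succ] at e hL0 hL1 hw0 ⊢
  rw [hw0, hL0, hL1, sub_eq_iff_eq_add] at e
  rw [e]
  simp only [map_smul, LinearMap.smul_apply]
  rw [← add_smul, ← add_smul]
  congr 1
  ring

/-- The coefficient of `x^{-m-1}` in
`Y(e^{xL(1)} (-x^{-2})^{L(0)} v, x^{-1})
  = ∑_{h, k} ((-1)^h / k!) x^{k-2h} Y(L(1)^k v_(h), x^{-1})`, where `v_(h)` is the component of
weight `h` of `v`. -/
def VOAModule.oppMode (M : VOAModule 𝓥 W) (m : ℤ) (v : V) : Module.End ℂ W :=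
  ∑ᶠ p : ℤ × ℕ, ((-1 : ℂ) ^ p.1 / (p.2 ! : ℂ)) •
    mode M.Y (2 * p.1 - p.2 - m - 2) (((vir 𝓥.Y 𝓥.conf 1) ^ p.2) (proj 𝓥.isInternal p.1 v))

theorem VOAModule.oppMode_finite (M : VOAModule 𝓥 W) (m : ℤ) (v : V) :
    (Function.support fun p : ℤ × ℕ => ((-1 : ℂ) ^ p.1 / (p.2 ! : ℂ)) •
    mode M.Y (2 * p.1 - p.2 - m - 2)
      (((vir 𝓥.Y 𝓥.conf 1) ^ p.2) (proj 𝓥.isInternal p.1 v))).Finite := by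
  obtain ⟨N, hN⟩ := 𝓥.weight_eq_bot
  refine ((proj_finite 𝓥.isInternal v).biUnion (t := fun h =>
    (fun k : ℕ => (h, k)) '' (Set.Iic (h - N).toNat))
    fun h _ => (Set.finite_Iic _).image _).subset ?_
  rintro ⟨h, k⟩ hp
  simp only [Set.mem_iUnion, Set.mem_image, Set.mem_ofPred_eq]
  refine ⟨h, fun h0 => hp (by simp [h0]), k, ?_, rfl⟩
  by_contra hk
  simp only [Set.mem_Iic, not_le] at hk
  have h1 := vir_one_pow_mem (proj_mem 𝓥.isInternal h v) k
  rw [hN (h - k) (by omega), Submodule.mem_bot] at h1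
  exact hp (by simp [h1])

/-- The underlying space of the contragredient module `W' = ∐ (W_(h))^*`: the linear functionals
on `W` that vanish on all but finitely many homogeneous subspaces. -/
def VOAModule.dualSpace (M : VOAModule 𝓥 W) : Submodule ℂ (Module.Dual ℂ W) where
  carrier := {f | {h : ℂ | ∃ w ∈ M.weight h, f w ≠ 0}.Finite}
  zero_mem' := by simp
  add_mem' := by
    intro f g hf hg
    refine (hf.union hg).subset ?_
    rintro h ⟨w, hw, hne⟩
    by_cases h0 : f w = 0
    · exact Or.inr ⟨w, hw, by simpa [h0] using hne⟩
    · exact Or.inl ⟨w, hw, h0⟩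
  smul_mem' := by
    intro c f hf
    refine hf.subset ?_
    rintro h ⟨w, hw, hne⟩
    exact ⟨w, hw, fun h0 => hne (by simp [h0])⟩

theorem VOAModule.comp_oppMode_mem (M : VOAModule 𝓥 W) (m : ℤ) (v : V) (f : M.dualSpace) :
    f.1 ∘ₗ M.oppMode m v ∈ M.dualSpace := by
  refine finsum_induction (p := fun T : Module.End ℂ W => f.1 ∘ₗ T ∈ M.dualSpace) ?_ ?_ ?_
  · simp
  · intro S T hS hT
    rw [LinearMap.comp_add]
    exact add_mem hS hT
  · rintro ⟨h, k⟩
    rw [LinearMap.comp_smul]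
    refine M.dualSpace.smul_mem _ ?_
    have h1 := vir_one_pow_mem (proj_mem 𝓥.isInternal h v) k
    refine (f.2.preimage (f := fun a : ℂ =>
      a + (((h - k : ℤ) : ℂ) - ((2 * h - k - m - 2 : ℤ) : ℂ) - 1))
      (add_left_injective _).injOn).subset ?_
    rintro a ⟨w, hw, hne⟩
    exact ⟨_, M.mode_mem h1 hw _, hne⟩

theorem VOAModule.comp_oppMode_eventually (M : VOAModule 𝓥 W) (v : V) (f : M.dualSpace) :
    ∃ m₀ : ℤ, ∀ m ≥ m₀, f.1 ∘ₗ M.oppMode m v = 0 := by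
  obtain ⟨N, hN⟩ := M.weight_eq_bot
  obtain ⟨R, hR⟩ : ∃ R : ℝ, ∀ a ∈ {h : ℂ | ∃ w ∈ M.weight h, f.1 w ≠ 0}, a.re ≤ R := by
    obtain ⟨R, hR⟩ := (f.2.image Complex.re).bddAbove
    exact ⟨R, fun a ha => hR ⟨a, ha, rfl⟩⟩
  obtain ⟨H, hH⟩ : ∃ H : ℤ, ∀ h, proj 𝓥.isInternal h v ≠ 0 → h ≤ H := by
    obtain ⟨H, hH⟩ := (proj_finite 𝓥.isInternal v).bddAbove
    exact ⟨H, fun h hh => hH hh⟩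
  obtain ⟨m₀, hm₀⟩ := exists_int_gt (R - N + H - 1)
  refine ⟨m₀, fun m hm => ?_⟩
  refine finsum_induction (p := fun T : Module.End ℂ W => f.1 ∘ₗ T = 0) ?_ ?_ ?_
  · simp
  · intro S T hS hT
    rw [LinearMap.comp_add, hS, hT, add_zero]
  · rintro ⟨h, k⟩
    by_cases h0 : proj 𝓥.isInternal h v = 0
    · simp [h0]
    rw [LinearMap.comp_smul]
    have h1 := vir_one_pow_mem (proj_mem 𝓥.isInternal h v) k
    have hle := hH h h0
    refine (congrArg _ ?_).trans (smul_zero _)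
    ext w
    induction w using homog_induction M.isInternal with
    | h0 => simp
    | hadd x y hx hy => rw [map_add, hx, hy, map_add]
    | hom a w hw =>
      have h2 := M.mode_mem h1 hw (2 * h - k - m - 2)
      by_contra hne
      have h3 := hR _ ⟨_, h2, hne⟩
      have h4 : N ≤ a.re := by
        by_contra h4
        have h5 := hN a (not_le.mp h4)
        rw [h5, Submodule.mem_bot] at hw
        exact hne (by simp [hw])
      have h6 : (a + (((h - k : ℤ) : ℂ) - ((2 * h - k - m - 2 : ℤ) : ℂ) - 1)).re
          = a.re - h + m + 1 := by
        push_cast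
        simp
        ring
      rw [h6] at h3
      have h7 : (h : ℝ) ≤ H := by exact_mod_cast hle
      have h8 : (m₀ : ℝ) ≤ m := by exact_mod_cast hm
      linarith

/-- `M.oppMode`, as a linear map in `v`. -/
def VOAModule.oppModeLin (M : VOAModule 𝓥 W) (m : ℤ) : V →ₗ[ℂ] Module.End ℂ W where
  toFun := M.oppMode m
  map_add' u v := by
    rw [oppMode, oppMode, oppMode,
      ← finsum_add_distrib (M.oppMode_finite m u) (M.oppMode_finite m v)]
    simp only [map_add, smul_add]
  map_smul' c v := by
    rw [oppMode, oppMode, RingHom.id_apply, smul_finsum]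
    refine finsum_congr fun p => ?_
    simp only [map_smul]
    rw [smul_comm]

/-- The mode `v'_m` of the contragredient vertex operator, acting on `W'`. -/
def VOAModule.dualMode (M : VOAModule 𝓥 W) (m : ℤ) : V →ₗ[ℂ] Module.End ℂ M.dualSpace where
  toFun v :=
    { toFun := fun f => ⟨f.1 ∘ₗ M.oppModeLin m v, M.comp_oppMode_mem m v f⟩
      map_add' := fun _ _ => rfl
      map_smul' := fun _ _ => rfl }
  map_add' u v := by
    ext f w
    simp
  map_smul' c v := by
    ext f w
    simp

/-- The contragredient vertex operator map `Y'` on `W'`, determined by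
`⟨Y'(v, x) w', w⟩ = ⟨w', Y(e^{xL(1)} (-x^{-2})^{L(0)} v, x^{-1}) w⟩`. -/
def VOAModule.dualY (M : VOAModule 𝓥 W) : V →ₗ[ℂ] VertexOperator ℂ M.dualSpace where
  toFun v := VertexOperator.of_coeff (fun s => M.dualMode (-s - 1) v) (by
    intro f
    obtain ⟨m₀, hm₀⟩ := M.comp_oppMode_eventually v f
    refine ⟨-m₀, fun s hs => ?_⟩
    by_contra hlt
    exact hs (Subtype.ext (hm₀ (-s - 1) (by omega))))
  map_add' u v := by
    refine HVertexOperator.coeff_inj (funext fun s => ?_)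
    rw [map_add]
    exact map_add (M.dualMode (-s - 1)) u v
  map_smul' c v := by
    refine HVertexOperator.coeff_inj (funext fun s => ?_)
    rw [map_smul]
    exact map_smul (M.dualMode (-s - 1)) c v

theorem VOAModule.mode_dualY (M : VOAModule 𝓥 W) (n : ℤ) (v : V) (f : M.dualSpace) (w : W) :
    (mode M.dualY n v f).1 w = f.1 (M.oppMode n v w) := by
  show (M.dualMode (-(-n - 1) - 1) v f).1 w = _
  rw [show -(-n - 1) - 1 = n by ring]
  rfl

end Contragredient

section Intertwining

variable {V W₁ W₂ W₃ : Type*} [AddCommGroup V] [Module ℂ V] [AddCommGroup W₁] [Module ℂ W₁]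
  [AddCommGroup W₂] [Module ℂ W₂] [AddCommGroup W₃] [Module ℂ W₃]

/-- The mode `(w₁)_n`, `n ∈ ℂ`, of `𝒴(w₁, x) = ∑ (w₁)_n x^{-n-1}`, applied to `w₂`. -/
def cmode (𝒴 : W₁ →ₗ[ℂ] W₂ →ₗ[ℂ] (ℂ → W₃)) (n : ℂ) (w₁ : W₁) (w₂ : W₂) : W₃ :=
  𝒴 w₁ w₂ (-n - 1)

/-- The Jacobi identity
`x₀⁻¹δ((x₁-x₂)/x₀) Y₃(v,x₁)𝒴(w₁,x₂)w₂ - x₀⁻¹δ((x₂-x₁)/(-x₀)) 𝒴(w₁,x₂)Y₂(v,x₁)w₂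
  = x₂⁻¹δ((x₁-x₀)/x₂) 𝒴(Y₁(v,x₀)w₁,x₂)w₂`,
as equality of the coefficients of `x₀^{-l-1} x₁^{-m-1} x₂^{-n-1}` for `l m : ℤ`, `n : ℂ`. The
sums have finitely many nonzero terms by lower truncation. -/
def IntertwiningJacobi (Y₁ : V →ₗ[ℂ] VertexOperator ℂ W₁) (Y₂ : V →ₗ[ℂ] VertexOperator ℂ W₂)
    (Y₃ : V →ₗ[ℂ] VertexOperator ℂ W₃) (𝒴 : W₁ →ₗ[ℂ] W₂ →ₗ[ℂ] (ℂ → W₃)) : Prop :=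
  ∀ (v : V) (w₁ : W₁) (w₂ : W₂) (l m : ℤ) (n : ℂ),
    (∑ᶠ i : ℕ, ((-1 : ℤ) ^ i * Ring.choose l i) •
        mode Y₃ (m + l - i) v (cmode 𝒴 (n + i) w₁ w₂))
      - (-1 : ℂ) ^ l • (∑ᶠ i : ℕ, ((-1 : ℤ) ^ i * Ring.choose l i) •
          cmode 𝒴 (n + l - i) w₁ (mode Y₂ (m + i) v w₂))
    = ∑ᶠ i : ℕ, Ring.choose m i • cmode 𝒴 (m + n - i) (mode Y₁ (l + i) v w₁) w₂

/-- Lower truncation: `(w₁)_n w₂ = 0` for `n` of sufficiently large real part. -/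
def LowerTruncated (𝒴 : W₁ →ₗ[ℂ] W₂ →ₗ[ℂ] (ℂ → W₃)) : Prop :=
  ∀ (w₁ : W₁) (w₂ : W₂), ∃ N : ℝ, ∀ n : ℂ, N < n.re → cmode 𝒴 n w₁ w₂ = 0

/-- `𝒴` is an intertwining operator of type `W₃ choose W₁ W₂`, for the vertex operator maps
`Y₁, Y₂, Y₃` of a vertex operator algebra with Virasoro element `ω`. -/
structure IsIntertwining (ω : V) (Y₁ : V →ₗ[ℂ] VertexOperator ℂ W₁)
    (Y₂ : V →ₗ[ℂ] VertexOperator ℂ W₂) (Y₃ : V →ₗ[ℂ] VertexOperator ℂ W₃)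
    (𝒴 : W₁ →ₗ[ℂ] W₂ →ₗ[ℂ] (ℂ → W₃)) : Prop where
  truncated : LowerTruncated 𝒴
  jacobi : IntertwiningJacobi Y₁ Y₂ Y₃ 𝒴
  /-- `d/dx 𝒴(w₁, x) = 𝒴(L(-1)w₁, x)`: equality of the coefficients of `x^s`. -/
  vir_neg_one : ∀ (w₁ : W₁) (w₂ : W₂) (s : ℂ),
    (s + 1) • 𝒴 w₁ w₂ (s + 1) = 𝒴 (vir Y₁ ω (-1) w₁) w₂ s

theorem mode_finite {E : Type*} [AddCommGroup E] [Module ℂ E] (Y : V →ₗ[ℂ] VertexOperator ℂ E)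
    (v : V) (w : E) : ∃ N : ℤ, ∀ n > N, mode Y n v w = 0 := by
  refine ⟨-((HahnModule.of ℂ).symm (Y v w)).order - 1, fun n hn => ?_⟩
  exact VertexOperator.ncoeff_eq_zero_of_lt_order (Y v) n w (by omega)

theorem finite_of_eventually {E : Type*} [AddCommGroup E] {f : ℕ → E} (N : ℕ)
    (h : ∀ i > N, f i = 0) : f.support.Finite := by
  refine (Set.finite_Iic N).subset fun i hi => ?_
  by_contra hlt
  exact hi (h i (not_le.mp hlt))

theorem LowerTruncated.finite_left {𝒴 : W₁ →ₗ[ℂ] W₂ →ₗ[ℂ] (ℂ → W₃)} (h : LowerTruncated 𝒴)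
    (c : ℕ → ℤ) (T : ℕ → Module.End ℂ W₃) (n : ℂ) (w₁ : W₁) (w₂ : W₂) :
    (Function.support fun i : ℕ => c i • T i (cmode 𝒴 (n + i) w₁ w₂)).Finite := by
  obtain ⟨N, hN⟩ := h w₁ w₂
  obtain ⟨K, hK⟩ := exists_nat_gt (N - n.re)
  refine finite_of_eventually K fun i hi => ?_
  have : (K : ℝ) < i := by exact_mod_cast hi
  rw [hN _ (by simp; linarith), map_zero, smul_zero]

theorem finite_middle (Y₂ : V →ₗ[ℂ] VertexOperator ℂ W₂) (𝒴 : W₁ →ₗ[ℂ] W₂ →ₗ[ℂ] (ℂ → W₃))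
    (c : ℕ → ℤ) (n : ℕ → ℂ) (m : ℤ) (v : V) (w₁ : W₁) (w₂ : W₂) :
    (Function.support fun i : ℕ => c i • cmode 𝒴 (n i) w₁ (mode Y₂ (m + i) v w₂)).Finite := by
  obtain ⟨N, hN⟩ := mode_finite Y₂ v w₂
  refine finite_of_eventually (N - m).toNat fun i hi => ?_
  rw [hN _ (by omega)]
  simp [cmode]

theorem finite_right (Y₁ : V →ₗ[ℂ] VertexOperator ℂ W₁) (𝒴 : W₁ →ₗ[ℂ] W₂ →ₗ[ℂ] (ℂ → W₃))
    (c : ℕ → ℤ) (n : ℕ → ℂ) (l : ℤ) (v : V) (w₁ : W₁) (w₂ : W₂) :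
    (Function.support fun i : ℕ => c i • cmode 𝒴 (n i) (mode Y₁ (l + i) v w₁) w₂).Finite := by
  obtain ⟨N, hN⟩ := mode_finite Y₁ v w₁
  refine finite_of_eventually (N - l).toNat fun i hi => ?_
  rw [hN _ (by omega)]
  simp [cmode]

theorem cmode_add (𝒴 𝒵 : W₁ →ₗ[ℂ] W₂ →ₗ[ℂ] (ℂ → W₃)) (n : ℂ) (w₁ : W₁) (w₂ : W₂) :
    cmode (𝒴 + 𝒵) n w₁ w₂ = cmode 𝒴 n w₁ w₂ + cmode 𝒵 n w₁ w₂ := rfl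

theorem cmode_smul (c : ℂ) (𝒴 : W₁ →ₗ[ℂ] W₂ →ₗ[ℂ] (ℂ → W₃)) (n : ℂ) (w₁ : W₁) (w₂ : W₂) :
    cmode (c • 𝒴) n w₁ w₂ = c • cmode 𝒴 n w₁ w₂ := rfl

/-- The vector space `𝒱^{W₃}_{W₁ W₂}` of intertwining operators of type `W₃ choose W₁ W₂`. -/
def intertwining (ω : V) (Y₁ : V →ₗ[ℂ] VertexOperator ℂ W₁)
    (Y₂ : V →ₗ[ℂ] VertexOperator ℂ W₂) (Y₃ : V →ₗ[ℂ] VertexOperator ℂ W₃) :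
    Submodule ℂ (W₁ →ₗ[ℂ] W₂ →ₗ[ℂ] (ℂ → W₃)) where
  carrier := {𝒴 | IsIntertwining ω Y₁ Y₂ Y₃ 𝒴}
  zero_mem' := by
    refine ⟨fun _ _ => ⟨0, fun _ _ => rfl⟩, ?_, fun _ _ _ => by simp⟩
    intro v w₁ w₂ l m n
    simp [cmode]
  add_mem' := by
    intro 𝒴 𝒵 h𝒴 h𝒵
    refine ⟨?_, ?_, ?_⟩
    · intro w₁ w₂
      obtain ⟨N, hN⟩ := h𝒴.truncated w₁ w₂
      obtain ⟨N', hN'⟩ := h𝒵.truncated w₁ w₂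
      refine ⟨max N N', fun n hn => ?_⟩
      rw [cmode_add, hN n (lt_of_le_of_lt (le_max_left _ _) hn),
        hN' n (lt_of_le_of_lt (le_max_right _ _) hn), add_zero]
    · intro v w₁ w₂ l m n
      simp only [cmode_add, map_add, smul_add]
      rw [finsum_add_distrib (h𝒴.truncated.finite_left _ _ n w₁ w₂)
          (h𝒵.truncated.finite_left _ _ n w₁ w₂),
        finsum_add_distrib (finite_middle Y₂ 𝒴 _ _ m v w₁ w₂) (finite_middle Y₂ 𝒵 _ _ m v w₁ w₂),
        finsum_add_distrib (finite_right Y₁ 𝒴 _ _ l v w₁ w₂) (finite_right Y₁ 𝒵 _ _ l v w₁ w₂),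
        ← h𝒴.jacobi, ← h𝒵.jacobi, smul_add]
      abel
    · intro w₁ w₂ s
      simp only [LinearMap.add_apply, Pi.add_apply, smul_add]
      rw [h𝒴.vir_neg_one, h𝒵.vir_neg_one]
  smul_mem' := by
    intro c 𝒴 h𝒴
    refine ⟨?_, ?_, ?_⟩
    · intro w₁ w₂
      obtain ⟨N, hN⟩ := h𝒴.truncated w₁ w₂
      exact ⟨N, fun n hn => by rw [cmode_smul, hN n hn, smul_zero]⟩
    · intro v w₁ w₂ l m n
      simp only [cmode_smul, map_smul, smul_comm _ c]
      rw [← smul_finsum, ← smul_finsum, ← smul_finsum, ← h𝒴.jacobi, smul_sub,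
        smul_comm _ c]
    · intro w₁ w₂ s
      simp only [LinearMap.smul_apply, Pi.smul_apply]
      rw [smul_comm, h𝒴.vir_neg_one]

end Intertwining

section Series

variable {W W₁ W₂ W₃ : Type*} [AddCommGroup W] [Module ℂ W] [AddCommGroup W₁] [Module ℂ W₁]
  [AddCommGroup W₂] [Module ℂ W₂] [AddCommGroup W₃] [Module ℂ W₃]

/-- The constant series `w`. -/
def const (w : W) : ℂ → W := Pi.single 0 w

/-- The series `f(e^ζ x)`, i.e. the substitution `x^s ↦ e^{ζ s} x^s`, for all `s ∈ ℂ`. -/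
def rescale (ζ : ℂ) (f : ℂ → W) : ℂ → W := fun s => Complex.exp (ζ * s) • f s

/-- The series `e^{c x^d T} f(x)`: its coefficient of `x^s` is `∑_k (c^k / k!) T^k f_{s-dk}`. -/
def expMul (c : ℂ) (d : ℤ) (T : Module.End ℂ W) (f : ℂ → W) : ℂ → W :=
  fun s => ∑ᶠ k : ℕ, (c ^ k / (k ! : ℂ)) • (T ^ k) (f (s - d * k))

/-- The series `e^{a L(0)} x^{-2L(0)} w = ∑_h e^{a h} x^{-2h} w_(h)`, where `w_(h)` is the
component of weight `h` of `w`. -/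
def weightTwist {A : ℂ → Submodule ℂ W} (hA : DirectSum.IsInternal A) (a : ℂ) (w : W) : ℂ → W :=
  fun s => Complex.exp (a * (-s / 2)) • proj hA (-s / 2) w

/-- The series `𝒴(f(x), x^{-1}) g(x)` for `W₁`- and `W₂`-valued series `f`, `g`. -/
def applyInv (𝒴 : W₁ →ₗ[ℂ] W₂ →ₗ[ℂ] (ℂ → W₃)) (f : ℂ → W₁) (g : ℂ → W₂) : ℂ → W₃ :=
  fun s => ∑ᶠ p : ℂ × ℂ, 𝒴 (f p.1) (g p.2) (-(s - p.1 - p.2))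

/-- The scalar series `⟨f(x), g(x)⟩` for series `f`, `g` with values in `W'` and `W`. -/
def pairing {D : Submodule ℂ (Module.Dual ℂ W)} (f : ℂ → D) (g : ℂ → W) : ℂ → ℂ :=
  fun s => ∑ᶠ t : ℂ, (f t).1 (g (s - t))

end Series

section Transformations

variable {V : Type*} [AddCommGroup V] [Module ℂ V] {𝓥 : VertexOperatorAlgebra V}
  {W₁ W₂ W₃ : Type*} [AddCommGroup W₁] [Module ℂ W₁] [AddCommGroup W₂] [Module ℂ W₂]
  [AddCommGroup W₃] [Module ℂ W₃]

/-- `Ω_r(𝒴)(w₂, x)w₁ = e^{xL(-1)} 𝒴(w₁, e^{(2r+1)πi}x)w₂`, where `L(-1)` is the operator on the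
target space `W₃`. -/
def skew (ω : V) (Y₃ : V →ₗ[ℂ] VertexOperator ℂ W₃) (r : ℤ)
    (𝒴 : W₁ →ₗ[ℂ] W₂ →ₗ[ℂ] (ℂ → W₃)) (w₂ : W₂) (w₁ : W₁) : ℂ → W₃ :=
  expMul 1 1 (vir Y₃ ω (-1)) (rescale ((2 * r + 1) * Real.pi * Complex.I) (𝒴 w₁ w₂))

/-- `⟨A_r(𝒴)(w₁, x)w₃', w₂⟩ = ⟨w₃', 𝒴(e^{xL(1)} e^{(2r+1)πiL(0)} x^{-2L(0)} w₁, x^{-1})w₂⟩`, as a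
scalar series in `x`. -/
def contra (M₁ : VOAModule 𝓥 W₁) (M₃ : VOAModule 𝓥 W₃) (r : ℤ)
    (𝒴 : W₁ →ₗ[ℂ] W₂ →ₗ[ℂ] (ℂ → W₃)) (w₁ : W₁) (w₃' : M₃.dualSpace) (w₂ : W₂) : ℂ → ℂ :=
  pairing (const w₃')
    (applyInv 𝒴
      (expMul 1 1 (vir M₁.Y 𝓥.conf 1)
        (weightTwist M₁.isInternal ((2 * r + 1) * Real.pi * Complex.I) w₁))
      (const w₂))

end Transformations

end VOA
end

open Finset.HasAntidiagonal (antidiagonal mem_antidiagonal)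
noncomputable section
namespace VOA

section Combinatorics

theorem choose_alternating_convolution (m α : ℤ) (t : ℕ) :
    ∑ p ∈ antidiagonal t, (-1) ^ p.1 * Ring.choose m p.1 * Ring.choose (α - p.1) p.2
      = Ring.choose (α - m) t := by
  have key : ∀ (β : ℤ) (n : ℕ), Ring.choose β n = (-1) ^ n * Ring.choose (n - 1 - β) n := by
    intro β n
    have h := Ring.choose_neg (-β) n
    rw [neg_neg] at h
    rw [h, show -β + n - 1 = n - 1 - β by ring]
    rcases Nat.even_or_odd n with hn | hn
    · rw [Int.negOnePow_even _ (by exact_mod_cast hn), hn.neg_one_pow]; simp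
    · rw [Int.negOnePow_odd _ (by exact_mod_cast hn), hn.neg_one_pow]; simp
  rw [key, show (t : ℤ) - 1 - (α - m) = m + (t - 1 - α) by ring,
    Ring.add_choose_eq t (Commute.all _ _), Finset.mul_sum]
  refine Finset.sum_congr rfl fun p hp => ?_
  have hp' := mem_antidiagonal.mp hp
  rw [key (α - p.1) p.2, ← hp', pow_add]
  push_cast
  rw [show (p.2 : ℤ) - 1 - (α - p.1) = p.1 + p.2 - 1 - α by ring]
  ring

theorem succ_mul_choose_succ (α : ℤ) (p : ℕ) :
    ((p : ℤ) + 1) * Ring.choose α (p + 1) = (α - p) * Ring.choose α p := by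
  have h := Ring.choose_smul_choose α (n := p + 1) (k := p) (by omega)
  rw [Nat.choose_succ_self_right] at h
  simp at h
  rw [h]; ring

end Combinatorics

section Sums

variable {E : Type*} [AddCommGroup E]

theorem finsum_eq_sum_range {f : ℕ → E} {N : ℕ} (h : ∀ i, N ≤ i → f i = 0) :
    ∑ᶠ i, f i = ∑ i ∈ Finset.range N, f i := by
  refine finsum_eq_sum_of_support_subset _ fun i hi => ?_
  by_contra hN
  exact hi (h i (by simpa using hN))

theorem sum_range_eq_of_le {f : ℕ → E} {M N : ℕ} (hMN : M ≤ N) (h : ∀ i, M ≤ i → f i = 0) :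
    ∑ i ∈ Finset.range M, f i = ∑ i ∈ Finset.range N, f i :=
  Finset.sum_subset (Finset.range_mono hMN) fun i _ hi => h i (by simpa using hi)

theorem sum_range_range_eq_sum_antidiagonal {f : ℕ → ℕ → E} {N : ℕ}
    (h : ∀ i j, N ≤ i + j → f i j = 0) :
    ∑ i ∈ Finset.range N, ∑ j ∈ Finset.range N, f i j
      = ∑ t ∈ Finset.range N, ∑ p ∈ antidiagonal t, f p.1 p.2 := by
  rw [← Finset.sum_product', Finset.sum_sigma']
  have : ∑ x ∈ (Finset.range N ×ˢ Finset.range N).filter (fun p => p.1 + p.2 < N), f x.1 x.2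
      = ∑ x ∈ Finset.range N ×ˢ Finset.range N, f x.1 x.2 := by
    refine Finset.sum_filter_of_ne fun p _ hp => ?_
    by_contra hN
    exact hp (h _ _ (not_lt.mp hN))
  rw [← this]
  refine Finset.sum_nbij' (fun p : ℕ × ℕ => (⟨p.1 + p.2, p⟩ : Σ _ : ℕ, ℕ × ℕ)) (fun q => q.2)
    ?_ ?_ ?_ ?_ ?_
  · rintro ⟨i, j⟩ hp
    simp at hp ⊢
    omega
  · rintro ⟨t, i, j⟩ hp
    simp at hp ⊢
    omega
  · intros; rfl
  · rintro ⟨t, i, j⟩ hp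
    simp at hp ⊢
    exact hp.2
  · intros; rfl

theorem sum_antidiagonal_assoc (f : ℕ → ℕ → ℕ → E) (n : ℕ) :
    ∑ p ∈ antidiagonal n, ∑ q ∈ antidiagonal p.1, f q.1 q.2 p.2
      = ∑ p ∈ antidiagonal n, ∑ q ∈ antidiagonal p.2, f p.1 q.1 q.2 := by
  rw [Finset.sum_sigma', Finset.sum_sigma']
  refine Finset.sum_nbij' (fun x => ⟨(x.2.1, x.2.2 + x.1.2), (x.2.2, x.1.2)⟩)
    (fun x => ⟨(x.1.1 + x.2.1, x.2.2), (x.1.1, x.2.1)⟩) ?_ ?_ ?_ ?_ ?_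
  · rintro ⟨⟨a, b⟩, c, d⟩ hx
    simp only [Finset.mem_sigma, mem_antidiagonal] at hx ⊢
    exact ⟨by omega, trivial⟩
  · rintro ⟨⟨a, b⟩, c, d⟩ hx
    simp only [Finset.mem_sigma, mem_antidiagonal] at hx ⊢
    exact ⟨by omega, trivial⟩
  · rintro ⟨⟨a, b⟩, c, d⟩ hx
    simp only [Finset.mem_sigma, mem_antidiagonal] at hx ⊢
    obtain ⟨rfl, rfl⟩ := hx
    rfl
  · rintro ⟨⟨a, b⟩, c, d⟩ hx
    simp only [Finset.mem_sigma, mem_antidiagonal] at hx ⊢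
    obtain ⟨rfl, rfl⟩ := hx
    rfl
  · intros
    rfl

theorem sum_antidiagonal_left_comm (f : ℕ → ℕ → ℕ → E) (n : ℕ) :
    ∑ p ∈ antidiagonal n, ∑ q ∈ antidiagonal p.2, f p.1 q.1 q.2
      = ∑ p ∈ antidiagonal n, ∑ q ∈ antidiagonal p.2, f q.1 p.1 q.2 := by
  rw [← sum_antidiagonal_assoc, ← sum_antidiagonal_assoc (fun a b c => f b a c)]
  refine Finset.sum_congr rfl fun p _ => ?_
  exact (Finset.Nat.sum_antidiagonal_swap (f := fun q => f q.1 q.2 p.2)).symm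

theorem sum_antidiagonal_fst_smul (f : ℕ → ℕ → E) (n : ℕ) :
    ∑ p ∈ antidiagonal (n + 1), p.1 • f p.1 p.2
      = ∑ p ∈ antidiagonal n, (p.1 + 1) • f (p.1 + 1) p.2 := by
  rw [Finset.Nat.sum_antidiagonal_succ]
  simp

theorem sum_antidiagonal_snd_smul (f : ℕ → ℕ → E) (n : ℕ) :
    ∑ p ∈ antidiagonal (n + 1), p.2 • f p.1 p.2
      = ∑ p ∈ antidiagonal n, (p.2 + 1) • f p.1 (p.2 + 1) := by
  rw [Finset.Nat.sum_antidiagonal_succ']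
  simp

/-- A doubly indexed family supported in a finite box is supported in all large boxes. -/
theorem eventually_box {f : ℕ → ℕ → E} (h₁ : ∃ N, ∀ i, N ≤ i → ∀ k, f i k = 0)
    (h₂ : ∀ i, ∃ K, ∀ k, K ≤ k → f i k = 0) :
    ∀ᶠ N in Filter.atTop, ∀ i k, N ≤ i ∨ N ≤ k → f i k = 0 := by
  obtain ⟨N, hN⟩ := h₁
  choose K hK using h₂
  refine Filter.eventually_atTop.mpr ⟨max N ((Finset.range N).sup K), fun M hM i k hik => ?_⟩
  rw [max_le_iff] at hM
  by_cases hi : N ≤ i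
  · exact hN i hi k
  · refine hK i k ?_
    have : K i ≤ (Finset.range N).sup K := Finset.le_sup (by simpa using hi)
    omega

end Sums

section DividedPowers

variable {W : Type*} [AddCommGroup W] [Module ℂ W]

/-- The divided power `T^k / k!`. -/
def divPow (T : Module.End ℂ W) (k : ℕ) : Module.End ℂ W := (k ! : ℂ)⁻¹ • T ^ k

@[simp]
theorem divPow_zero (T : Module.End ℂ W) : divPow T 0 = 1 := by simp [divPow]

theorem divPow_one (T : Module.End ℂ W) : divPow T 1 = T := by simp [divPow]

theorem mul_divPow (T : Module.End ℂ W) (k : ℕ) :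
    T * divPow T k = (k + 1) • divPow T (k + 1) := by
  have : ((k : ℂ) + 1) ≠ 0 := Nat.cast_add_one_ne_zero k
  rw [divPow, divPow, mul_smul_comm, ← pow_succ', ← Nat.cast_smul_eq_nsmul ℂ, smul_smul,
    Nat.factorial_succ]
  congr 1
  push_cast
  field_simp

theorem divPow_mul (T : Module.End ℂ W) (k : ℕ) :
    divPow T k * T = (k + 1) • divPow T (k + 1) := by
  rw [← mul_divPow, divPow, mul_smul_comm, smul_mul_assoc, ← pow_succ, ← pow_succ']

theorem succ_smul_cancel {k : ℕ} {S T : Module.End ℂ W} (h : (k + 1) • S = (k + 1) • T) :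
    S = T := by
  rw [← Nat.cast_smul_eq_nsmul ℂ, ← Nat.cast_smul_eq_nsmul ℂ] at h
  exact (smul_right_inj (by exact_mod_cast Nat.succ_ne_zero k)).mp h

/-- If `[T, S_q] = (q+1) S_{q+1}`, then `e^T S_0 = (∑_q S_q) e^T`, degree by degree. -/
theorem divPow_mul_of_commutator (T : Module.End ℂ W) (S : ℕ → Module.End ℂ W)
    (h : ∀ q, T * S q = S q * T + (q + 1) • S (q + 1)) (n : ℕ) :
    divPow T n * S 0 = ∑ p ∈ antidiagonal n, S p.1 * divPow T p.2 := by
  induction n with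
  | zero => simp
  | succ n ih =>
    refine succ_smul_cancel (k := n) ?_
    rw [← smul_mul_assoc, ← mul_divPow, mul_assoc, ih, Finset.mul_sum]
    have e1 : ∀ p : ℕ × ℕ, T * (S p.1 * divPow T p.2)
        = (p.2 + 1) • (S p.1 * divPow T (p.2 + 1)) + (p.1 + 1) • (S (p.1 + 1) * divPow T p.2) := by
      intro p
      rw [← mul_assoc, h, add_mul, mul_assoc, mul_divPow, smul_mul_assoc, mul_smul_comm]
    simp only [e1]
    rw [Finset.sum_add_distrib, ← sum_antidiagonal_snd_smul (fun i j => S i * divPow T j),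
      ← sum_antidiagonal_fst_smul (fun i j => S i * divPow T j), ← Finset.sum_add_distrib,
      Finset.smul_sum]
    refine Finset.sum_congr rfl fun p hp => ?_
    rw [← add_smul, add_comm p.2, mem_antidiagonal.mp hp]

/-- If `[S_q, T] = (q+1) S_{q+1}`, then `S_0 e^T = e^T ∑_q S_q`, degree by degree. -/
theorem mul_divPow_of_commutator (T : Module.End ℂ W) (S : ℕ → Module.End ℂ W)
    (h : ∀ q, S q * T = T * S q + (q + 1) • S (q + 1)) (n : ℕ) :
    S 0 * divPow T n = ∑ p ∈ antidiagonal n, divPow T p.2 * S p.1 := by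
  induction n with
  | zero => simp
  | succ n ih =>
    refine succ_smul_cancel (k := n) ?_
    rw [← mul_smul_comm, ← divPow_mul, ← mul_assoc, ih, Finset.sum_mul]
    have e1 : ∀ p : ℕ × ℕ, divPow T p.2 * S p.1 * T
        = (p.2 + 1) • (divPow T (p.2 + 1) * S p.1) + (p.1 + 1) • (divPow T p.2 * S (p.1 + 1)) := by
      intro p
      rw [mul_assoc, h, mul_add, ← mul_assoc, divPow_mul, smul_mul_assoc, mul_smul_comm]
    simp only [e1]
    rw [Finset.sum_add_distrib, ← sum_antidiagonal_snd_smul (fun i j => divPow T j * S i),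
      ← sum_antidiagonal_fst_smul (fun i j => divPow T j * S i), ← Finset.sum_add_distrib,
      Finset.smul_sum]
    refine Finset.sum_congr rfl fun p hp => ?_
    rw [← add_smul, add_comm p.2, mem_antidiagonal.mp hp]

theorem divPow_mul_divPow (T : Module.End ℂ W) (i j : ℕ) :
    divPow T i * divPow T j = (i + j).choose i • divPow T (i + j) := by
  rw [divPow, divPow, divPow, smul_mul_smul_comm, ← pow_add, ← Nat.cast_smul_eq_nsmul ℂ, smul_smul]
  congr 1
  have h := Nat.add_choose_mul_factorial_mul_factorial i j
  rw [← Nat.choose_symm_add] at h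
  have h' : ((i + j).choose i : ℂ) * (i ! : ℂ) * (j ! : ℂ) = ((i + j)! : ℂ) := by exact_mod_cast h
  have h1 : (i ! : ℂ) ≠ 0 := by exact_mod_cast i.factorial_ne_zero
  have h2 : (j ! : ℂ) ≠ 0 := by exact_mod_cast j.factorial_ne_zero
  rw [← h']
  have h3 : ((i + j).choose i : ℂ) ≠ 0 := by
    exact_mod_cast (Nat.choose_pos (Nat.le_add_right i j)).ne'
  field_simp

theorem divPow_mul_divPow_comm (T : Module.End ℂ W) (i j : ℕ) :
    divPow T i * divPow T j = divPow T j * divPow T i := by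
  rw [divPow_mul_divPow, divPow_mul_divPow, add_comm i j, Nat.choose_symm_add]

/-- `e^{-T} e^T = 1`, degree by degree. -/
theorem sum_antidiagonal_neg_one_pow_divPow (T : Module.End ℂ W) (n : ℕ) :
    ∑ p ∈ antidiagonal n, (-1 : ℂ) ^ p.1 • (divPow T p.1 * divPow T p.2)
      = if n = 0 then 1 else 0 := by
  have h := Commute.add_pow' (Commute.neg_one_left (1 : ℤ)) n
  rw [neg_add_cancel] at h
  have e : ∀ p ∈ antidiagonal n, (-1 : ℂ) ^ p.1 • (divPow T p.1 * divPow T p.2)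
      = ((n.choose p.1 • ((-1) ^ p.1 * 1 ^ p.2) : ℤ) : ℂ) • divPow T n := by
    intro p hp
    rw [divPow_mul_divPow, mem_antidiagonal.mp hp, ← Nat.cast_smul_eq_nsmul ℂ, smul_smul]
    congr 1
    simp [mul_comm]
  rw [Finset.sum_congr rfl e, ← Finset.sum_smul, ← Int.cast_sum, ← h]
  rcases n with _ | n
  · simp
  · simp

theorem sum_antidiagonal_neg_one_pow_divPow' (T : Module.End ℂ W) (n : ℕ) :
    ∑ p ∈ antidiagonal n, (-1 : ℂ) ^ p.2 • (divPow T p.2 * divPow T p.1)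
      = if n = 0 then 1 else 0 := by
  rw [← sum_antidiagonal_neg_one_pow_divPow T n, ← Finset.Nat.sum_antidiagonal_swap]
  rfl

end DividedPowers

section Twist

/-- The exponent `(2r+1)πi`. -/
abbrev twist (r : ℤ) : ℂ := (2 * r + 1) * Real.pi * Complex.I

theorem exp_twist (r : ℤ) : Complex.exp (twist r) = -1 := by
  have : twist r = Real.pi * Complex.I + r * (2 * Real.pi * Complex.I) := by
    simp only [twist]; ring
  rw [this, Complex.exp_add, Complex.exp_pi_mul_I, Complex.exp_int_mul_two_pi_mul_I, mul_one]

theorem exp_twist_mul_int (r m : ℤ) : Complex.exp (twist r * m) = (-1) ^ m := by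
  rw [mul_comm, Complex.exp_int_mul, exp_twist]

theorem exp_twist_add_int (r m : ℤ) (s : ℂ) :
    Complex.exp (twist r * (s + m)) = (-1) ^ m * Complex.exp (twist r * s) := by
  rw [mul_add, Complex.exp_add, exp_twist_mul_int, mul_comm]

theorem exp_twist_sub_nat (r : ℤ) (k : ℕ) (s : ℂ) :
    Complex.exp (twist r * (s - k)) = (-1) ^ k * Complex.exp (twist r * s) := by
  have h := exp_twist_add_int r (-k) s
  push_cast at h
  rw [← sub_eq_add_neg] at h
  rw [h, zpow_neg, zpow_natCast, ← inv_pow]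
  norm_num

theorem exp_twist_mul_exp_twist_neg (r : ℤ) (s : ℂ) :
    Complex.exp (twist (-r - 1) * s) * Complex.exp (twist r * s) = 1 := by
  rw [← Complex.exp_add, ← Complex.exp_zero]
  congr 1
  simp only [twist]
  push_cast
  ring

theorem neg_one_pow_mul_self (k : ℕ) : (-1 : ℂ) ^ k * (-1) ^ k = 1 := by
  rw [← mul_pow]; norm_num

theorem neg_one_zpow_mul_self (k : ℤ) : (-1 : ℂ) ^ k * (-1) ^ k = 1 := by
  rw [← mul_zpow]; norm_num

end Twist

section Skew

variable {V A B C : Type*} [AddCommGroup V] [Module ℂ V] [AddCommGroup A] [Module ℂ A]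
  [AddCommGroup B] [Module ℂ B] [AddCommGroup C] [Module ℂ C]

theorem LowerTruncated.eventually {𝒴 : A →ₗ[ℂ] B →ₗ[ℂ] (ℂ → C)} (h : LowerTruncated 𝒴)
    (a : A) (b : B) (n : ℂ) :
    ∀ᶠ N : ℕ in Filter.atTop, ∀ k, N ≤ k → cmode 𝒴 (n + k) a b = 0 := by
  obtain ⟨R, hR⟩ := h a b
  obtain ⟨K, hK⟩ := exists_nat_gt (R - n.re)
  refine Filter.eventually_atTop.mpr ⟨K, fun N hN k hk => hR _ ?_⟩
  have : (K : ℝ) ≤ k := by exact_mod_cast hN.trans hk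
  simp
  linarith

theorem LowerTruncated.eventually_coeff {𝒴 : A →ₗ[ℂ] B →ₗ[ℂ] (ℂ → C)} (h : LowerTruncated 𝒴)
    (a : A) (b : B) (s : ℂ) :
    ∀ᶠ N : ℕ in Filter.atTop, ∀ k : ℕ, N ≤ k → 𝒴 a b (s - k) = 0 := by
  filter_upwards [h.eventually a b (-s - 1)] with N hN k hk
  have := hN k hk
  rwa [cmode, show -(-s - 1 + (k : ℂ)) - 1 = s - k by ring] at this

theorem mode_eventually (Y : V →ₗ[ℂ] VertexOperator ℂ A) (v : V) (a : A) (m : ℤ) :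
    ∀ᶠ N : ℕ in Filter.atTop, ∀ k : ℕ, N ≤ k → mode Y (m + k) v a = 0 := by
  obtain ⟨R, hR⟩ := mode_finite Y v a
  refine Filter.eventually_atTop.mpr ⟨(R - m + 1).toNat, fun N hN k hk => hR _ ?_⟩
  omega

/-- `C`-valued coefficients of `e^{xD} f(e^ζ x)`, for `f` truncated from below. -/
theorem expMul_rescale_eq_sum (D : Module.End ℂ C) (r : ℤ) (f : ℂ → C) (s : ℂ) {N : ℕ}
    (hN : ∀ k : ℕ, N ≤ k → f (s - k) = 0) :
    expMul 1 1 D (rescale (twist r) f) s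
      = ∑ k ∈ Finset.range N,
          (Complex.exp (twist r * s) * (-1) ^ k) • divPow D k (f (s - k)) := by
  rw [expMul, finsum_eq_sum_range (N := N)]
  · refine Finset.sum_congr rfl fun k _ => ?_
    rw [rescale, Int.cast_one, one_mul, exp_twist_sub_nat, map_smul, divPow, smul_smul,
      LinearMap.smul_apply, smul_smul]
    congr 1
    rw [one_pow]
    ring
  · intro k hk
    rw [rescale, Int.cast_one, one_mul, hN k hk]
    simp

variable (ω : V) (Y₃ : V →ₗ[ℂ] VertexOperator ℂ C) (r : ℤ)

theorem skew_eq_sum {𝒴 : A →ₗ[ℂ] B →ₗ[ℂ] (ℂ → C)} {a : A} {b : B} {s : ℂ} {N : ℕ}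
    (hN : ∀ k : ℕ, N ≤ k → 𝒴 a b (s - k) = 0) :
    skew ω Y₃ r 𝒴 b a s
      = ∑ k ∈ Finset.range N, (Complex.exp (twist r * s) * (-1) ^ k) •
          divPow (vir Y₃ ω (-1)) k (𝒴 a b (s - k)) :=
  expMul_rescale_eq_sum _ r _ s hN

/-- `Ω_r(𝒴)` as a bilinear map. -/
def skewBilin (𝒴 : A →ₗ[ℂ] B →ₗ[ℂ] (ℂ → C)) (h : LowerTruncated 𝒴) :
    B →ₗ[ℂ] A →ₗ[ℂ] (ℂ → C) :=
  LinearMap.mk₂ ℂ (skew ω Y₃ r 𝒴)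
    (by
      intro b b' a
      funext s
      obtain ⟨N, h1, h2⟩ :=
        ((h.eventually_coeff a b s).and (h.eventually_coeff a b' s)).exists
      rw [Pi.add_apply, skew_eq_sum ω Y₃ r h1, skew_eq_sum ω Y₃ r h2, skew_eq_sum ω Y₃ r (N := N),
        ← Finset.sum_add_distrib]
      · simp
      · intro k hk
        simp [h1 k hk, h2 k hk])
    (by
      intro c b a
      funext s
      obtain ⟨N, h1⟩ := (h.eventually_coeff a b s).exists
      rw [Pi.smul_apply, skew_eq_sum ω Y₃ r h1, skew_eq_sum ω Y₃ r (N := N), Finset.smul_sum]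
      · refine Finset.sum_congr rfl fun k _ => ?_
        rw [map_smul, Pi.smul_apply, map_smul, smul_comm]
      · intro k hk
        simp [h1 k hk])
    (by
      intro b a a'
      funext s
      obtain ⟨N, h1, h2⟩ :=
        ((h.eventually_coeff a b s).and (h.eventually_coeff a' b s)).exists
      rw [Pi.add_apply, skew_eq_sum ω Y₃ r h1, skew_eq_sum ω Y₃ r h2, skew_eq_sum ω Y₃ r (N := N),
        ← Finset.sum_add_distrib]
      · simp
      · intro k hk
        simp [h1 k hk, h2 k hk])
    (by
      intro c b a
      funext s
      obtain ⟨N, h1⟩ := (h.eventually_coeff a b s).exists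
      rw [Pi.smul_apply, skew_eq_sum ω Y₃ r h1, skew_eq_sum ω Y₃ r (N := N), Finset.smul_sum]
      · refine Finset.sum_congr rfl fun k _ => ?_
        rw [map_smul, LinearMap.smul_apply, Pi.smul_apply, map_smul, smul_comm]
      · intro k hk
        simp [h1 k hk])

variable {ω Y₃ r}

theorem cmode_skewBilin {𝒴 : A →ₗ[ℂ] B →ₗ[ℂ] (ℂ → C)} (h : LowerTruncated 𝒴) {a : A} {b : B}
    {n : ℂ} {N : ℕ} (hN : ∀ k : ℕ, N ≤ k → cmode 𝒴 (n + k) a b = 0) :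
    cmode (skewBilin ω Y₃ r 𝒴 h) n b a
      = ∑ k ∈ Finset.range N, (Complex.exp (twist r * (-n - 1)) * (-1) ^ k) •
          divPow (vir Y₃ ω (-1)) k (cmode 𝒴 (n + k) a b) := by
  have e : ∀ k : ℕ, -(n + k) - 1 = (-n - 1) - k := fun k => by ring
  simp only [cmode, e] at hN ⊢
  exact skew_eq_sum ω Y₃ r hN

theorem LowerTruncated.skewBilin {𝒴 : A →ₗ[ℂ] B →ₗ[ℂ] (ℂ → C)} (h : LowerTruncated 𝒴) :
    LowerTruncated (skewBilin ω Y₃ r 𝒴 h) := by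
  intro b a
  obtain ⟨N, hN⟩ := h a b
  refine ⟨N, fun n hn => ?_⟩
  rw [cmode_skewBilin h (N := 0), Finset.sum_range_zero]
  intro k _
  refine hN _ ?_
  have : (0 : ℝ) ≤ k := k.cast_nonneg
  simp
  linarith

theorem skewBilin_skewBilin {𝒴 : A →ₗ[ℂ] B →ₗ[ℂ] (ℂ → C)} (h : LowerTruncated 𝒴) :
    skewBilin ω Y₃ (-r - 1) (skewBilin ω Y₃ r 𝒴 h) h.skewBilin = 𝒴 := by
  ext a b s
  obtain ⟨N, hN⟩ := Filter.eventually_atTop.mp (h.eventually_coeff a b s)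
  have h1 : ∀ k : ℕ, N ≤ k → 𝒴 a b (s - k) = 0 := hN N le_rfl
  have hsk : ∀ j : ℕ, skewBilin ω Y₃ r 𝒴 h b a (s - j)
      = ∑ k ∈ Finset.range N, (Complex.exp (twist r * (s - j)) * (-1) ^ k) •
          divPow (vir Y₃ ω (-1)) k (𝒴 a b (s - j - k)) := fun j =>
    skew_eq_sum ω Y₃ r fun k hk => by
      have := h1 (j + k) (by omega)
      rwa [Nat.cast_add, ← sub_sub] at this
  have h2 : ∀ k : ℕ, N ≤ k → skewBilin ω Y₃ r 𝒴 h b a (s - k) = 0 := by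
    intro j hj
    rw [hsk]
    refine Finset.sum_eq_zero fun k _ => ?_
    have := h1 (j + k) (by omega)
    rw [Nat.cast_add, ← sub_sub] at this
    rw [this, map_zero, smul_zero]
  refine (skew_eq_sum ω Y₃ (-r - 1) h2).trans ?_
  have e : ∀ j k : ℕ, (Complex.exp (twist (-r - 1) * s) * (-1) ^ j) • divPow (vir Y₃ ω (-1)) j
      ((Complex.exp (twist r * (s - j)) * (-1) ^ k) • divPow (vir Y₃ ω (-1)) k (𝒴 a b (s - j - k)))
      = (-1 : ℂ) ^ k • (divPow (vir Y₃ ω (-1)) k * divPow (vir Y₃ ω (-1)) j) (𝒴 a b (s - (j + k : ℕ))) := by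
    intro j k
    rw [map_smul, smul_smul, Nat.cast_add, ← sub_sub, divPow_mul_divPow_comm, exp_twist_sub_nat,
      Module.End.mul_apply]
    congr 1
    linear_combination (-1 : ℂ) ^ k * exp_twist_mul_exp_twist_neg r s
      + (-1 : ℂ) ^ k * (Complex.exp (twist (-r - 1) * s) * Complex.exp (twist r * s))
        * neg_one_pow_mul_self j
  simp only [hsk, map_sum, Finset.smul_sum]
  rw [sum_range_range_eq_sum_antidiagonal]
  · have e2 : ∀ t, ∑ p ∈ antidiagonal t,
        (-1 : ℂ) ^ p.2 • (divPow (vir Y₃ ω (-1)) p.2 * divPow (vir Y₃ ω (-1)) p.1) (𝒴 a b (s - (p.1 + p.2 : ℕ)))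
        = (if t = 0 then (1 : Module.End ℂ C) else 0) (𝒴 a b (s - t)) := by
      intro t
      rw [← sum_antidiagonal_neg_one_pow_divPow' (vir Y₃ ω (-1)) t, LinearMap.sum_apply]
      refine Finset.sum_congr rfl fun p hp => ?_
      rw [mem_antidiagonal.mp hp]
      rfl
    simp only [e, e2]
    rcases N with _ | N
    · simpa using (h1 0 le_rfl).symm
    · rw [Finset.sum_range_succ']
      simp
  · intro j k hjk
    rw [e, h1 _ hjk]
    simp

end Skew

section SkewJacobi

theorem neg_one_zpow_sub (i : ℕ) (m : ℤ) : (-1 : ℂ) ^ ((i : ℤ) - m) = (-1) ^ m * (-1) ^ i := by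
  rw [sub_eq_neg_add, zpow_add₀ (by norm_num), zpow_neg, ← inv_zpow, zpow_natCast]
  norm_num

variable {V A B C : Type*} [AddCommGroup V] [Module ℂ V] [AddCommGroup A] [Module ℂ A]
  [AddCommGroup B] [Module ℂ B] [AddCommGroup C] [Module ℂ C]

/-- The commutator formula `[L(-1), Y(v, x)] = d/dx Y(v, x)`. -/
def IsTranslation (ω : V) (Y : V →ₗ[ℂ] VertexOperator ℂ C) : Prop :=
  ∀ (v : V) (p : ℤ), mode Y p v * vir Y ω (-1)
    = vir Y ω (-1) * mode Y p v + p • mode Y (p - 1) v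

variable {ω : V} {Y₁ : V →ₗ[ℂ] VertexOperator ℂ A} {Y₂ : V →ₗ[ℂ] VertexOperator ℂ B}
  {Y₃ : V →ₗ[ℂ] VertexOperator ℂ C} {r : ℤ}

theorem IsTranslation.mode_mul_divPow (h : IsTranslation ω Y₃) (v : V) (p : ℤ) (n : ℕ) :
    mode Y₃ p v * divPow (vir Y₃ ω (-1)) n
      = ∑ q ∈ antidiagonal n,
          divPow (vir Y₃ ω (-1)) q.2 * (Ring.choose p q.1 • mode Y₃ (p - q.1) v) := by
  have := mul_divPow_of_commutator (vir Y₃ ω (-1)) (fun q => Ring.choose p q • mode Y₃ (p - q) v)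
    (fun q => by
      rw [smul_mul_assoc, h, smul_add, mul_smul_comm]
      congr 1
      rw [smul_smul, ← natCast_zsmul (Ring.choose p (q + 1) • _), smul_smul]
      push_cast
      rw [succ_mul_choose_succ, mul_comm, sub_sub]) n
  simpa [Ring.choose_zero_right] using this

theorem IsTranslation.mode_divPow (h : IsTranslation ω Y₃) (v : V) (p : ℤ) (n : ℕ) (c : C) :
    mode Y₃ p v (divPow (vir Y₃ ω (-1)) n c)
      = ∑ q ∈ antidiagonal n,
          divPow (vir Y₃ ω (-1)) q.2 (Ring.choose p q.1 • mode Y₃ (p - q.1) v c) := by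
  rw [← Module.End.mul_apply, h.mode_mul_divPow, LinearMap.sum_apply]
  rfl

theorem skew_jacobi_left (hT : IsTranslation ω Y₃) {𝒴 : A →ₗ[ℂ] B →ₗ[ℂ] (ℂ → C)}
    (h : LowerTruncated 𝒴) (v : V) (a : A) (b : B) (l m : ℤ) (n : ℂ) {N : ℕ}
    (hN : ∀ k : ℕ, N ≤ k → cmode 𝒴 (n + k) a b = 0) :
    ∑ᶠ i : ℕ, ((-1 : ℤ) ^ i * Ring.choose l i) •
        mode Y₃ (m + l - i) v (cmode (skewBilin ω Y₃ r 𝒴 h) (n + i) b a)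
      = ∑ k ∈ Finset.range N, (Complex.exp (twist r * (-n - 1)) * (-1) ^ k) •
          divPow (vir Y₃ ω (-1)) k (∑ᶠ t : ℕ, ((-1 : ℤ) ^ t * Ring.choose m t) •
            mode Y₃ (l + m - t) v (cmode 𝒴 (n + k + t) a b)) := by
  have hN' : ∀ i k : ℕ, N ≤ i + k → cmode 𝒴 (n + i + k) a b = 0 := fun i k hik => by
    have := hN _ hik
    rwa [Nat.cast_add, ← add_assoc] at this
  have hΩ : ∀ i : ℕ, cmode (skewBilin ω Y₃ r 𝒴 h) (n + i) b a
      = ∑ k ∈ Finset.range N, (Complex.exp (twist r * (-n - 1)) * (-1) ^ i * (-1) ^ k) •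
          divPow (vir Y₃ ω (-1)) k (cmode 𝒴 (n + i + k) a b) := by
    intro i
    rw [cmode_skewBilin h (N := N) fun k hk => hN' i k (by omega),
      show -(n + i) - 1 = -n - 1 - i by ring, exp_twist_sub_nat, mul_comm ((-1 : ℂ) ^ i)]
  let G : ℕ → ℕ → ℕ → C := fun i q k =>
    (Complex.exp (twist r * (-n - 1)) * (-1) ^ k) • divPow (vir Y₃ ω (-1)) k
      (((-1 : ℤ) ^ q * (Ring.choose l i * Ring.choose (m + l - i) q)) •
        mode Y₃ (m + l - i - q) v (cmode 𝒴 (n + (i + q + k : ℕ)) a b))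
  have hG : ∀ i q k, N ≤ i + q + k → G i q k = 0 := fun i q k hk => by
    simp only [G]
    rw [hN _ hk]
    simp
  have e1 : ∀ i : ℕ, ((-1 : ℤ) ^ i * Ring.choose l i) •
        mode Y₃ (m + l - i) v (cmode (skewBilin ω Y₃ r 𝒴 h) (n + i) b a)
      = ∑ k ∈ Finset.range N, ∑ q ∈ antidiagonal k, G i q.1 q.2 := by
    intro i
    rw [hΩ, map_sum, Finset.smul_sum]
    refine Finset.sum_congr rfl fun k _ => ?_
    rw [map_smul, hT.mode_divPow, Finset.smul_sum, Finset.smul_sum]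
    refine Finset.sum_congr rfl fun q hq => ?_
    have hq' := mem_antidiagonal.mp hq
    simp only [G]
    rw [add_assoc, ← Nat.cast_add, ← hq', ← add_assoc, map_zsmul, map_zsmul,
      ← Int.cast_smul_eq_zsmul ℂ, ← Int.cast_smul_eq_zsmul ℂ, ← Int.cast_smul_eq_zsmul ℂ,
      smul_smul, smul_smul, smul_smul]
    congr 1
    simp only [Int.cast_mul, Int.cast_pow, Int.cast_neg, Int.cast_one, pow_add]
    linear_combination (Complex.exp (twist r * (-n - 1)) * (-1) ^ q.1 * (-1) ^ q.2
      * ((Ring.choose l i : ℤ) : ℂ) * ((Ring.choose (m + l - i) q.1 : ℤ) : ℂ)) * neg_one_pow_mul_self i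
  rw [finsum_congr e1, finsum_eq_sum_range (N := N)]
  · have e2 : ∀ i, ∑ k ∈ Finset.range N, ∑ q ∈ antidiagonal k, G i q.1 q.2
        = ∑ k ∈ Finset.range N, ∑ q ∈ Finset.range N, G i q k := fun i => by
      rw [Finset.sum_comm, sum_range_range_eq_sum_antidiagonal]
      exact fun q k hqk => hG _ _ _ (by omega)
    simp only [e2]
    rw [Finset.sum_comm]
    refine Finset.sum_congr rfl fun k _ => ?_
    rw [sum_range_range_eq_sum_antidiagonal (fun i q hiq => hG _ _ _ (by omega)),
      finsum_eq_sum_range (N := N)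
        (fun t ht => by rw [hN' k t (by omega), map_zero, smul_zero]),
      map_sum, Finset.smul_sum]
    refine Finset.sum_congr rfl fun t _ => ?_
    have hc : (-1 : ℤ) ^ t * Ring.choose m t
        = ∑ p ∈ antidiagonal t,
          (-1 : ℤ) ^ p.2 * (Ring.choose l p.1 * Ring.choose (m + l - p.1) p.2) := by
      have := choose_alternating_convolution l (m + l) t
      rw [add_sub_cancel_right] at this
      rw [← this, Finset.mul_sum]
      refine Finset.sum_congr rfl fun p hp => ?_
      rw [← mem_antidiagonal.mp hp, pow_add]
      have h1 : (-1 : ℤ) ^ p.1 * (-1) ^ p.1 = 1 := by rw [← mul_pow]; norm_num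
      linear_combination ((-1 : ℤ) ^ p.2 * Ring.choose l p.1 * Ring.choose (m + l - p.1) p.2) * h1
    rw [hc, Finset.sum_smul, map_sum, Finset.smul_sum]
    refine Finset.sum_congr rfl fun p hp => ?_
    have hp' := mem_antidiagonal.mp hp
    simp only [G]
    rw [hp', add_comm t k, sub_sub, ← Nat.cast_add (R := ℤ), hp', add_comm l m, Nat.cast_add,
      ← add_assoc]
  · intro i hi
    refine Finset.sum_eq_zero fun k _ => Finset.sum_eq_zero fun q _ => hG _ _ _ (by omega)

theorem IntertwiningJacobi.skewBilin (hT : IsTranslation ω Y₃) {𝒴 : A →ₗ[ℂ] B →ₗ[ℂ] (ℂ → C)}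
    (h : LowerTruncated 𝒴) (hJ : IntertwiningJacobi Y₁ Y₂ Y₃ 𝒴) :
    IntertwiningJacobi Y₂ Y₁ Y₃ (skewBilin ω Y₃ r 𝒴 h) := by
  intro v b a l m n
  have b1 : ∀ᶠ N : ℕ in Filter.atTop, ∀ i k : ℕ, N ≤ i ∨ N ≤ k →
      cmode 𝒴 (n + l - i + k) (mode Y₁ (m + i) v a) b = 0 := by
    refine eventually_box ?_ fun i => (h.eventually _ _ _).exists
    obtain ⟨N, hN⟩ := (mode_eventually Y₁ v a m).exists
    exact ⟨N, fun i hi k => by simp [hN i hi, cmode]⟩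
  have b2 : ∀ᶠ N : ℕ in Filter.atTop, ∀ i k : ℕ, N ≤ i ∨ N ≤ k →
      cmode 𝒴 (m + n - i + k) a (mode Y₂ (l + i) v b) = 0 := by
    refine eventually_box ?_ fun i => (h.eventually _ _ _).exists
    obtain ⟨N, hN⟩ := (mode_eventually Y₂ v b l).exists
    exact ⟨N, fun i hi k => by simp [hN i hi, cmode]⟩
  obtain ⟨N, hN, hN1, hN2⟩ := ((h.eventually a b n).and (b1.and b2)).exists
  rw [skew_jacobi_left hT h v a b l m n hN]
  have c1 : (-1 : ℂ) ^ l • (∑ᶠ i : ℕ, ((-1 : ℤ) ^ i * Ring.choose l i) •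
          cmode (VOA.skewBilin ω Y₃ r 𝒴 h) (n + l - i) b (mode Y₁ (m + i) v a))
      = ∑ k ∈ Finset.range N, (Complex.exp (twist r * (-n - 1)) * (-1) ^ k) •
          divPow (vir Y₃ ω (-1)) k (∑ᶠ i : ℕ, Ring.choose l i •
            cmode 𝒴 (l + (n + k) - i) (mode Y₁ (m + i) v a) b) := by
    have e1 : ∀ k : ℕ, (∑ᶠ i : ℕ, Ring.choose l i •
            cmode 𝒴 (l + (n + k) - i) (mode Y₁ (m + i) v a) b)
        = ∑ i ∈ Finset.range N, Ring.choose l i •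
            cmode 𝒴 (l + (n + k) - i) (mode Y₁ (m + i) v a) b := fun k =>
      finsum_eq_sum_range fun i hi => by
        have := hN1 i k (Or.inl hi)
        rw [show (l : ℂ) + (n + k) - i = n + l - i + k by ring, this, smul_zero]
    simp only [e1, map_sum, Finset.smul_sum]
    rw [Finset.sum_comm, finsum_eq_sum_range (N := N), Finset.smul_sum]
    · refine Finset.sum_congr rfl fun i _ => ?_
      rw [cmode_skewBilin h (N := N) fun k hk => hN1 i k (Or.inr hk), Finset.smul_sum,
        Finset.smul_sum]
      refine Finset.sum_congr rfl fun k _ => ?_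
      rw [show -(n + l - i) - 1 = (-n - 1) + (i - l : ℤ) by push_cast; ring, exp_twist_add_int,
        neg_one_zpow_sub, show (l : ℂ) + (n + k) - i = n + l - i + k by ring, map_zsmul,
        ← Int.cast_smul_eq_zsmul ℂ, ← Int.cast_smul_eq_zsmul ℂ, smul_smul, smul_smul, smul_smul]
      congr 1
      simp only [Int.cast_mul, Int.cast_pow, Int.cast_neg, Int.cast_one]
      linear_combination (Complex.exp (twist r * (-n - 1)) * (-1) ^ k * ((Ring.choose l i : ℤ) : ℂ))
        * (((-1) ^ i * (-1) ^ i) * neg_one_zpow_mul_self l + neg_one_pow_mul_self i)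
    · intro i hi
      rw [cmode_skewBilin h (N := 0) fun k _ => hN1 i k (Or.inl hi), Finset.sum_range_zero,
        smul_zero]
  have c2 : ∑ᶠ i : ℕ, Ring.choose m i •
        cmode (VOA.skewBilin ω Y₃ r 𝒴 h) (m + n - i) (mode Y₂ (l + i) v b) a
      = ∑ k ∈ Finset.range N, (Complex.exp (twist r * (-n - 1)) * (-1) ^ k) •
          divPow (vir Y₃ ω (-1)) k ((-1 : ℂ) ^ m • ∑ᶠ i : ℕ, ((-1 : ℤ) ^ i * Ring.choose m i) •
            cmode 𝒴 ((n + k) + m - i) a (mode Y₂ (l + i) v b)) := by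
    have e1 : ∀ k : ℕ, (∑ᶠ i : ℕ, ((-1 : ℤ) ^ i * Ring.choose m i) •
            cmode 𝒴 ((n + k) + m - i) a (mode Y₂ (l + i) v b))
        = ∑ i ∈ Finset.range N, ((-1 : ℤ) ^ i * Ring.choose m i) •
            cmode 𝒴 ((n + k) + m - i) a (mode Y₂ (l + i) v b) := fun k =>
      finsum_eq_sum_range fun i hi => by
        have := hN2 i k (Or.inl hi)
        rw [show (n + k) + (m : ℂ) - i = m + n - i + k by ring, this, smul_zero]
    simp only [e1, map_sum, Finset.smul_sum]
    rw [Finset.sum_comm, finsum_eq_sum_range (N := N)]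
    · refine Finset.sum_congr rfl fun i _ => ?_
      rw [cmode_skewBilin h (N := N) fun k hk => hN2 i k (Or.inr hk), Finset.smul_sum]
      refine Finset.sum_congr rfl fun k _ => ?_
      rw [show -(m + n - i) - 1 = (-n - 1) + (i - m : ℤ) by push_cast; ring, exp_twist_add_int,
        neg_one_zpow_sub, show (n + k) + (m : ℂ) - i = m + n - i + k by ring, map_smul, map_zsmul,
        ← Int.cast_smul_eq_zsmul ℂ, ← Int.cast_smul_eq_zsmul ℂ, smul_smul, smul_smul, smul_smul]
      congr 1
      simp only [Int.cast_mul, Int.cast_pow, Int.cast_neg, Int.cast_one]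
      ring
    · intro i hi
      rw [cmode_skewBilin h (N := 0) fun k _ => hN2 i k (Or.inl hi), Finset.sum_range_zero,
        smul_zero]
  rw [c1, c2, ← Finset.sum_sub_distrib]
  refine Finset.sum_congr rfl fun k _ => ?_
  rw [← smul_sub, ← map_sub, ← hJ v a b m l (n + k), sub_sub_cancel]

/-- `[L(-1), 𝒴(a, x)] = 𝒴(L(-1)a, x)`. -/
theorem IsIntertwining.vir_neg_one_commutator {𝒴 : A →ₗ[ℂ] B →ₗ[ℂ] (ℂ → C)}
    (h : IsIntertwining ω Y₁ Y₂ Y₃ 𝒴) (a : A) (b : B) (s : ℂ) :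
    vir Y₃ ω (-1) (𝒴 a b s) = 𝒴 a (vir Y₂ ω (-1) b) s + (s + 1) • 𝒴 a b (s + 1) := by
  have e := h.jacobi ω a b 0 0 (-s - 1)
  rw [finsum_eq_single _ 0 (fun i hi => by
      rw [Ring.choose_zero_pos ℤ (Nat.pos_of_ne_zero hi)]; simp),
    finsum_eq_single _ 0 (fun i hi => by
      rw [Ring.choose_zero_pos ℤ (Nat.pos_of_ne_zero hi)]; simp),
    finsum_eq_single _ 0 (fun i hi => by
      rw [Ring.choose_zero_pos ℤ (Nat.pos_of_ne_zero hi)]; simp)] at e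
  rw [h.vir_neg_one]
  simpa [cmode, vir, Ring.choose_zero_right, sub_eq_iff_eq_add'] using e

theorem IsIntertwining.skewBilin (hT : IsTranslation ω Y₃) {𝒴 : A →ₗ[ℂ] B →ₗ[ℂ] (ℂ → C)}
    (h : IsIntertwining ω Y₁ Y₂ Y₃ 𝒴) :
    IsIntertwining ω Y₂ Y₁ Y₃ (skewBilin ω Y₃ r 𝒴 h.truncated) where
  truncated := h.truncated.skewBilin
  jacobi := h.jacobi.skewBilin hT h.truncated
  vir_neg_one := by
    intro b a s
    obtain ⟨N, h1, h2⟩ := ((h.truncated.eventually_coeff a b (s + 1)).and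
      (h.truncated.eventually_coeff a (vir Y₂ ω (-1) b) s)).exists
    have h1' : ∀ k : ℕ, N + 1 ≤ k → 𝒴 a b (s + 1 - k) = 0 := fun k hk => h1 k (by omega)
    have eL : VOA.skewBilin ω Y₃ r 𝒴 h.truncated b a (s + 1) = _ := skew_eq_sum ω Y₃ r h1'
    have eR : VOA.skewBilin ω Y₃ r 𝒴 h.truncated (vir Y₂ ω (-1) b) a s = _ := skew_eq_sum ω Y₃ r h2
    have hη : Complex.exp (twist r * (s + 1)) = - Complex.exp (twist r * s) := by
      have := exp_twist_add_int r 1 s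
      simpa using this
    have e1 : ∀ k : ℕ, 𝒴 a (vir Y₂ ω (-1) b) (s - k)
        = vir Y₃ ω (-1) (𝒴 a b (s - k)) - (s - k + 1) • 𝒴 a b (s - k + 1) := fun k => by
      rw [h.vir_neg_one_commutator, add_sub_cancel_right]
    have e2 : ∀ k : ℕ, divPow (vir Y₃ ω (-1)) k (vir Y₃ ω (-1) (𝒴 a b (s - k)))
        = ((k : ℂ) + 1) • divPow (vir Y₃ ω (-1)) (k + 1) (𝒴 a b (s + 1 - (k + 1 : ℕ))) := by
      intro k
      rw [← Module.End.mul_apply, divPow_mul, ← Nat.cast_smul_eq_nsmul ℂ, LinearMap.smul_apply]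
      push_cast
      rw [add_sub_add_right_eq_sub]
    rw [eL, eR]
    simp only [e1, map_sub, smul_sub, Finset.sum_sub_distrib, e2]
    have e3 : ∑ k ∈ Finset.range N, (Complex.exp (twist r * s) * (-1) ^ k) •
          ((k : ℂ) + 1) • divPow (vir Y₃ ω (-1)) (k + 1) (𝒴 a b (s + 1 - (k + 1 : ℕ)))
        = ∑ k ∈ Finset.range (N + 1), (Complex.exp (twist r * (s + 1)) * (-1) ^ k) •
          (k : ℂ) • divPow (vir Y₃ ω (-1)) k (𝒴 a b (s + 1 - k)) := by
      rw [Finset.sum_range_succ']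
      simp only [Nat.cast_zero, zero_smul, smul_zero, add_zero]
      refine Finset.sum_congr rfl fun k _ => ?_
      rw [hη, pow_succ, Nat.cast_succ]
      congr 1
      ring
    have e4 : ∑ k ∈ Finset.range N, (Complex.exp (twist r * s) * (-1) ^ k) •
          divPow (vir Y₃ ω (-1)) k ((s - k + 1) • 𝒴 a b (s - k + 1))
        = ∑ k ∈ Finset.range (N + 1), (Complex.exp (twist r * s) * (-1) ^ k) •
          (s - k + 1) • divPow (vir Y₃ ω (-1)) k (𝒴 a b (s + 1 - k)) := by
      rw [Finset.sum_range_succ, h1 N le_rfl, map_zero, smul_zero, smul_zero, add_zero]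
      refine Finset.sum_congr rfl fun k _ => ?_
      rw [map_smul, sub_add_eq_add_sub]
    rw [e3, e4, ← Finset.sum_sub_distrib, Finset.smul_sum]
    refine Finset.sum_congr rfl fun k _ => ?_
    rw [hη, smul_smul, smul_smul, smul_smul, ← sub_smul]
    congr 1
    ring

/-- `Ω_r` as a linear isomorphism between spaces of intertwining operators. -/
def skewEquiv (ω : V) (Y₁ : V →ₗ[ℂ] VertexOperator ℂ A) (Y₂ : V →ₗ[ℂ] VertexOperator ℂ B)
    (Y₃ : V →ₗ[ℂ] VertexOperator ℂ C) (hT : IsTranslation ω Y₃) (r : ℤ) :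
    intertwining ω Y₁ Y₂ Y₃ ≃ₗ[ℂ] intertwining ω Y₂ Y₁ Y₃ where
  toFun 𝒴 := ⟨skewBilin ω Y₃ r 𝒴.1 𝒴.2.truncated, 𝒴.2.skewBilin hT⟩
  invFun 𝒴 := ⟨skewBilin ω Y₃ (-r - 1) 𝒴.1 𝒴.2.truncated, 𝒴.2.skewBilin hT⟩
  map_add' 𝒴 𝒵 := by
    refine Subtype.ext ?_
    ext b a s
    obtain ⟨N, h1, h2⟩ := ((𝒴.2.truncated.eventually_coeff a b s).and
      (𝒵.2.truncated.eventually_coeff a b s)).exists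
    have h3 : ∀ k : ℕ, N ≤ k → (𝒴 + 𝒵).1 a b (s - k) = 0 := fun k hk => by
      simp [h1 k hk, h2 k hk]
    refine (skew_eq_sum ω Y₃ r h3).trans ?_
    refine Eq.trans ?_ (congrArg₂ (· + ·) (skew_eq_sum ω Y₃ r h1) (skew_eq_sum ω Y₃ r h2)).symm
    simp [Finset.sum_add_distrib]
  map_smul' c 𝒴 := by
    refine Subtype.ext ?_
    ext b a s
    obtain ⟨N, h1⟩ := (𝒴.2.truncated.eventually_coeff a b s).exists
    have h3 : ∀ k : ℕ, N ≤ k → (c • 𝒴).1 a b (s - k) = 0 := fun k hk => by simp [h1 k hk]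
    refine (skew_eq_sum ω Y₃ r h3).trans ?_
    refine Eq.trans ?_ (congrArg (c • ·) (skew_eq_sum ω Y₃ r h1)).symm
    rw [Finset.smul_sum]
    refine Finset.sum_congr rfl fun k _ => ?_
    rw [smul_comm c, ← map_smul (divPow _ k) c]
    rfl
  left_inv 𝒴 := Subtype.ext (skewBilin_skewBilin 𝒴.2.truncated)
  right_inv 𝒴 := by
    refine Subtype.ext ?_
    have := skewBilin_skewBilin (ω := ω) (Y₃ := Y₃) (r := -r - 1) 𝒴.2.truncated
    rwa [show -(-r - 1) - 1 = r by ring] at this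

theorem skewEquiv_apply (hT : IsTranslation ω Y₃) (𝒴 : intertwining ω Y₁ Y₂ Y₃) (b : B) (a : A) :
    (skewEquiv ω Y₁ Y₂ Y₃ hT r 𝒴).1 b a = skew ω Y₃ r 𝒴.1 b a := rfl

end SkewJacobi

section Modules

variable {V : Type*} [AddCommGroup V] [Module ℂ V] {𝓥 : VertexOperatorAlgebra V}
  {W : Type*} [AddCommGroup W] [Module ℂ W]

/-- The operator `L(n)` on the vertex operator algebra. -/
abbrev VertexOperatorAlgebra.L (𝓥 : VertexOperatorAlgebra V) (n : ℤ) : Module.End ℂ V :=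
  vir 𝓥.Y 𝓥.conf n

/-- The operator `L(n)` on a module. -/
abbrev VOAModule.L (M : VOAModule 𝓥 W) (n : ℤ) : Module.End ℂ W := vir M.Y 𝓥.conf n

theorem ActionJacobi.commutator {YV : V →ₗ[ℂ] VertexOperator ℂ V}
    {Y : V →ₗ[ℂ] VertexOperator ℂ W} (h : ActionJacobi YV Y) (u v : V) (m n : ℤ) (w : W) :
    mode Y m u (mode Y n v w) - mode Y n v (mode Y m u w)
      = ∑ᶠ i : ℕ, Ring.choose m i • mode Y (m + n - i) (mode YV i u v) w := by
  have e := h u v w 0 m n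
  rw [finsum_eq_single _ 0 (fun i hi => by
      rw [Ring.choose_zero_pos ℤ (Nat.pos_of_ne_zero hi)]; simp),
    finsum_eq_single _ 0 (fun i hi => by
      rw [Ring.choose_zero_pos ℤ (Nat.pos_of_ne_zero hi)]; simp)] at e
  simpa [Ring.choose_zero_right] using e

theorem VOAModule.isTranslation (M : VOAModule 𝓥 W) : IsTranslation 𝓥.conf M.Y := by
  intro v p
  refine LinearMap.ext fun w => ?_
  have e := M.jacobi.commutator 𝓥.conf v 0 p w
  rw [finsum_eq_single _ 0 (fun i hi => by
      rw [Ring.choose_zero_pos ℤ (Nat.pos_of_ne_zero hi)]; simp)] at e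
  have h1 := M.vir_neg_one v w p
  simp only [vir] at h1 ⊢
  norm_num [Ring.choose_zero_right] at e h1 ⊢
  rw [h1, sub_eq_iff_eq_add] at e
  rw [e, ← Int.cast_smul_eq_zsmul ℂ]
  module

theorem choose_two_eq_zero {i : ℕ} (hi : 3 ≤ i) : Ring.choose (2 : ℤ) i = 0 := by
  have h := Ring.choose_natCast (R := ℤ) 2 i
  rw [Nat.choose_eq_zero_of_lt (by omega)] at h
  exact_mod_cast h

/-- `[L(1), v_n] = (2h - n - 2) v_{n+1} + (L(1)v)_n` for `v` of weight `h`. -/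
theorem VOAModule.L_one_mul_mode (M : VOAModule 𝓥 W) {h : ℤ} {v : V} (hv : v ∈ 𝓥.weight h)
    (n : ℤ) :
    M.L 1 * mode M.Y n v = mode M.Y n v * M.L 1 + (2 * h - n - 2) • mode M.Y (n + 1) v
      + mode M.Y n (𝓥.L 1 v) := by
  refine LinearMap.ext fun w => ?_
  have e := M.jacobi.commutator 𝓥.conf v 2 n w
  rw [finsum_eq_sum_range (N := 3) (fun i hi => by rw [choose_two_eq_zero hi, zero_smul])] at e
  have h1 := M.vir_neg_one v w (2 + n)
  have h0 := 𝓥.vir_zero h v hv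
  have c0 : Ring.choose (2 : ℤ) 0 = 1 := Ring.choose_zero_right _
  have c1 : Ring.choose (2 : ℤ) 1 = 2 := Ring.choose_one_right _
  have c2 : Ring.choose (2 : ℤ) 2 = 1 := by
    have h := Ring.choose_natCast (R := ℤ) 2 2
    exact_mod_cast h
  simp only [VOAModule.L, VertexOperatorAlgebra.L, vir] at h1 h0 ⊢
  norm_num [Finset.sum_range_succ, c0, c1, c2] at e h1 h0 ⊢
  rw [h1, h0, sub_eq_iff_eq_add] at e
  rw [e, map_smul, LinearMap.smul_apply, show (2 + n - 1) = n + 1 by ring,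
    ← Int.cast_smul_eq_zsmul ℂ h, ← Int.cast_smul_eq_zsmul ℂ n]
  module

theorem VertexOperatorAlgebra.divPow_L_one_mem {h : ℤ} {v : V} (hv : v ∈ 𝓥.weight h) (k : ℕ) :
    divPow (𝓥.L 1) k v ∈ 𝓥.weight (h - k) :=
  Submodule.smul_mem _ _ (vir_one_pow_mem hv k)

theorem VertexOperatorAlgebra.eventually_divPow_L_one {h : ℤ} {v : V} (hv : v ∈ 𝓥.weight h) :
    ∀ᶠ K : ℕ in Filter.atTop, ∀ k, K ≤ k → divPow (𝓥.L 1) k v = 0 := by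
  obtain ⟨N, hN⟩ := 𝓥.weight_eq_bot
  refine Filter.eventually_atTop.mpr ⟨(h - N).toNat + 1, fun K hK k hk => ?_⟩
  have h1 := 𝓥.divPow_L_one_mem hv k
  rwa [hN (h - k) (by omega), Submodule.mem_bot] at h1

theorem VOAModule.L_mem (M : VOAModule 𝓥 W) {h : ℂ} {w : W} (hw : w ∈ M.weight h) (n : ℤ) :
    M.L n w ∈ M.weight (h - n) := by
  have := M.mode_mem 𝓥.conf_mem hw (n + 1)
  rwa [show h + ((2 : ℤ) - ((n + 1 : ℤ) : ℂ) - 1) = h - n by push_cast; ring] at this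

theorem VOAModule.divPow_L_one_mem (M : VOAModule 𝓥 W) {h : ℂ} {w : W} (hw : w ∈ M.weight h)
    (k : ℕ) : divPow (M.L 1) k w ∈ M.weight (h - k) := by
  refine Submodule.smul_mem _ _ ?_
  induction k with
  | zero => simpa using hw
  | succ k ih =>
    rw [pow_succ', Module.End.mul_apply]
    have := M.L_mem ih 1
    rwa [show h - ((k + 1 : ℕ) : ℂ) = h - k - (1 : ℤ) by push_cast; ring]

theorem VOAModule.eventually_divPow_L_one (M : VOAModule 𝓥 W) (w : W) :
    ∀ᶠ K : ℕ in Filter.atTop, ∀ k, K ≤ k → divPow (M.L 1) k w = 0 := by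
  induction w using homog_induction M.isInternal with
  | h0 => simp
  | hadd x y hx hy =>
    filter_upwards [hx, hy] with K h1 h2 k hk
    rw [map_add, h1 k hk, h2 k hk, add_zero]
  | hom h w hw =>
    obtain ⟨N, hN⟩ := M.weight_eq_bot
    obtain ⟨K, hK⟩ := exists_nat_gt (h.re - N)
    refine Filter.eventually_atTop.mpr ⟨K, fun K' hK' k hk => ?_⟩
    have h1 := M.divPow_L_one_mem hw k
    have h2 : (K : ℝ) ≤ k := by exact_mod_cast hK'.trans hk
    rwa [hN (h - k) (by simp; linarith), Submodule.mem_bot] at h1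

theorem VOAModule.L_one_mul_mode_divPow (M : VOAModule 𝓥 W) {h : ℤ} {v : V}
    (hv : v ∈ 𝓥.weight h) (n : ℤ) (k : ℕ) :
    M.L 1 * mode M.Y n (divPow (𝓥.L 1) k v) = mode M.Y n (divPow (𝓥.L 1) k v) * M.L 1
      + (2 * h - 2 * k - n - 2) • mode M.Y (n + 1) (divPow (𝓥.L 1) k v)
      + (k + 1) • mode M.Y n (divPow (𝓥.L 1) (k + 1) v) := by
  rw [M.L_one_mul_mode (𝓥.divPow_L_one_mem hv k) n, ← Module.End.mul_apply (𝓥.L 1), mul_divPow,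
    LinearMap.smul_apply, map_nsmul, show 2 * (h - (k : ℤ)) - n - 2 = 2 * h - 2 * k - n - 2 by ring]

/-- The formula for `e^{xL(1)} Y(v, x₀) e^{-xL(1)}`, degree by degree. -/
theorem VOAModule.divPow_L_one_mul_mode (M : VOAModule 𝓥 W) {h : ℤ} {v : V}
    (hv : v ∈ 𝓥.weight h) (n : ℤ) (J : ℕ) :
    divPow (M.L 1) J * mode M.Y n v = ∑ q ∈ antidiagonal J, (∑ p ∈ antidiagonal q.1,
      Ring.choose (2 * h - p.1 - n - 2) p.2 • mode M.Y (n + p.2) (divPow (𝓥.L 1) p.1 v))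
        * divPow (M.L 1) q.2 := by
  have := divPow_mul_of_commutator (M.L 1) (fun q => ∑ p ∈ antidiagonal q,
    Ring.choose (2 * h - p.1 - n - 2) p.2 • mode M.Y (n + p.2) (divPow (𝓥.L 1) p.1 v)) ?_ J
  · simpa [Ring.choose_zero_right] using this
  intro q
  rw [Finset.mul_sum, Finset.sum_mul]
  have e1 : ∀ p : ℕ × ℕ, M.L 1 * (Ring.choose (2 * h - p.1 - n - 2) p.2 •
        mode M.Y (n + p.2) (divPow (𝓥.L 1) p.1 v))
      = (Ring.choose (2 * h - p.1 - n - 2) p.2 •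
        mode M.Y (n + p.2) (divPow (𝓥.L 1) p.1 v)) * M.L 1
      + ((Ring.choose (2 * h - p.1 - n - 2) p.2 * (2 * h - 2 * p.1 - (n + p.2) - 2)) •
          mode M.Y (n + (p.2 + 1 : ℕ)) (divPow (𝓥.L 1) p.1 v)
        + (p.1 + 1) • (Ring.choose (2 * h - (p.1 + 1 : ℕ) - n - 2 + 1) p.2 •
          mode M.Y (n + p.2) (divPow (𝓥.L 1) (p.1 + 1) v))) := by
    intro p
    rw [mul_smul_comm, M.L_one_mul_mode_divPow hv, smul_add, smul_add, smul_mul_assoc, add_assoc,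
      smul_smul, smul_comm _ (p.1 + 1)]
    push_cast
    rw [add_assoc n, show 2 * h - ((p.1 : ℤ) + 1) - n - 2 + 1 = 2 * h - p.1 - n - 2 by ring]
  simp only [e1, Finset.sum_add_distrib]
  congr 1
  let G : ℕ → ℕ → Module.End ℂ W := fun k p => Nat.casesOn p 0 fun p =>
    (Ring.choose (2 * h - k - n - 2) p * (2 * h - 2 * k - (n + p) - 2)) •
      mode M.Y (n + (p + 1 : ℕ)) (divPow (𝓥.L 1) k v)
  have hG := Finset.Nat.sum_antidiagonal_succ' (n := q) (f := fun x => G x.1 x.2)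
  have hG0 : G (q + 1) 0 = 0 := rfl
  rw [hG0, zero_add] at hG
  rw [← sum_antidiagonal_fst_smul (fun k p => Ring.choose (2 * h - k - n - 2 + 1) p •
          mode M.Y (n + p) (divPow (𝓥.L 1) k v)) q, ← hG, ← Finset.sum_add_distrib, Finset.smul_sum]
  refine Finset.sum_congr rfl fun p hp => ?_
  rw [← mem_antidiagonal.mp hp]
  obtain ⟨k, p⟩ := p
  rcases p with _ | p
  · simp [G]
  · simp only [G]
    rw [← natCast_zsmul, ← natCast_zsmul, smul_smul, smul_smul, ← add_smul]
    congr 1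
    rw [Ring.choose_succ_succ]
    have := succ_mul_choose_succ (2 * h - k - n - 2) p
    push_cast
    linear_combination -this

theorem VOAModule.divPow_L_one_mode (M : VOAModule 𝓥 W) {h : ℤ} {v : V}
    (hv : v ∈ 𝓥.weight h) (n : ℤ) (J : ℕ) (w : W) :
    divPow (M.L 1) J (mode M.Y n v w) = ∑ q ∈ antidiagonal J, ∑ p ∈ antidiagonal q.1,
      Ring.choose (2 * h - p.1 - n - 2) p.2 •
        mode M.Y (n + p.2) (divPow (𝓥.L 1) p.1 v) (divPow (M.L 1) q.2 w) := by
  rw [← Module.End.mul_apply, M.divPow_L_one_mul_mode hv]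
  simp only [LinearMap.sum_apply, Module.End.mul_apply, LinearMap.smul_apply]

theorem VOAModule.sum_choose_divPow_L_one_mode (M : VOAModule 𝓥 W) {h : ℤ} {v : V}
    (hv : v ∈ 𝓥.weight h) (l m : ℤ) (T : ℕ) (w : W) :
    ∑ p ∈ antidiagonal T, ((-1 : ℤ) ^ p.1 * Ring.choose m p.1) •
        divPow (M.L 1) p.2 (mode M.Y (l + p.1) v w)
      = ∑ q ∈ antidiagonal T, ∑ p ∈ antidiagonal q.1,
          Ring.choose (2 * h - p.1 - m - l - 2) p.2 •
            mode M.Y (l + p.2) (divPow (𝓥.L 1) p.1 v) (divPow (M.L 1) q.2 w) := by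
  let g : ℕ → ℕ → ℕ → ℕ → W := fun i k p j =>
    ((-1 : ℤ) ^ i * Ring.choose m i * Ring.choose (2 * h - k - l - 2 - i) p) •
      mode M.Y (l + (i + p : ℕ)) (divPow (𝓥.L 1) k v) (divPow (M.L 1) j w)
  have e1 : ∀ p ∈ antidiagonal T, ((-1 : ℤ) ^ p.1 * Ring.choose m p.1) •
        divPow (M.L 1) p.2 (mode M.Y (l + p.1) v w)
      = ∑ q ∈ antidiagonal p.2, ∑ x ∈ antidiagonal q.1, g p.1 x.1 x.2 q.2 := by
    intro p _
    rw [M.divPow_L_one_mode hv, Finset.smul_sum]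
    refine Finset.sum_congr rfl fun q _ => ?_
    rw [Finset.smul_sum]
    refine Finset.sum_congr rfl fun x _ => ?_
    simp only [g]
    rw [smul_smul, Nat.cast_add, add_assoc l,
      show 2 * h - (x.1 : ℤ) - (l + p.1) - 2 = 2 * h - x.1 - l - 2 - p.1 by ring]
  rw [Finset.sum_congr rfl e1,
    ← sum_antidiagonal_assoc (fun i q j => ∑ x ∈ antidiagonal q, g i x.1 x.2 j)]
  refine Finset.sum_congr rfl fun q _ => ?_
  rw [sum_antidiagonal_left_comm (fun i k p => g i k p q.2)]
  refine Finset.sum_congr rfl fun x _ => ?_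
  have hc := choose_alternating_convolution m (2 * h - x.1 - l - 2) x.2
  rw [show 2 * h - (x.1 : ℤ) - m - l - 2 = 2 * h - x.1 - l - 2 - m by ring, ← hc, Finset.sum_smul]
  refine Finset.sum_congr rfl fun y hy => ?_
  simp only [g]
  rw [mem_antidiagonal.mp hy]

end Modules

section Opposite

variable {V : Type*} [AddCommGroup V] [Module ℂ V] {𝓥 : VertexOperatorAlgebra V}
  {A B B' C C' : Type*} [AddCommGroup A] [Module ℂ A] [AddCommGroup B] [Module ℂ B]
  [AddCommGroup B'] [Module ℂ B'] [AddCommGroup C] [Module ℂ C] [AddCommGroup C'] [Module ℂ C']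

/-- `⟨Y'(v, x) f, w⟩ = ⟨f, Y(e^{xL(1)} (-x^{-2})^{L(0)} v, x^{-1}) w⟩` for a pairing of `B'`
and `B`. -/
def IsOpposite (𝓥 : VertexOperatorAlgebra V) (Y : V →ₗ[ℂ] VertexOperator ℂ B)
    (Y' : V →ₗ[ℂ] VertexOperator ℂ B') (p : B' →ₗ[ℂ] B →ₗ[ℂ] ℂ) : Prop :=
  ∀ (h : ℤ), ∀ v ∈ 𝓥.weight h, ∀ (n : ℤ) (f : B') (w : B),
    p (mode Y' n v f) w
      = (-1) ^ h * ∑ᶠ k : ℕ, p f (mode Y (2 * h - k - n - 2) (divPow (𝓥.L 1) k v) w)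

/-- `⟨𝒵(a, x)c', b⟩ = ⟨c', 𝒴(e^{xL(1)} e^{(2r+1)πiL(0)} x^{-2L(0)} a, x^{-1})b⟩` for pairings of
`B'` and `B` and of `C'` and `C`. -/
def IsContra (M : VOAModule 𝓥 A) (r : ℤ) (pB : B' →ₗ[ℂ] B →ₗ[ℂ] ℂ) (pC : C' →ₗ[ℂ] C →ₗ[ℂ] ℂ)
    (𝒴 : A →ₗ[ℂ] B →ₗ[ℂ] (ℂ → C)) (𝒵 : A →ₗ[ℂ] C' →ₗ[ℂ] (ℂ → B')) : Prop :=
  ∀ (h : ℂ), ∀ a ∈ M.weight h, ∀ (c' : C') (b : B) (n : ℂ),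
    pB (cmode 𝒵 n a c') b = Complex.exp (twist r * h) *
      ∑ᶠ k : ℕ, pC c' (cmode 𝒴 (2 * h - k - n - 2) (divPow (M.L 1) k a) b)

variable {YB : V →ₗ[ℂ] VertexOperator ℂ B} {YB' : V →ₗ[ℂ] VertexOperator ℂ B'}
  {YC : V →ₗ[ℂ] VertexOperator ℂ C} {YC' : V →ₗ[ℂ] VertexOperator ℂ C'}
  {pB : B' →ₗ[ℂ] B →ₗ[ℂ] ℂ} {pC : C' →ₗ[ℂ] C →ₗ[ℂ] ℂ}

theorem IsOpposite.eq_sum (H : IsOpposite 𝓥 YB YB' pB) {h : ℤ} {v : V} (hv : v ∈ 𝓥.weight h)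
    {K : ℕ} (hK : ∀ k, K ≤ k → divPow (𝓥.L 1) k v = 0) (n : ℤ) (f : B') (w : B) :
    pB (mode YB' n v f) w = (-1) ^ h * ∑ k ∈ Finset.range K,
      pB f (mode YB (2 * h - k - n - 2) (divPow (𝓥.L 1) k v) w) := by
  rw [H h v hv, finsum_eq_sum_range fun k hk => by simp [hK k hk]]

theorem IsOpposite.symm (H : IsOpposite 𝓥 YB YB' pB) : IsOpposite 𝓥 YB' YB pB.flip := by
  intro h v hv n w f
  obtain ⟨K, hK⟩ := (VertexOperatorAlgebra.eventually_divPow_L_one hv).exists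
  have hK2 : ∀ j k, K ≤ k + j → divPow (𝓥.L 1) j (divPow (𝓥.L 1) k v) = 0 := fun j k hjk => by
    rw [← Module.End.mul_apply, divPow_mul_divPow, LinearMap.smul_apply, hK _ (by omega),
      smul_zero]
  rw [finsum_eq_sum_range (N := K) fun k hk => by simp [hK k hk], Finset.mul_sum]
  simp only [LinearMap.flip_apply]
  have e1 : ∀ k ∈ Finset.range K, (-1 : ℂ) ^ h *
        pB (mode YB' (2 * h - k - n - 2) (divPow (𝓥.L 1) k v) f) w
      = ∑ j ∈ Finset.range K, pB f (mode YB (n - (k + j : ℕ))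
          ((-1 : ℂ) ^ k • (divPow (𝓥.L 1) k * divPow (𝓥.L 1) j) v) w) := by
    intro k _
    rw [H.eq_sum (𝓥.divPow_L_one_mem hv k) (K := K) (fun j hj => hK2 j k (by omega)), ← mul_assoc,
      Finset.mul_sum]
    refine Finset.sum_congr rfl fun j _ => ?_
    rw [divPow_mul_divPow_comm, Module.End.mul_apply, map_smul, LinearMap.smul_apply, map_smul,
      smul_eq_mul, show 2 * (h - (k : ℤ)) - j - (2 * h - k - n - 2) - 2 = n - (k + j : ℕ) by
        push_cast; ring, ← neg_sub (k : ℤ) h, zpow_neg, neg_one_zpow_sub, mul_inv,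
      ← zpow_neg_one ((-1 : ℂ) ^ h), ← zpow_mul, ← mul_assoc, ← zpow_add₀ (by norm_num), ← inv_pow]
    norm_num
  rw [Finset.sum_congr rfl e1, sum_range_range_eq_sum_antidiagonal]
  · have e2 : ∀ t ∈ Finset.range K, ∑ p ∈ antidiagonal t, pB f (mode YB (n - (p.1 + p.2 : ℕ))
          ((-1 : ℂ) ^ p.1 • (divPow (𝓥.L 1) p.1 * divPow (𝓥.L 1) p.2) v) w)
        = pB f (mode YB (n - t) ((if t = 0 then (1 : Module.End ℂ V) else 0) v) w) := by
      intro t _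
      rw [← sum_antidiagonal_neg_one_pow_divPow (𝓥.L 1) t, LinearMap.sum_apply, map_sum,
        LinearMap.sum_apply, map_sum]
      refine Finset.sum_congr rfl fun p hp => ?_
      rw [mem_antidiagonal.mp hp]
      rfl
    rw [Finset.sum_congr rfl e2]
    rcases K with _ | K
    · have := hK 0 le_rfl
      rw [divPow_zero, Module.End.one_apply] at this
      simp [this]
    · rw [Finset.sum_range_succ']
      simp
  · intro k j hjk
    rw [divPow_mul_divPow_comm, Module.End.mul_apply, hK2 j k hjk]
    simp

variable {M : VOAModule 𝓥 A} {r : ℤ} {𝒴 : A →ₗ[ℂ] B →ₗ[ℂ] (ℂ → C)}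
  {𝒵 : A →ₗ[ℂ] C' →ₗ[ℂ] (ℂ → B')}

theorem cmode_zero_left (n : ℂ) (b : B) : cmode 𝒴 n 0 b = 0 := by simp [cmode]

theorem IsContra.eq_sum (H : IsContra M r pB pC 𝒴 𝒵) {h : ℂ} {a : A} (ha : a ∈ M.weight h)
    {K : ℕ} (hK : ∀ k, K ≤ k → divPow (M.L 1) k a = 0) (c' : C') (b : B) (n : ℂ) :
    pB (cmode 𝒵 n a c') b = Complex.exp (twist r * h) * ∑ k ∈ Finset.range K,
      pC c' (cmode 𝒴 (2 * h - k - n - 2) (divPow (M.L 1) k a) b) := by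
  rw [H h a ha, finsum_eq_sum_range fun k hk => by rw [hK k hk, cmode_zero_left, map_zero]]

theorem IsContra.symm (H : IsContra M r pB pC 𝒴 𝒵) :
    IsContra M (-r - 1) pC.flip pB.flip 𝒵 𝒴 := by
  intro h a ha b c' n
  obtain ⟨K, hK⟩ := (M.eventually_divPow_L_one a).exists
  have hK2 : ∀ j k, K ≤ k + j → divPow (M.L 1) j (divPow (M.L 1) k a) = 0 := fun j k hjk => by
    rw [← Module.End.mul_apply, divPow_mul_divPow, LinearMap.smul_apply, hK _ (by omega),
      smul_zero]
  rw [finsum_eq_sum_range (N := K) fun k hk => by rw [hK k hk, cmode_zero_left, map_zero],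
    Finset.mul_sum]
  simp only [LinearMap.flip_apply]
  have e1 : ∀ k ∈ Finset.range K, Complex.exp (twist (-r - 1) * h) *
        pB (cmode 𝒵 (2 * h - k - n - 2) (divPow (M.L 1) k a) c') b
      = ∑ j ∈ Finset.range K, pC c' (cmode 𝒴 (n - (k + j : ℕ))
          ((-1 : ℂ) ^ k • (divPow (M.L 1) k * divPow (M.L 1) j) a) b) := by
    intro k _
    rw [H.eq_sum (M.divPow_L_one_mem ha k) (K := K) (fun j hj => hK2 j k (by omega)), ← mul_assoc,
      Finset.mul_sum]
    refine Finset.sum_congr rfl fun j _ => ?_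
    rw [divPow_mul_divPow_comm, Module.End.mul_apply, exp_twist_sub_nat,
      show 2 * (h - (k : ℂ)) - j - (2 * h - k - n - 2) - 2 = n - (k + j : ℕ) by push_cast; ring]
    simp only [cmode, map_smul, LinearMap.smul_apply, Pi.smul_apply, smul_eq_mul]
    linear_combination ((-1 : ℂ) ^ k * pC c' (𝒴 (divPow (M.L 1) j (divPow (M.L 1) k a)) b
      (-(n - (k + j : ℕ)) - 1))) * exp_twist_mul_exp_twist_neg r h
  rw [Finset.sum_congr rfl e1, sum_range_range_eq_sum_antidiagonal]
  · have e2 : ∀ t ∈ Finset.range K, ∑ p ∈ antidiagonal t, pC c' (cmode 𝒴 (n - (p.1 + p.2 : ℕ))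
          ((-1 : ℂ) ^ p.1 • (divPow (M.L 1) p.1 * divPow (M.L 1) p.2) a) b)
        = pC c' (cmode 𝒴 (n - t) ((if t = 0 then (1 : Module.End ℂ A) else 0) a) b) := by
      intro t _
      rw [← sum_antidiagonal_neg_one_pow_divPow (M.L 1) t]
      simp only [cmode, map_sum, LinearMap.sum_apply, Finset.sum_apply]
      refine Finset.sum_congr rfl fun p hp => ?_
      rw [mem_antidiagonal.mp hp]
      rfl
    rw [Finset.sum_congr rfl e2]
    rcases K with _ | K
    · have := hK 0 le_rfl
      rw [divPow_zero, Module.End.one_apply] at this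
      simp [this, cmode]
    · rw [Finset.sum_range_succ']
      simp [cmode]
  · intro k j hjk
    rw [divPow_mul_divPow_comm, Module.End.mul_apply, hK2 j k hjk]
    simp [cmode]

/-- The transformation of the iterate side of the Jacobi identity under `x ↦ x^{-1}`. -/
theorem VOAModule.finsum_choose_divPow_L_one_mode (M : VOAModule 𝓥 A) {h : ℤ} {v : V}
    (hv : v ∈ 𝓥.weight h) (a : A) (l m : ℤ) (F : ℕ → A →ₗ[ℂ] ℂ) {K : ℕ}
    (hKv : ∀ k, K ≤ k → divPow (𝓥.L 1) k v = 0) (hKa : ∀ k, K ≤ k → divPow (M.L 1) k a = 0) :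
    ∑ᶠ i : ℕ, ∑ᶠ j : ℕ, ((-1 : ℤ) ^ i * Ring.choose m i) •
        F (i + j) (divPow (M.L 1) j (mode M.Y (l + i) v a))
      = ∑ k ∈ Finset.range K, ∑ j ∈ Finset.range K, ∑ᶠ i : ℕ,
          Ring.choose (2 * h - k - m - l - 2) i •
            F (k + i + j) (mode M.Y (l + i) (divPow (𝓥.L 1) k v) (divPow (M.L 1) j a)) := by
  have b1 : ∀ᶠ N : ℕ in Filter.atTop, ∀ k ∈ Finset.range K, ∀ j ∈ Finset.range K, ∀ i, N ≤ i →
      mode M.Y (l + i) (divPow (𝓥.L 1) k v) (divPow (M.L 1) j a) = 0 := by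
    simp only [Filter.eventually_all_finset]
    exact fun k _ j _ => mode_eventually M.Y _ _ l
  have b2 : ∀ᶠ N : ℕ in Filter.atTop, ∀ i j, N ≤ i ∨ N ≤ j →
      divPow (M.L 1) j (mode M.Y (l + i) v a) = 0 := by
    refine eventually_box ?_ fun i => (M.eventually_divPow_L_one _).exists
    obtain ⟨N, hN⟩ := (mode_eventually M.Y v a l).exists
    exact ⟨N, fun i hi k => by rw [hN i hi, map_zero]⟩
  obtain ⟨N₀, hN1, hN2, hKN⟩ := (b1.and (b2.and (Filter.eventually_ge_atTop K))).exists
  let N := 3 * N₀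
  have v1 : ∀ k j i, N₀ ≤ k ∨ N₀ ≤ j ∨ N₀ ≤ i →
      mode M.Y (l + i) (divPow (𝓥.L 1) k v) (divPow (M.L 1) j a) = 0 := by
    intro k j i hkji
    by_cases hk : K ≤ k
    · simp [hKv k hk]
    by_cases hj : K ≤ j
    · simp [hKa j hj]
    exact hN1 k (by simpa using hk) j (by simpa using hj) i (by omega)
  have eL : ∑ᶠ i : ℕ, ∑ᶠ j : ℕ, ((-1 : ℤ) ^ i * Ring.choose m i) •
        F (i + j) (divPow (M.L 1) j (mode M.Y (l + i) v a))
      = ∑ T ∈ Finset.range N, F T (∑ p ∈ antidiagonal T, ((-1 : ℤ) ^ p.1 * Ring.choose m p.1) •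
        divPow (M.L 1) p.2 (mode M.Y (l + p.1) v a)) := by
    rw [finsum_eq_sum_range (N := N)]
    · have : ∀ i ∈ Finset.range N, ∑ᶠ j : ℕ, ((-1 : ℤ) ^ i * Ring.choose m i) •
            F (i + j) (divPow (M.L 1) j (mode M.Y (l + i) v a))
          = ∑ j ∈ Finset.range N, ((-1 : ℤ) ^ i * Ring.choose m i) •
            F (i + j) (divPow (M.L 1) j (mode M.Y (l + i) v a)) := fun i _ =>
        finsum_eq_sum_range fun j hj => by rw [hN2 i j (by omega), map_zero, smul_zero]
      rw [Finset.sum_congr rfl this, sum_range_range_eq_sum_antidiagonal]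
      · refine Finset.sum_congr rfl fun T _ => ?_
        rw [map_sum]
        refine Finset.sum_congr rfl fun p hp => ?_
        rw [mem_antidiagonal.mp hp, map_zsmul]
      · intro i j hij
        rw [hN2 i j (by omega), map_zero, smul_zero]
    · intro i hi
      rw [← finsum_zero (α := ℕ)]
      exact finsum_congr fun j => by rw [hN2 i j (by omega), map_zero, smul_zero]
  rw [eL]
  simp only [M.sum_choose_divPow_L_one_mode hv]
  let H : ℕ → ℕ → ℕ → ℂ := fun k j i => Ring.choose (2 * h - k - m - l - 2) i •
    F (k + i + j) (mode M.Y (l + i) (divPow (𝓥.L 1) k v) (divPow (M.L 1) j a))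
  have hH : ∀ k j i, N₀ ≤ k ∨ N₀ ≤ j ∨ N₀ ≤ i → H k j i = 0 := fun k j i hk => by
    simp only [H]
    rw [v1 k j i hk, map_zero, smul_zero]
  have eR : ∑ k ∈ Finset.range K, ∑ j ∈ Finset.range K, ∑ᶠ i : ℕ, H k j i
      = ∑ j ∈ Finset.range N, ∑ k ∈ Finset.range N, ∑ i ∈ Finset.range N, H k j i := by
    have h1 : ∀ k j, ∑ᶠ i : ℕ, H k j i = ∑ i ∈ Finset.range N, H k j i := fun k j =>
      finsum_eq_sum_range fun i hi => hH k j i (by omega)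
    simp only [h1]
    rw [Finset.sum_comm]
    rw [sum_range_eq_of_le (N := N) (by omega)]
    · refine Finset.sum_congr rfl fun j _ => ?_
      refine sum_range_eq_of_le (by omega) fun k hk => Finset.sum_eq_zero fun i _ => ?_
      simp [H, hKv k hk]
    · intro j hj
      refine Finset.sum_eq_zero fun k _ => Finset.sum_eq_zero fun i _ => ?_
      simp [H, hKa j hj]
  refine Eq.trans ?_ eR.symm
  have e3 : ∀ j ∈ Finset.range N, ∑ k ∈ Finset.range N, ∑ i ∈ Finset.range N, H k j i
      = ∑ q ∈ Finset.range N, ∑ p ∈ antidiagonal q, H p.1 j p.2 := fun j _ =>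
    sum_range_range_eq_sum_antidiagonal fun k i hki => hH k j i (by omega)
  rw [Finset.sum_congr rfl e3, Finset.sum_comm, sum_range_range_eq_sum_antidiagonal
    (f := fun q j => ∑ p ∈ antidiagonal q, H p.1 j p.2)]
  · refine Finset.sum_congr rfl fun T _ => ?_
    rw [map_sum]
    refine Finset.sum_congr rfl fun q hq => ?_
    rw [map_sum]
    refine Finset.sum_congr rfl fun p hp => ?_
    simp only [H]
    rw [map_zsmul, mem_antidiagonal.mp hp, mem_antidiagonal.mp hq]
  · intro q j hqj
    refine Finset.sum_eq_zero fun p hp => hH _ _ _ ?_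
    have := mem_antidiagonal.mp hp
    omega

end Opposite

section ContraIntertwining

variable {V : Type*} [AddCommGroup V] [Module ℂ V] {𝓥 : VertexOperatorAlgebra V}
  {A B B' C C' : Type*} [AddCommGroup A] [Module ℂ A] [AddCommGroup B] [Module ℂ B]
  [AddCommGroup B'] [Module ℂ B'] [AddCommGroup C] [Module ℂ C] [AddCommGroup C'] [Module ℂ C']
  {YB : V →ₗ[ℂ] VertexOperator ℂ B} {YB' : V →ₗ[ℂ] VertexOperator ℂ B'}
  {YC : V →ₗ[ℂ] VertexOperator ℂ C} {YC' : V →ₗ[ℂ] VertexOperator ℂ C'}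
  {pB : B' →ₗ[ℂ] B →ₗ[ℂ] ℂ} {pC : C' →ₗ[ℂ] C →ₗ[ℂ] ℂ}
  {M : VOAModule 𝓥 A} {r : ℤ} {𝒴 : A →ₗ[ℂ] B →ₗ[ℂ] (ℂ → C)}
  {𝒵 : A →ₗ[ℂ] C' →ₗ[ℂ] (ℂ → B')}

theorem cmode_add_left (n : ℂ) (a a' : A) (b : B) :
    cmode 𝒴 n (a + a') b = cmode 𝒴 n a b + cmode 𝒴 n a' b := by simp [cmode]

theorem cmode_add_right (n : ℂ) (a : A) (b b' : B) :
    cmode 𝒴 n a (b + b') = cmode 𝒴 n a b + cmode 𝒴 n a b' := by simp [cmode]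

/-- The Jacobi identity follows from its homogeneous instances. -/
theorem IntertwiningJacobi.of_homogeneous (M : VOAModule 𝓥 A) (hZ : LowerTruncated 𝒴)
    (H : ∀ (hv : ℤ), ∀ v ∈ 𝓥.weight hv, ∀ (ha : ℂ), ∀ a ∈ M.weight ha, ∀ (b : B) (l m : ℤ) (n : ℂ),
      (∑ᶠ i : ℕ, ((-1 : ℤ) ^ i * Ring.choose l i) •
          mode YC (m + l - i) v (cmode 𝒴 (n + i) a b))
        - (-1 : ℂ) ^ l • (∑ᶠ i : ℕ, ((-1 : ℤ) ^ i * Ring.choose l i) •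
            cmode 𝒴 (n + l - i) a (mode YB (m + i) v b))
      = ∑ᶠ i : ℕ, Ring.choose m i • cmode 𝒴 (m + n - i) (mode M.Y (l + i) v a) b) :
    IntertwiningJacobi M.Y YB YC 𝒴 := by
  intro v a b l m n
  induction v using homog_induction 𝓥.isInternal with
  | h0 => simp [cmode]
  | hadd u v hu hv =>
    simp only [cmode_add_left, cmode_add_right, map_add, smul_add, LinearMap.add_apply]
    rw [finsum_add_distrib (hZ.finite_left _ _ n a b) (hZ.finite_left _ _ n a b),
      finsum_add_distrib (finite_middle YB 𝒴 _ _ m u a b) (finite_middle YB 𝒴 _ _ m v a b),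
      finsum_add_distrib (finite_right M.Y 𝒴 _ _ l u a b) (finite_right M.Y 𝒴 _ _ l v a b),
      ← hu, ← hv, smul_add]
    abel
  | hom hv v hvm =>
    induction a using homog_induction M.isInternal with
    | h0 => simp [cmode]
    | hadd x y hx hy =>
      simp only [cmode_add_left, map_add, smul_add]
      rw [finsum_add_distrib (hZ.finite_left _ _ n x b) (hZ.finite_left _ _ n y b),
        finsum_add_distrib (finite_middle YB 𝒴 _ _ m v x b) (finite_middle YB 𝒴 _ _ m v y b),
        finsum_add_distrib (finite_right M.Y 𝒴 _ _ l v x b) (finite_right M.Y 𝒴 _ _ l v y b),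
        ← hx, ← hy, smul_add]
      abel
    | hom ha a ham => exact H hv v hvm ha a ham b l m n

theorem map_finsum_zsmul {E : Type*} [AddCommGroup E] [Module ℂ E] (θ : E →ₗ[ℂ] ℂ) (c : ℕ → ℤ)
    (x : ℕ → E) (h : (Function.support fun i => c i • x i).Finite) :
    θ (∑ᶠ i, c i • x i) = ∑ᶠ i, (c i : ℂ) * θ (x i) := by
  have := (θ : E →+ ℂ).map_finsum h
  refine this.trans (finsum_congr fun i => ?_)
  show θ (c i • x i) = _
  rw [map_zsmul, zsmul_eq_mul]

theorem finsum_mul_sum_sum {K L : ℕ} (E : ℂ) (c : ℕ → ℤ) (x : ℕ → ℕ → ℕ → ℂ)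
    (h : ∀ k j, (Function.support fun i => c i * x i k j).Finite) :
    ∑ᶠ i, (c i : ℂ) * (E * ∑ k ∈ Finset.range K, ∑ j ∈ Finset.range L, x i k j)
      = E * ∑ k ∈ Finset.range K, ∑ j ∈ Finset.range L, ∑ᶠ i, (c i : ℂ) * x i k j := by
  have e : ∀ i, (c i : ℂ) * (E * ∑ k ∈ Finset.range K, ∑ j ∈ Finset.range L, x i k j)
      = E • ∑ k ∈ Finset.range K, ∑ j ∈ Finset.range L, (c i : ℂ) * x i k j := fun i => by
    simp only [smul_eq_mul, Finset.mul_sum]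
    refine Finset.sum_congr rfl fun k _ => Finset.sum_congr rfl fun j _ => ?_
    ring
  rw [finsum_congr e, ← smul_finsum, smul_eq_mul, finsum_sum_comm]
  · congr 1
    refine Finset.sum_congr rfl fun k _ => ?_
    rw [finsum_sum_comm]
    exact fun j _ => h k j
  · intro k _
    refine ((Finset.range L).finite_toSet.biUnion fun j _ => h k j).subset ?_
    intro i hi
    by_contra hne
    simp only [Set.mem_iUnion, not_exists, Function.mem_support, not_not] at hne
    exact hi (Finset.sum_eq_zero fun j hj => hne j hj)

theorem IsContra.jacobi (HZ : IsContra M r pB pC 𝒴 𝒵) (HB : IsOpposite 𝓥 YB YB' pB)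
    (HC : IsOpposite 𝓥 YC YC' pC) (hp : ∀ f, (∀ b, pB f b = 0) → f = 0)
    (hY : LowerTruncated 𝒴) (hZ : LowerTruncated 𝒵) (hJ : IntertwiningJacobi M.Y YB YC 𝒴) :
    IntertwiningJacobi M.Y YC' YB' 𝒵 := by
  refine IntertwiningJacobi.of_homogeneous M hZ fun h v hv h' a ha c' l m n => ?_
  rw [← sub_eq_zero]
  refine hp _ fun b => ?_
  rw [map_sub, LinearMap.sub_apply, sub_eq_zero]
  obtain ⟨K, hKv, hKa⟩ := ((VertexOperatorAlgebra.eventually_divPow_L_one hv).and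
    (M.eventually_divPow_L_one a)).exists
  let S : ℂ := (-1) ^ h * Complex.exp (twist r * h')
  have hS : S = Complex.exp (twist r * h') * (-1) ^ h := mul_comm _ _
  let θ : B' →ₗ[ℂ] ℂ := pB.flip b
  -- the two products
  have t1 : θ (∑ᶠ i : ℕ, ((-1 : ℤ) ^ i * Ring.choose l i) •
        mode YB' (m + l - i) v (cmode 𝒵 (n + i) a c'))
      = S * ∑ k ∈ Finset.range K, ∑ j ∈ Finset.range K,
        pC c' (∑ᶠ i : ℕ, ((-1 : ℤ) ^ i * Ring.choose l i) •
          cmode 𝒴 ((2 * h' - j - n - 2 - l) + l - i) (divPow (M.L 1) j a)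
            (mode YB ((2 * h - k - m - l - 2) + i) (divPow (𝓥.L 1) k v) b)) := by
    have hfin := fun k j : ℕ => finite_middle YB 𝒴 (fun i => (-1 : ℤ) ^ i * Ring.choose l i)
      (fun i => (2 * h' - j - n - 2 - l) + l - i) (2 * h - k - m - l - 2) (divPow (𝓥.L 1) k v)
      (divPow (M.L 1) j a) b
    rw [map_finsum_zsmul _ _ _ (hZ.finite_left _ _ n a c')]
    simp only [map_finsum_zsmul _ _ _ (hfin _ _)]
    rw [← finsum_mul_sum_sum]
    · refine finsum_congr fun i => congrArg _ ?_
      show pB _ b = _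
      rw [HB.eq_sum hv hKv, mul_assoc]
      congr 1
      rw [Finset.mul_sum]
      refine Finset.sum_congr rfl fun k _ => ?_
      rw [HZ.eq_sum ha hKa]
      congr 1
      refine Finset.sum_congr rfl fun j _ => ?_
      rw [show 2 * h' - j - (n + i) - 2 = (2 * h' - j - n - 2 - l) + l - i by ring,
        show 2 * h - (k : ℤ) - (m + l - i) - 2 = (2 * h - k - m - l - 2) + i by ring]
    · intro k j
      refine (hfin k j).subset fun i hi hne => hi ?_
      have := congrArg (pC c') hne
      simpa using this
  have t2 : θ (∑ᶠ i : ℕ, ((-1 : ℤ) ^ i * Ring.choose l i) •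
          cmode 𝒵 (n + l - i) a (mode YC' (m + i) v c'))
      = S * ∑ k ∈ Finset.range K, ∑ j ∈ Finset.range K,
        pC c' (∑ᶠ i : ℕ, ((-1 : ℤ) ^ i * Ring.choose l i) •
          mode YC ((2 * h - k - m - l - 2) + l - i) (divPow (𝓥.L 1) k v)
            (cmode 𝒴 ((2 * h' - j - n - 2 - l) + i) (divPow (M.L 1) j a) b)) := by
    have hfin := fun k j : ℕ => hY.finite_left (fun i => (-1 : ℤ) ^ i * Ring.choose l i)
      (fun i => mode YC ((2 * h - k - m - l - 2) + l - i) (divPow (𝓥.L 1) k v))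
      (2 * h' - j - n - 2 - l) (divPow (M.L 1) j a) b
    rw [map_finsum_zsmul _ _ _ (finite_middle YC' 𝒵 _ _ m v a c')]
    simp only [map_finsum_zsmul _ _ _ (hfin _ _)]
    rw [← finsum_mul_sum_sum]
    · refine finsum_congr fun i => congrArg _ ?_
      show pB _ b = _
      rw [HZ.eq_sum ha hKa, hS, mul_assoc (Complex.exp _), Finset.sum_comm]
      congr 1
      rw [Finset.mul_sum]
      refine Finset.sum_congr rfl fun j _ => ?_
      rw [HC.eq_sum hv hKv]
      congr 1
      refine Finset.sum_congr rfl fun k _ => ?_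
      rw [show 2 * h' - j - (n + l - i) - 2 = (2 * h' - j - n - 2 - l) + i by ring,
        show 2 * h - (k : ℤ) - (m + i) - 2 = (2 * h - k - m - l - 2) + l - i by ring]
    · intro k j
      refine (hfin k j).subset fun i hi hne => hi ?_
      have := congrArg (pC c') hne
      simpa using this
  -- the iterate
  let F : ℕ → A →ₗ[ℂ] ℂ := fun T =>
    pC c' ∘ₗ LinearMap.proj (-(2 * h + 2 * h' - m - n - 2 * l - 4 - T) - 1) ∘ₗ 𝒴.flip b
  have hF : ∀ T x, F T x = pC c' (cmode 𝒴 (2 * h + 2 * h' - m - n - 2 * l - 4 - T) x b) :=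
    fun _ _ => rfl
  have t3 : θ (∑ᶠ i : ℕ, Ring.choose m i • cmode 𝒵 (m + n - i) (mode M.Y (l + i) v a) c')
      = -((-1) ^ l * S) * ∑ᶠ i : ℕ, ∑ᶠ j : ℕ, ((-1 : ℤ) ^ i * Ring.choose m i) •
        F (i + j) (divPow (M.L 1) j (mode M.Y (l + i) v a)) := by
    rw [map_finsum_zsmul _ _ _ (finite_right M.Y 𝒵 _ _ l v a c'), ← smul_eq_mul (-((-1) ^ l * S)),
      smul_finsum]
    refine finsum_congr fun i => ?_
    show _ * pB _ b = _
    rw [HZ _ _ (M.mode_mem hv ha (l + i)), ← smul_finsum, ← Int.cast_smul_eq_zsmul ℂ, smul_smul,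
      smul_eq_mul, ← mul_assoc]
    have e1 : Complex.exp (twist r * (h' + ((h : ℂ) - ((l + i : ℤ) : ℂ) - 1)))
        = -((-1) ^ l * S) * (-1) ^ i := by
      rw [show (h : ℂ) - ((l + i : ℤ) : ℂ) - 1 = ((h - l - i - 1 : ℤ) : ℂ) by push_cast; ring,
        exp_twist_add_int, zpow_sub₀ (by norm_num), zpow_sub₀ (by norm_num),
        zpow_sub₀ (by norm_num), zpow_natCast, zpow_one, div_div, div_div, div_eq_mul_inv]
      simp only [S]
      have hinv : ((-1 : ℂ) ^ l * ((-1) ^ i * -1))⁻¹ = -((-1) ^ l * (-1) ^ i) := by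
        rw [mul_inv, mul_inv, ← inv_zpow, ← inv_pow]
        norm_num
      rw [hinv]
      ring
    rw [e1]
    congr 1
    · push_cast
      ring
    · refine finsum_congr fun j => ?_
      rw [hF]
      congr 2
      push_cast
      ring
  have hJ' : ∀ k j : ℕ, pC c' (∑ᶠ i : ℕ, ((-1 : ℤ) ^ i * Ring.choose l i) •
          mode YC ((2 * h - k - m - l - 2) + l - i) (divPow (𝓥.L 1) k v)
            (cmode 𝒴 ((2 * h' - j - n - 2 - l) + i) (divPow (M.L 1) j a) b))
      = (-1) ^ l * pC c' (∑ᶠ i : ℕ, ((-1 : ℤ) ^ i * Ring.choose l i) •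
          cmode 𝒴 ((2 * h' - j - n - 2 - l) + l - i) (divPow (M.L 1) j a)
            (mode YB ((2 * h - k - m - l - 2) + i) (divPow (𝓥.L 1) k v) b))
        + ∑ᶠ i : ℕ, Ring.choose (2 * h - k - m - l - 2) i •
            F (k + i + j) (mode M.Y (l + i) (divPow (𝓥.L 1) k v) (divPow (M.L 1) j a)) := by
    intro k j
    have e := congrArg (pC c') (hJ (divPow (𝓥.L 1) k v) (divPow (M.L 1) j a) b l
      (2 * h - k - m - l - 2) (2 * h' - j - n - 2 - l))
    rw [map_sub, map_smul, sub_eq_iff_eq_add'] at e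
    refine e.trans (congrArg₂ (· + ·) rfl ?_)
    rw [map_finsum_zsmul _ _ _ (finite_right M.Y 𝒴 _ _ l _ _ b)]
    refine finsum_congr fun i => ?_
    rw [hF, zsmul_eq_mul]
    congr 3
    push_cast
    ring
  show θ _ = θ _
  rw [map_sub, map_smul, t1, t2, t3, M.finsum_choose_divPow_L_one_mode hv a l m F hKv hKa]
  simp only [hJ', Finset.sum_add_distrib, ← Finset.mul_sum, smul_eq_mul]
  linear_combination (-S * ∑ k ∈ Finset.range K, ∑ j ∈ Finset.range K,
        pC c' (∑ᶠ i : ℕ, ((-1 : ℤ) ^ i * Ring.choose l i) •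
          cmode 𝒴 ((2 * h' - j - n - 2 - l) + l - i) (divPow (M.L 1) j a)
            (mode YB ((2 * h - k - m - l - 2) + i) (divPow (𝓥.L 1) k v) b)))
    * neg_one_zpow_mul_self l

theorem VOAModule.divPow_L_one_L_neg_one (M : VOAModule 𝓥 A) {h : ℂ} {a : A}
    (ha : a ∈ M.weight h) (k : ℕ) :
    divPow (M.L 1) (k + 1) (M.L (-1) a)
      = M.L (-1) (divPow (M.L 1) (k + 1) a) + (2 * h - k) • divPow (M.L 1) k a := by
  have comm : ∀ x, M.L 1 (M.L (-1) x) = M.L (-1) (M.L 1 x) + (2 : ℂ) • M.L 0 x := fun x => by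
    have := M.virasoro 1 (-1) x
    rw [sub_eq_iff_eq_add'] at this
    rw [VOAModule.L, this]
    norm_num
  have succ : ∀ (j : ℕ) (x : A), M.L 1 (divPow (M.L 1) j x)
      = ((j : ℂ) + 1) • divPow (M.L 1) (j + 1) x := fun j x => by
    rw [← Module.End.mul_apply, mul_divPow, LinearMap.smul_apply, ← Nat.cast_smul_eq_nsmul ℂ]
    push_cast
    rfl
  have hL0 : ∀ j : ℕ, M.L 0 (divPow (M.L 1) j a) = (h - j) • divPow (M.L 1) j a := fun j =>
    M.vir_zero _ _ (M.divPow_L_one_mem ha j)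
  induction k with
  | zero =>
    have := hL0 0
    simp only [divPow_zero, Module.End.one_apply] at this
    simp [divPow_one, comm, this, smul_smul]
  | succ k ih =>
    have h2 : ((k + 1 : ℕ) : ℂ) + 1 ≠ 0 := Nat.cast_add_one_ne_zero _
    refine (smul_right_inj h2).mp ?_
    rw [← succ, ih, map_add, map_smul, comm, succ, hL0, succ, smul_add, map_smul]
    push_cast
    module

theorem cmode_L_neg_one {ω : V} {Y₁ : V →ₗ[ℂ] VertexOperator ℂ A}
    (hY : ∀ (a : A) (b : B) (s : ℂ), (s + 1) • 𝒴 a b (s + 1) = 𝒴 (vir Y₁ ω (-1) a) b s)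
    (n : ℂ) (a : A) (b : B) :
    cmode 𝒴 n (vir Y₁ ω (-1) a) b = (-n) • cmode 𝒴 (n - 1) a b := by
  have := hY a b (-n - 1)
  rw [cmode, cmode, ← this, show -n - 1 + 1 = -n by ring, show -(n - 1) - 1 = -n by ring]

theorem IsContra.vir_neg_one (HZ : IsContra M r pB pC 𝒴 𝒵)
    (hp : ∀ f, (∀ b, pB f b = 0) → f = 0)
    (hY : ∀ (a : A) (b : B) (s : ℂ), (s + 1) • 𝒴 a b (s + 1) = 𝒴 (M.L (-1) a) b s)
    (a : A) (c' : C') (s : ℂ) : (s + 1) • 𝒵 a c' (s + 1) = 𝒵 (M.L (-1) a) c' s := by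
  induction a using homog_induction M.isInternal with
  | h0 => simp
  | hadd x y hx hy => simp [smul_add, hx, hy]
  | hom h a ha =>
    rw [← sub_eq_zero]
    refine hp _ fun b => ?_
    rw [map_sub, LinearMap.sub_apply, sub_eq_zero, map_smul, LinearMap.smul_apply, smul_eq_mul]
    have ha' := M.L_mem ha (-1)
    obtain ⟨K, hK, hK'⟩ := ((M.eventually_divPow_L_one a).and
      (M.eventually_divPow_L_one (M.L (-1) a))).exists
    have e1 := HZ.eq_sum ha hK c' b (-s - 2)
    have e2 := HZ.eq_sum ha' (K := K + 1) (fun k hk => hK' k (by omega)) c' b (-s - 1)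
    rw [cmode, show -(-s - 2) - 1 = s + 1 by ring] at e1
    rw [cmode, show -(-s - 1) - 1 = s by ring] at e2
    rw [e1, e2, show h - ((-1 : ℤ) : ℂ) = h + (1 : ℤ) by push_cast; ring, exp_twist_add_int,
      zpow_one]
    let X : ℕ → ℂ := fun k => pC c' (cmode 𝒴 (2 * h - k + s) (divPow (M.L 1) k a) b)
    have hX1 : ∀ k : ℕ, pC c' (cmode 𝒴 (2 * h - k - (-s - 2) - 2) (divPow (M.L 1) k a) b) = X k :=
      fun k => by
        simp only [X]
        rw [show 2 * h - (k : ℂ) - (-s - 2) - 2 = 2 * h - k + s by ring]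
    have hX2 : ∀ k : ℕ, pC c' (cmode 𝒴 (2 * h - k + s + 1) (M.L (-1) (divPow (M.L 1) k a)) b)
        = -(2 * h - k + s + 1) * X k := fun k => by
      rw [cmode_L_neg_one hY, map_smul, smul_eq_mul, add_sub_cancel_right]
    have hX3 : ∀ k : ℕ, pC c' (cmode 𝒴 (2 * (h + (1 : ℤ)) - (k + 1 : ℕ) - (-s - 1) - 2)
          (divPow (M.L 1) (k + 1) (M.L (-1) a)) b)
        = -(2 * h - (k + 1 : ℕ) + s + 1) * X (k + 1) + (2 * h - k) * X k := by
      intro k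
      rw [show 2 * (h + ((1 : ℤ) : ℂ)) - (k + 1 : ℕ) - (-s - 1) - 2 = 2 * h - (k + 1 : ℕ) + s + 1 by
          push_cast; ring,
        M.divPow_L_one_L_neg_one ha, cmode_add_left, map_add, hX2,
        show 2 * h - ((k + 1 : ℕ) : ℂ) + s + 1 = 2 * h - k + s by push_cast; ring]
      simp [X, cmode]
    have hX4 : pC c' (cmode 𝒴 (2 * (h + (1 : ℤ)) - (0 : ℕ) - (-s - 1) - 2)
          (divPow (M.L 1) 0 (M.L (-1) a)) b) = -(2 * h - (0 : ℕ) + s + 1) * X 0 := by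
      have := hX2 0
      rw [divPow_zero, Module.End.one_apply] at this ⊢
      rw [← this]
      congr 3
      push_cast
      ring
    have hXK : X K = 0 := by
      simp only [X]
      rw [hK K le_rfl, cmode_zero_left, map_zero]
    have hsum : ∑ k ∈ Finset.range (K + 1), -(2 * h - k + s + 1) * X k
        = ∑ k ∈ Finset.range K, -(2 * h - k + s + 1) * X k := by
      rw [Finset.sum_range_succ, hXK, mul_zero, add_zero]
    rw [Finset.sum_range_succ' (fun k : ℕ => pC c' (cmode 𝒴 (2 * (h + (1 : ℤ)) - k - (-s - 1) - 2)
      (divPow (M.L 1) k (M.L (-1) a)) b)), hX4]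
    simp only [hX1, hX3, Finset.sum_add_distrib]
    rw [add_right_comm, ← Finset.sum_range_succ' (fun k : ℕ => -(2 * h - k + s + 1) * X k), hsum,
      ← Finset.sum_add_distrib, ← mul_assoc, Finset.mul_sum, Finset.mul_sum]
    refine Finset.sum_congr rfl fun k _ => ?_
    ring

theorem IsContra.isIntertwining (HZ : IsContra M r pB pC 𝒴 𝒵) (HB : IsOpposite 𝓥 YB YB' pB)
    (HC : IsOpposite 𝓥 YC YC' pC) (hp : ∀ f, (∀ b, pB f b = 0) → f = 0)
    (hY : IsIntertwining 𝓥.conf M.Y YB YC 𝒴) (hZ : LowerTruncated 𝒵) :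
    IsIntertwining 𝓥.conf M.Y YC' YB' 𝒵 where
  truncated := hZ
  jacobi := HZ.jacobi HB HC hp hY.truncated hZ hY.jacobi
  vir_neg_one := HZ.vir_neg_one hp hY.vir_neg_one

end ContraIntertwining

section GradedPairs

variable {V : Type*} [AddCommGroup V] [Module ℂ V] {𝓥 : VertexOperatorAlgebra V}
  {A B B' C C' : Type*} [AddCommGroup A] [Module ℂ A] [AddCommGroup B] [Module ℂ B]
  [AddCommGroup B'] [Module ℂ B'] [AddCommGroup C] [Module ℂ C] [AddCommGroup C'] [Module ℂ C']
  {YB : V →ₗ[ℂ] VertexOperator ℂ B} {YB' : V →ₗ[ℂ] VertexOperator ℂ B'}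
  {YC : V →ₗ[ℂ] VertexOperator ℂ C} {YC' : V →ₗ[ℂ] VertexOperator ℂ C'}
  {pB : B' →ₗ[ℂ] B →ₗ[ℂ] ℂ} {pC : C' →ₗ[ℂ] C →ₗ[ℂ] ℂ}

theorem VertexOperatorAlgebra.L_one_conf (𝓥 : VertexOperatorAlgebra V) : 𝓥.L 1 𝓥.conf = 0 := by
  have h := 𝓥.virasoro 1 (-2) 𝓥.vac
  have h2 : vir 𝓥.Y 𝓥.conf (-2) 𝓥.vac = 𝓥.conf := by
    rw [vir, show (-2 : ℤ) + 1 = -1 by norm_num]; exact 𝓥.creation_neg_one _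
  have h1 : ∀ n : ℤ, -1 ≤ n → vir 𝓥.Y 𝓥.conf n 𝓥.vac = 0 := fun n hn =>
    𝓥.creation _ _ (by omega)
  rw [h2, h1 1 (by norm_num), h1 _ (by norm_num)] at h
  simpa using h

/-- With respect to the pairing, the adjoint of `L(n)` is `L(-n)`. -/
theorem IsOpposite.vir (H : IsOpposite 𝓥 YB YB' pB) (n : ℤ) (f : B') (w : B) :
    pB (vir YB' 𝓥.conf n f) w = pB f (vir YB 𝓥.conf (-n) w) := by
  rw [VOA.vir, H.eq_sum 𝓥.conf_mem (K := 1)]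
  · rw [Finset.sum_range_one, divPow_zero, Module.End.one_apply, VOA.vir,
      show (2 : ℤ) * 2 - (0 : ℕ) - (n + 1) - 2 = -n + 1 by push_cast; ring]
    norm_num
  · intro k hk
    obtain ⟨j, rfl⟩ : ∃ j, k = j + 1 := ⟨k - 1, by omega⟩
    have : divPow (𝓥.L 1) (j + 1) 𝓥.conf = 0 := by
      rw [divPow, LinearMap.smul_apply, pow_succ, Module.End.mul_apply, 𝓥.L_one_conf, map_zero,
        smul_zero]
    exact this

theorem IsOpposite.isTranslation (M : VOAModule 𝓥 B) (H : IsOpposite 𝓥 M.Y YB' pB)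
    (hp : ∀ f, (∀ b, pB f b = 0) → f = 0) : IsTranslation 𝓥.conf YB' := by
  intro v p
  refine LinearMap.ext fun f => ?_
  induction v using homog_induction 𝓥.isInternal with
  | h0 => simp
  | hadd u v hu hv =>
    simp only [LinearMap.add_apply, Module.End.mul_apply, map_add, LinearMap.smul_apply,
      smul_add] at hu hv ⊢
    rw [hu, hv]
    abel
  | hom h v hv =>
    rw [← sub_eq_zero]
    refine hp _ fun w => ?_
    rw [map_sub, LinearMap.sub_apply, sub_eq_zero]
    obtain ⟨K, hK⟩ := (VertexOperatorAlgebra.eventually_divPow_L_one hv).exists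
    simp only [Module.End.mul_apply, LinearMap.add_apply, LinearMap.smul_apply, map_add, map_zsmul]
    rw [H.vir, H.eq_sum hv hK, H.eq_sum hv hK, H.eq_sum hv hK]
    simp only [H.vir, neg_neg]
    let X : ℕ → ℂ := fun k => pB f (mode M.Y (2 * h - k - p - 1) (divPow (𝓥.L 1) k v) w)
    have e1 : ∀ k : ℕ, pB f (M.L 1 (mode M.Y (2 * h - k - p - 2) (divPow (𝓥.L 1) k v) w))
        = pB f (mode M.Y (2 * h - k - p - 2) (divPow (𝓥.L 1) k v) (M.L 1 w))
          + ((p - k) * X k + (k + 1) * X (k + 1)) := by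
      intro k
      have := M.L_one_mul_mode_divPow hv (2 * h - k - p - 2) k
      have := congrArg (fun T : Module.End ℂ B => pB f (T w)) this
      simp only [Module.End.mul_apply, LinearMap.add_apply, LinearMap.smul_apply, map_add,
        map_zsmul, map_nsmul] at this
      rw [this, add_assoc]
      simp only [X]
      rw [show 2 * h - (k : ℤ) - p - 2 + 1 = 2 * h - k - p - 1 by ring,
        show 2 * h - ((k + 1 : ℕ) : ℤ) - p - 1 = 2 * h - k - p - 2 by push_cast; ring,
        zsmul_eq_mul, nsmul_eq_mul]
      push_cast
      ring
    have e2 : ∀ k : ℕ, pB f (mode M.Y (2 * h - k - (p - 1) - 2) (divPow (𝓥.L 1) k v) w) = X k :=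
      fun k => by
        simp only [X]
        rw [show 2 * h - (k : ℤ) - (p - 1) - 2 = 2 * h - k - p - 1 by ring]
    have e3 : ∑ k ∈ Finset.range K, ((k : ℂ) + 1) * X (k + 1)
        = ∑ k ∈ Finset.range K, (k : ℂ) * X k := by
      have h1 := Finset.sum_range_succ' (fun k : ℕ => (k : ℂ) * X k) K
      have h2 := Finset.sum_range_succ (fun k : ℕ => (k : ℂ) * X k) K
      have h3 : X K = 0 := by simp [X, hK K le_rfl]
      rw [h3, mul_zero, add_zero] at h2
      rw [h2] at h1
      simpa using h1.symm
    simp only [e2]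
    have e1' := Finset.sum_congr (rfl : Finset.range K = Finset.range K) fun k _ => e1 k
    rw [Finset.sum_add_distrib, Finset.sum_add_distrib, e3, ← Finset.sum_add_distrib] at e1'
    refine (congrArg ((-1 : ℂ) ^ h * ·) e1').trans ?_
    show (-1 : ℂ) ^ h * (_ + _) = _
    rw [mul_add]
    congr 1
    rw [zsmul_eq_mul, Finset.mul_sum, Finset.mul_sum, Finset.mul_sum]
    refine Finset.sum_congr rfl fun k _ => ?_
    ring

/-- The weight of `a_n b`. -/
theorem IsIntertwining.vir_zero_cmode {ω : V} {Y₁ : V →ₗ[ℂ] VertexOperator ℂ A}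
    {𝒴 : A →ₗ[ℂ] B →ₗ[ℂ] (ℂ → C)} (h : IsIntertwining ω Y₁ YB YC 𝒴) {α β : ℂ} {a : A} {b : B}
    (ha : vir Y₁ ω 0 a = α • a) (hb : vir YB ω 0 b = β • b) (n : ℂ) :
    vir YC ω 0 (cmode 𝒴 n a b) = (α + β - n - 1) • cmode 𝒴 n a b := by
  have e := h.jacobi ω a b 0 1 n
  rw [finsum_eq_single _ 0 (fun i hi => by
      rw [Ring.choose_zero_pos ℤ (Nat.pos_of_ne_zero hi)]; simp),
    finsum_eq_single _ 0 (fun i hi => by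
      rw [Ring.choose_zero_pos ℤ (Nat.pos_of_ne_zero hi)]; simp),
    finsum_eq_sum_range (N := 2) (fun i hi => by
      have h := Ring.choose_natCast (R := ℤ) 1 i
      rw [Nat.choose_eq_zero_of_lt (by omega)] at h
      rw [show Ring.choose (1 : ℤ) i = 0 by exact_mod_cast h, zero_smul])] at e
  have h1 := cmode_L_neg_one h.vir_neg_one (1 + n) a b
  simp only [VOA.vir] at ha hb h1 ⊢
  norm_num [Finset.sum_range_succ] at e h1 ha hb ⊢
  rw [h1, ha, hb, sub_eq_iff_eq_add] at e
  rw [e]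
  simp only [cmode, map_smul, LinearMap.smul_apply, Pi.smul_apply]
  module

/-- Two spaces with vertex operators, in perfect duality as graded spaces, each being the
contragredient of the other. -/
structure GradedPair (𝓥 : VertexOperatorAlgebra V) (YB : V →ₗ[ℂ] VertexOperator ℂ B)
    (YB' : V →ₗ[ℂ] VertexOperator ℂ B') (pB : B' →ₗ[ℂ] B →ₗ[ℂ] ℂ)
    (WB : ℂ → Submodule ℂ B) (WB' : ℂ → Submodule ℂ B') : Prop where
  opposite : IsOpposite 𝓥 YB YB' pB
  vir_zero : ∀ h, ∀ w ∈ WB h, vir YB 𝓥.conf 0 w = h • w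
  vir_zero' : ∀ h, ∀ f ∈ WB' h, vir YB' 𝓥.conf 0 f = h • f
  span : ⨆ h, WB h = ⊤
  span' : ⨆ h, WB' h = ⊤
  bounded : ∃ N : ℝ, ∀ h : ℂ, h.re < N → WB h = ⊥
  bounded' : ∃ N : ℝ, ∀ h : ℂ, h.re < N → WB' h = ⊥
  perfect : ∀ (h : ℂ) (g : B →ₗ[ℂ] ℂ), (∀ h', h' ≠ h → ∀ w ∈ WB h', g w = 0) →
    ∃ f ∈ WB' h, ∀ w, pB f w = g w
  perfect' : ∀ (h : ℂ) (g : B' →ₗ[ℂ] ℂ), (∀ h', h' ≠ h → ∀ f ∈ WB' h', g f = 0) →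
    ∃ w ∈ WB h, ∀ f, pB f w = g f
  separating : ∀ f, (∀ w, pB f w = 0) → f = 0
  separating' : ∀ w, (∀ f, pB f w = 0) → w = 0

variable {WB : ℂ → Submodule ℂ B} {WB' : ℂ → Submodule ℂ B'} {WC : ℂ → Submodule ℂ C}
  {WC' : ℂ → Submodule ℂ C'}

theorem GradedPair.symm (P : GradedPair 𝓥 YB YB' pB WB WB') :
    GradedPair 𝓥 YB' YB pB.flip WB' WB where
  opposite := P.opposite.symm
  vir_zero := P.vir_zero'
  vir_zero' := P.vir_zero
  span := P.span'
  span' := P.span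
  bounded := P.bounded'
  bounded' := P.bounded
  perfect := P.perfect'
  perfect' := P.perfect
  separating := P.separating'
  separating' := P.separating

/-- Vectors of different weights are orthogonal. -/
theorem GradedPair.eq_zero_of_ne (P : GradedPair 𝓥 YB YB' pB WB WB') {h h' : ℂ} {f : B'}
    (hf : f ∈ WB' h') {w : B} (hw : vir YB 𝓥.conf 0 w = h • w) (hh : h ≠ h') : pB f w = 0 := by
  have e := P.opposite.vir 0 f w
  rw [P.vir_zero' _ f hf, neg_zero, hw, map_smul, map_smul, LinearMap.smul_apply, smul_eq_mul,
    smul_eq_mul, ← sub_eq_zero, ← sub_mul, mul_eq_zero, sub_eq_zero] at e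
  exact e.resolve_left fun h => hh h.symm

theorem span_induction {W : ℂ → Submodule ℂ B} (hW : ⨆ h, W h = ⊤) {P : B → Prop} (h0 : P 0)
    (hadd : ∀ x y, P x → P y → P (x + y)) (hom : ∀ i, ∀ x ∈ W i, P x) (x : B) : P x := by
  have hx : x ∈ ⨆ i, W i := by rw [hW]; trivial
  induction hx using Submodule.iSup_induction' with
  | mem i x hx => exact hom i x hx
  | zero => exact h0
  | add x y _ _ hx hy => exact hadd x y hx hy

variable {M : VOAModule 𝓥 A} {r : ℤ} {𝒴 : A →ₗ[ℂ] B →ₗ[ℂ] (ℂ → C)}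
  {𝒵 : A →ₗ[ℂ] C' →ₗ[ℂ] (ℂ → B')}

/-- The homogeneous functional `b ↦ ⟨c', 𝒴(e^{xL(1)} e^{(2r+1)πiL(0)} x^{-2L(0)} a, x^{-1})b⟩`
is represented by a homogeneous vector. -/
theorem GradedPair.exists_represent (PB : GradedPair 𝓥 YB YB' pB WB WB')
    (PC : GradedPair 𝓥 YC YC' pC WC WC') (hY : IsIntertwining 𝓥.conf M.Y YB YC 𝒴) {α γ : ℂ}
    {a : A} (ha : a ∈ M.weight α) {c' : C'} (hc : c' ∈ WC' γ) (n : ℂ) :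
    ∃ f ∈ WB' (γ + α - n - 1), ∀ b, pB f b = Complex.exp (twist r * α) *
      ∑ᶠ k : ℕ, pC c' (cmode 𝒴 (2 * α - k - n - 2) (divPow (M.L 1) k a) b) := by
  obtain ⟨K, hK⟩ := (M.eventually_divPow_L_one a).exists
  let g : B →ₗ[ℂ] ℂ := Complex.exp (twist r * α) • ∑ k ∈ Finset.range K,
    pC c' ∘ₗ LinearMap.proj (-(2 * α - k - n - 2) - 1) ∘ₗ 𝒴 (divPow (M.L 1) k a)
  have hg : ∀ b, g b = Complex.exp (twist r * α) *
      ∑ᶠ k : ℕ, pC c' (cmode 𝒴 (2 * α - k - n - 2) (divPow (M.L 1) k a) b) := by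
    intro b
    rw [finsum_eq_sum_range (N := K) fun k hk => by rw [hK k hk, cmode_zero_left, map_zero]]
    simp only [g, LinearMap.smul_apply, LinearMap.sum_apply, smul_eq_mul]
    rfl
  obtain ⟨f, hf, hfg⟩ := PB.perfect (γ + α - n - 1) g fun β hβ b hb => by
    rw [hg]
    refine mul_eq_zero_of_right _ ((finsum_congr fun k => ?_).trans finsum_zero)
    have h1 := hY.vir_zero_cmode (M.vir_zero _ _ (M.divPow_L_one_mem ha k)) (PB.vir_zero _ _ hb)
      (2 * α - k - n - 2)
    refine PC.eq_zero_of_ne hc h1 fun h => hβ ?_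
    linear_combination h
  exact ⟨f, hf, fun b => (hfg b).trans (hg b)⟩

theorem GradedPair.cmode_mem (PB : GradedPair 𝓥 YB YB' pB WB WB')
    (PC : GradedPair 𝓥 YC YC' pC WC WC') (hY : IsIntertwining 𝓥.conf M.Y YB YC 𝒴)
    (HZ : IsContra M r pB pC 𝒴 𝒵) {α γ : ℂ} {a : A} (ha : a ∈ M.weight α) {c' : C'}
    (hc : c' ∈ WC' γ) (n : ℂ) : cmode 𝒵 n a c' ∈ WB' (γ + α - n - 1) := by
  obtain ⟨f, hf, h⟩ := PB.exists_represent (r := r) PC hY ha hc n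
  have : cmode 𝒵 n a c' = f := by
    rw [← sub_eq_zero]
    refine PB.separating _ fun b => ?_
    rw [map_sub, LinearMap.sub_apply, h, HZ α a ha, sub_self]
  rwa [this]

theorem GradedPair.isIntertwining_of_isContra (PB : GradedPair 𝓥 YB YB' pB WB WB')
    (PC : GradedPair 𝓥 YC YC' pC WC WC') (hY : IsIntertwining 𝓥.conf M.Y YB YC 𝒴)
    (HZ : IsContra M r pB pC 𝒴 𝒵) : IsIntertwining 𝓥.conf M.Y YC' YB' 𝒵 := by
  refine HZ.isIntertwining PB.opposite PC.opposite PB.separating hY fun a c' => ?_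
  induction a using homog_induction M.isInternal with
  | h0 => exact ⟨0, fun n _ => by simp [cmode]⟩
  | hadd x y hx hy =>
    obtain ⟨N, hN⟩ := hx
    obtain ⟨N', hN'⟩ := hy
    refine ⟨max N N', fun n hn => ?_⟩
    rw [cmode_add_left, hN n (lt_of_le_of_lt (le_max_left _ _) hn),
      hN' n (lt_of_le_of_lt (le_max_right _ _) hn), add_zero]
  | hom α a ha =>
    induction c' using span_induction PC.span' with
    | h0 => exact ⟨0, fun n _ => by simp [cmode]⟩
    | hadd x y hx hy =>
      obtain ⟨N, hN⟩ := hx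
      obtain ⟨N', hN'⟩ := hy
      refine ⟨max N N', fun n hn => ?_⟩
      rw [cmode_add_right, hN n (lt_of_le_of_lt (le_max_left _ _) hn),
        hN' n (lt_of_le_of_lt (le_max_right _ _) hn), add_zero]
    | hom γ c' hc =>
      obtain ⟨N, hN⟩ := PB.bounded'
      refine ⟨γ.re + α.re - 1 - N, fun n hn => ?_⟩
      have h1 := PB.cmode_mem PC hY HZ ha hc n
      rwa [hN _ (by simp; linarith), Submodule.mem_bot] at h1

theorem IsContra.unique (hp : ∀ f, (∀ b, pB f b = 0) → f = 0)
    {𝒵' : A →ₗ[ℂ] C' →ₗ[ℂ] (ℂ → B')} (H : IsContra M r pB pC 𝒴 𝒵)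
    (H' : IsContra M r pB pC 𝒴 𝒵') : 𝒵 = 𝒵' := by
  refine LinearMap.ext fun a => ?_
  induction a using homog_induction M.isInternal with
  | h0 => simp
  | hadd x y hx hy => rw [map_add, map_add, hx, hy]
  | hom h a ha =>
    ext c' s
    rw [← sub_eq_zero]
    refine hp _ fun b => ?_
    have h1 := (H h a ha c' b (-s - 1)).trans (H' h a ha c' b (-s - 1)).symm
    rw [cmode, cmode, show -(-s - 1) - 1 = s by ring] at h1
    rw [map_sub, LinearMap.sub_apply, h1, sub_self]

/-- Linear maps prescribed on the homogeneous subspaces. -/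
theorem exists_linearMap_homogeneous {ι E X : Type*} [DecidableEq ι] [AddCommGroup E] [Module ℂ E]
    [AddCommGroup X] [Module ℂ X] {W : ι → Submodule ℂ E} (hW : DirectSum.IsInternal W)
    (T : ι → E →ₗ[ℂ] X) : ∃ S : E →ₗ[ℂ] X, ∀ i, ∀ x ∈ W i, S x = T i x := by
  refine ⟨DirectSum.toModule ℂ ι X (fun i => T i ∘ₗ (W i).subtype) ∘ₗ
    (LinearEquiv.ofBijective (DirectSum.coeLinearMap W) hW).symm.toLinearMap, fun i x hx => ?_⟩
  have h : (LinearEquiv.ofBijective (DirectSum.coeLinearMap W) hW).symm x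
      = DirectSum.lof ℂ ι (fun j => W j) i ⟨x, hx⟩ := by
    rw [LinearEquiv.symm_apply_eq]
    exact (DirectSum.coeLinearMap_lof W i ⟨x, hx⟩).symm
  rw [LinearMap.comp_apply, LinearEquiv.coe_coe, h, DirectSum.toModule_lof]
  rfl

/-- The functional-valued series `b ↦ ⟨c', 𝒴(Sa, u(x))b⟩`. -/
def functionalSeries (pC : C' →ₗ[ℂ] C →ₗ[ℂ] ℂ) (𝒴 : A →ₗ[ℂ] B →ₗ[ℂ] (ℂ → C))
    (S : Module.End ℂ A) (u : ℂ → ℂ) : A →ₗ[ℂ] C' →ₗ[ℂ] (ℂ → (B →ₗ[ℂ] ℂ)) :=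
  LinearMap.mk₂ ℂ (fun a c' s => pC c' ∘ₗ LinearMap.proj (u s) ∘ₗ 𝒴 (S a))
    (by intros; ext; simp) (by intros; ext; simp) (by intros; ext; simp) (by intros; ext; simp)

theorem VOAModule.exists_divPow_L_one_weight (M : VOAModule 𝓥 A) (h : ℂ) :
    ∃ K : ℕ, ∀ k, K ≤ k → ∀ a ∈ M.weight h, divPow (M.L 1) k a = 0 := by
  obtain ⟨N, hN⟩ := M.weight_eq_bot
  obtain ⟨K, hK⟩ := exists_nat_gt (h.re - N)
  refine ⟨K, fun k hk a ha => ?_⟩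
  have h1 := M.divPow_L_one_mem ha k
  have h2 : (K : ℝ) ≤ k := by exact_mod_cast hk
  rwa [hN (h - k) (by simp; linarith), Submodule.mem_bot] at h1

theorem GradedPair.exists_isContra (PB : GradedPair 𝓥 YB YB' pB WB WB')
    (PC : GradedPair 𝓥 YC YC' pC WC WC') (hY : IsIntertwining 𝓥.conf M.Y YB YC 𝒴) (r : ℤ) :
    ∃ 𝒵 : A →ₗ[ℂ] C' →ₗ[ℂ] (ℂ → B'), IsContra M r pB pC 𝒴 𝒵 := by
  choose K hK using M.exists_divPow_L_one_weight
  obtain ⟨T, hT⟩ := exists_linearMap_homogeneous M.isInternal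
    (fun h => Complex.exp (twist r * h) • ∑ k ∈ Finset.range (K h),
      functionalSeries pC 𝒴 (divPow (M.L 1) k) (fun s => -(2 * h - k - (-s - 1) - 2) - 1))
  have hT' : ∀ h, ∀ a ∈ M.weight h, ∀ c' s b, T a c' s b = Complex.exp (twist r * h) *
      ∑ᶠ k : ℕ, pC c' (cmode 𝒴 (2 * h - k - (-s - 1) - 2) (divPow (M.L 1) k a) b) := by
    intro h a ha c' s b
    rw [hT h a ha, finsum_eq_sum_range (N := K h) fun k hk => by
      rw [hK h k hk a ha, cmode_zero_left, map_zero]]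
    simp only [LinearMap.smul_apply, LinearMap.sum_apply, Pi.smul_apply, Finset.sum_apply,
      smul_eq_mul]
    rfl
  have hex : ∀ a c' s, ∃ f, ∀ b, pB f b = T a c' s b := by
    intro a c' s
    induction a using homog_induction M.isInternal with
    | h0 => exact ⟨0, fun b => by simp⟩
    | hadd x y hx hy =>
      obtain ⟨f, hf⟩ := hx
      obtain ⟨g, hg⟩ := hy
      exact ⟨f + g, fun b => by simp [hf, hg]⟩
    | hom α a ha =>
      induction c' using span_induction PC.span' with
      | h0 => exact ⟨0, fun b => by simp⟩
      | hadd x y hx hy =>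
        obtain ⟨f, hf⟩ := hx
        obtain ⟨g, hg⟩ := hy
        exact ⟨f + g, fun b => by simp [hf, hg]⟩
      | hom γ c' hc =>
        obtain ⟨f, -, hf⟩ := PB.exists_represent (r := r) PC hY ha hc (-s - 1)
        exact ⟨f, fun b => (hf b).trans (hT' α a ha c' s b).symm⟩
  choose z hz using hex
  have hsep : ∀ f g : B', (∀ b, pB f b = pB g b) → f = g := fun f g h => by
    rw [← sub_eq_zero]
    exact PB.separating _ fun b => by rw [map_sub, LinearMap.sub_apply, h, sub_self]
  refine ⟨LinearMap.mk₂ ℂ z (fun a a' c' => funext fun s => hsep _ _ fun b => by simp [hz])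
    (fun c a c' => funext fun s => hsep _ _ fun b => by simp [hz])
    (fun a c' d' => funext fun s => hsep _ _ fun b => by simp [hz])
    (fun c a c' => funext fun s => hsep _ _ fun b => by simp [hz]), fun h a ha c' b n => ?_⟩
  refine (hz a c' (-n - 1) b).trans ((hT' h a ha c' (-n - 1) b).trans ?_)
  rw [show -(-n - 1) - 1 = n by ring]

theorem IsContra.add {𝒴' : A →ₗ[ℂ] B →ₗ[ℂ] (ℂ → C)} {𝒵' : A →ₗ[ℂ] C' →ₗ[ℂ] (ℂ → B')}
    (H : IsContra M r pB pC 𝒴 𝒵) (H' : IsContra M r pB pC 𝒴' 𝒵') :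
    IsContra M r pB pC (𝒴 + 𝒴') (𝒵 + 𝒵') := by
  intro h a ha c' b n
  obtain ⟨K, hK⟩ := (M.eventually_divPow_L_one a).exists
  rw [cmode_add, map_add, LinearMap.add_apply, H.eq_sum ha hK, H'.eq_sum ha hK,
    finsum_eq_sum_range (N := K) fun k hk => by rw [hK k hk, cmode_zero_left, map_zero], ← mul_add,
    ← Finset.sum_add_distrib]
  simp only [cmode_add, map_add]

theorem IsContra.smul (c : ℂ) (H : IsContra M r pB pC 𝒴 𝒵) :
    IsContra M r pB pC (c • 𝒴) (c • 𝒵) := by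
  intro h a ha c' b n
  rw [cmode_smul, map_smul, LinearMap.smul_apply, H h a ha, smul_eq_mul]
  simp only [cmode_smul, map_smul]
  rw [← smul_finsum]
  exact mul_left_comm _ _ _

/-- The intertwining operator `A_r(𝒴)`. -/
def contraFun (r : ℤ) (PB : GradedPair 𝓥 YB YB' pB WB WB')
    (PC : GradedPair 𝓥 YC YC' pC WC WC') (𝒴 : intertwining 𝓥.conf M.Y YB YC) :
    intertwining 𝓥.conf M.Y YC' YB' :=
  ⟨(PB.exists_isContra PC 𝒴.2 r).choose,
    PB.isIntertwining_of_isContra PC 𝒴.2 (PB.exists_isContra PC 𝒴.2 r).choose_spec⟩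

theorem isContra_contraFun (r : ℤ) (PB : GradedPair 𝓥 YB YB' pB WB WB')
    (PC : GradedPair 𝓥 YC YC' pC WC WC') (𝒴 : intertwining 𝓥.conf M.Y YB YC) :
    IsContra M r pB pC 𝒴.1 (contraFun r PB PC 𝒴).1 :=
  (PB.exists_isContra PC 𝒴.2 r).choose_spec

/-- `A_r` as a linear isomorphism between spaces of intertwining operators. -/
def contraEquiv (M : VOAModule 𝓥 A) (r : ℤ) (PB : GradedPair 𝓥 YB YB' pB WB WB')
    (PC : GradedPair 𝓥 YC YC' pC WC WC') :
    intertwining 𝓥.conf M.Y YB YC ≃ₗ[ℂ] intertwining 𝓥.conf M.Y YC' YB' where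
  toFun := contraFun r PB PC
  invFun := contraFun (-r - 1) PC.symm PB.symm
  map_add' 𝒴 𝒵 := Subtype.ext <| IsContra.unique PB.separating (isContra_contraFun r PB PC _)
    ((isContra_contraFun r PB PC 𝒴).add (isContra_contraFun r PB PC 𝒵))
  map_smul' c 𝒴 := Subtype.ext <| IsContra.unique PB.separating (isContra_contraFun r PB PC _)
    ((isContra_contraFun r PB PC 𝒴).smul c)
  left_inv 𝒴 := Subtype.ext <| IsContra.unique PC.separating'
    (isContra_contraFun (-r - 1) PC.symm PB.symm _) (isContra_contraFun r PB PC 𝒴).symm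
  right_inv 𝒵 := Subtype.ext <| IsContra.unique PB.separating
    (isContra_contraFun r PB PC _) <| by
      have := (isContra_contraFun (-r - 1) PC.symm PB.symm 𝒵).symm
      rwa [show -(-r - 1) - 1 = r by ring] at this

theorem isContra_contraEquiv (PB : GradedPair 𝓥 YB YB' pB WB WB')
    (PC : GradedPair 𝓥 YC YC' pC WC WC') (𝒴 : intertwining 𝓥.conf M.Y YB YC) :
    IsContra M r pB pC 𝒴.1 (contraEquiv M r PB PC 𝒴).1 :=
  isContra_contraFun r PB PC 𝒴

end GradedPairs

section DualPair

variable {V W : Type*} [AddCommGroup V] [Module ℂ V] {𝓥 : VertexOperatorAlgebra V}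
  [AddCommGroup W] [Module ℂ W]

/-- The homogeneous subspace `(W_(h))^*` of the contragredient module. -/
def VOAModule.dualWeight (M : VOAModule 𝓥 W) (h : ℂ) : Submodule ℂ M.dualSpace where
  carrier := {f | ∀ h', h' ≠ h → ∀ w ∈ M.weight h', f.1 w = 0}
  zero_mem' := fun _ _ _ _ => rfl
  add_mem' hf hg h' hh w hw := by
    show _ + _ = (0 : ℂ)
    rw [hf h' hh w hw, hg h' hh w hw, add_zero]
  smul_mem' c f hf h' hh w hw := by
    show c • f.1 w = 0
    rw [hf h' hh w hw, smul_zero]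

/-- A functional on `W_(h)`, extended by zero to the other homogeneous subspaces. -/
def VOAModule.extendDual (M : VOAModule 𝓥 W) (h : ℂ) :
    Module.Dual ℂ (M.weight h) →ₗ[ℂ] M.dualSpace where
  toFun g := ⟨g ∘ₗ (proj M.isInternal h).codRestrict (M.weight h) (proj_mem M.isInternal h), by
    refine (Set.finite_singleton h).subset ?_
    rintro h' ⟨w, hw, hne⟩
    by_contra hh
    refine hne ?_
    have : (proj M.isInternal h).codRestrict (M.weight h) (proj_mem M.isInternal h) w = 0 :=
      Subtype.ext (proj_ne M.isInternal hh hw)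
    rw [LinearMap.comp_apply, this, map_zero]⟩
  map_add' _ _ := rfl
  map_smul' _ _ := rfl

theorem VOAModule.extendDual_of_mem (M : VOAModule 𝓥 W) {h : ℂ} (g : Module.Dual ℂ (M.weight h))
    {w : W} (hw : w ∈ M.weight h) : (M.extendDual h g).1 w = g ⟨w, hw⟩ :=
  congrArg g (Subtype.ext (proj_self M.isInternal h hw))

theorem VOAModule.extendDual_of_ne (M : VOAModule 𝓥 W) {h h' : ℂ} (hh : h' ≠ h)
    (g : Module.Dual ℂ (M.weight h)) {w : W} (hw : w ∈ M.weight h') :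
    (M.extendDual h g).1 w = 0 :=
  (congrArg g (Subtype.ext (proj_ne M.isInternal hh hw))).trans (map_zero g)

theorem VOAModule.extendDual_mem (M : VOAModule 𝓥 W) {h : ℂ} (g : Module.Dual ℂ (M.weight h)) :
    M.extendDual h g ∈ M.dualWeight h :=
  fun _ hh _ hw => M.extendDual_of_ne hh g hw

theorem VOAModule.dual_ext (M : VOAModule 𝓥 W) {f g : M.dualSpace}
    (h : ∀ i, ∀ w ∈ M.weight i, f.1 w = g.1 w) : f = g := by
  refine Subtype.ext (LinearMap.ext fun w => ?_)
  induction w using homog_induction M.isInternal with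
  | h0 => rw [map_zero, map_zero]
  | hadd x y hx hy => rw [map_add, map_add, hx, hy]
  | hom i w hw => exact h i w hw

theorem VOAModule.extendDual_restrict (M : VOAModule 𝓥 W) {h : ℂ} {f : M.dualSpace}
    (hf : f ∈ M.dualWeight h) : M.extendDual h (f.1 ∘ₗ (M.weight h).subtype) = f := by
  refine M.dual_ext fun i w hw => ?_
  by_cases hi : i = h
  · subst hi
    exact M.extendDual_of_mem _ hw
  · rw [M.extendDual_of_ne hi _ hw, hf i hi w hw]

theorem VOAModule.iSup_dualWeight (M : VOAModule 𝓥 W) : ⨆ h, M.dualWeight h = ⊤ := by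
  rw [eq_top_iff]
  rintro f -
  have hfin : {h : ℂ | ∃ w ∈ M.weight h, f.1 w ≠ 0}.Finite := f.2
  have : f = ∑ h ∈ hfin.toFinset, M.extendDual h (f.1 ∘ₗ (M.weight h).subtype) := by
    refine M.dual_ext fun i w hw => ?_
    rw [AddSubmonoidClass.coe_finsetSum, LinearMap.sum_apply]
    by_cases hi : i ∈ hfin.toFinset
    · rw [Finset.sum_eq_single_of_mem i hi fun j _ hj => M.extendDual_of_ne hj.symm _ hw]
      exact (M.extendDual_of_mem (f.1 ∘ₗ (M.weight i).subtype) hw).symm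
    · rw [Finset.sum_eq_zero fun j hj =>
        M.extendDual_of_ne (fun e : i = j => hi (by rw [e]; exact hj)) _ hw]
      by_contra hne
      exact hi (hfin.mem_toFinset.mpr ⟨w, hw, hne⟩)
  rw [this]
  exact Submodule.sum_mem _ fun h _ =>
    Submodule.mem_iSup_of_mem h (M.extendDual_mem _)

theorem VOAModule.isOpposite_dualY (M : VOAModule 𝓥 W) :
    IsOpposite 𝓥 M.Y M.dualY M.dualSpace.subtype := by
  intro h v hv n f w
  obtain ⟨K, hK⟩ := (VertexOperatorAlgebra.eventually_divPow_L_one hv).exists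
  show (mode M.dualY n v f).1 w = _
  rw [M.mode_dualY, finsum_eq_sum_range (N := K) fun k hk => by simp [hK k hk]]
  have e : M.oppMode n v = ∑ k ∈ Finset.range K,
      (-1 : ℂ) ^ h • mode M.Y (2 * h - k - n - 2) (divPow (𝓥.L 1) k v) := by
    rw [VOAModule.oppMode, finsum_eq_sum_of_support_subset
      (s := (Finset.range K).map ⟨fun k => (h, k), fun i j hij => (Prod.ext_iff.mp hij).2⟩),
      Finset.sum_map]
    · refine Finset.sum_congr rfl fun k _ => ?_
      show ((-1 : ℂ) ^ h / (k ! : ℂ)) • mode M.Y (2 * h - k - n - 2)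
        ((vir 𝓥.Y 𝓥.conf 1 ^ k) (proj 𝓥.isInternal h v)) = _
      rw [proj_self _ _ hv, divPow, LinearMap.smul_apply, map_smul, smul_smul, div_eq_mul_inv]
    · rintro ⟨h', k⟩ hp
      by_contra hne
      refine hp ?_
      by_cases hh : h = h'
      · subst hh
        have hk : K ≤ k := by
          by_contra hk
          exact hne (Finset.mem_coe.2 (Finset.mem_map.2 ⟨k, by simpa using hk, rfl⟩))
        have h0 := hK k hk
        rw [divPow, LinearMap.smul_apply, smul_eq_zero] at h0
        have h0' := h0.resolve_left (by simp [Nat.factorial_ne_zero])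
        simp [proj_self _ _ hv, h0']
      · simp [proj_ne 𝓥.isInternal hh hv]
  rw [e, LinearMap.sum_apply, map_sum, Finset.mul_sum]
  refine Finset.sum_congr rfl fun k _ => ?_
  rw [LinearMap.smul_apply, map_smul]
  rfl

theorem VOAModule.gradedPair (M : VOAModule 𝓥 W) :
    GradedPair 𝓥 M.Y M.dualY M.dualSpace.subtype M.weight M.dualWeight where
  opposite := M.isOpposite_dualY
  vir_zero := M.vir_zero
  vir_zero' h f hf := by
    refine M.dual_ext fun i w hw => ?_
    have h1 := M.isOpposite_dualY.vir 0 f w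
    rw [neg_zero, M.vir_zero i w hw] at h1
    refine h1.trans ?_
    show f.1 (i • w) = h • f.1 w
    rw [map_smul]
    by_cases hi : i = h
    · rw [hi]
    · rw [hf i hi w hw, smul_zero, smul_zero]
  span := M.isInternal.submodule_iSup_eq_top
  span' := M.iSup_dualWeight
  bounded := M.weight_eq_bot
  bounded' := by
    obtain ⟨N, hN⟩ := M.weight_eq_bot
    refine ⟨N, fun h hh => ?_⟩
    rw [eq_bot_iff]
    intro f hf
    rw [Submodule.mem_bot]
    refine M.dual_ext fun i w hw => ?_
    by_cases hi : i = h
    · subst hi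
      rw [hN i hh, Submodule.mem_bot] at hw
      rw [hw, map_zero, map_zero]
    · exact hf i hi w hw
  perfect h g hg := by
    refine ⟨⟨g, (Set.finite_singleton h).subset ?_⟩, hg, fun w => rfl⟩
    rintro h' ⟨w, hw, hne⟩
    by_contra hh
    exact hne (hg h' hh w hw)
  perfect' h g hg := by
    have := M.finiteDimensional h
    refine ⟨(Module.evalEquiv ℂ (M.weight h)).symm (g ∘ₗ M.extendDual h), Subtype.property _,
      fun f => ?_⟩
    induction f using span_induction M.iSup_dualWeight with
    | h0 => simp
    | hadd x y hx hy => rw [map_add, map_add, LinearMap.add_apply, hx, hy]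
    | hom i f hf =>
      by_cases hi : i = h
      · subst hi
        rw [← M.extendDual_restrict hf]
        refine (M.extendDual_of_mem _ (Subtype.property _)).trans ?_
        exact Module.apply_evalEquiv_symm_apply ℂ (M.weight i) _ _
      · rw [hg i hi f hf]
        exact hf h (fun e => hi e.symm) _ (Subtype.property _)
  separating f hf := Subtype.ext (LinearMap.ext hf)
  separating' w hw := by
    have h0 : ∀ h, proj M.isInternal h w = 0 := by
      intro h
      have h1 : (⟨proj M.isInternal h w, proj_mem M.isInternal h w⟩ : M.weight h) = 0 := by
        rw [← Module.forall_dual_apply_eq_zero_iff ℂ]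
        exact fun g => hw (M.extendDual h g)
      exact congrArg Subtype.val h1
    rw [← proj_self M.isInternal 0 (eq_proj M.isInternal 0 fun j _ => h0 j), h0]

theorem VOAModule.isTranslation_dualY (M : VOAModule 𝓥 W) : IsTranslation 𝓥.conf M.dualY :=
  M.isOpposite_dualY.isTranslation M M.gradedPair.separating

end DualPair

section FiniteSeries

variable {W W₁ W₂ W₃ : Type*} [AddCommGroup W] [Module ℂ W] [AddCommGroup W₁] [Module ℂ W₁]
  [AddCommGroup W₂] [Module ℂ W₂] [AddCommGroup W₃] [Module ℂ W₃]

theorem expMul_sum_single {ι : Type*} (I : Finset ι) (c : ℂ) (d : ℤ) (T : Module.End ℂ W)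
    (t : ι → ℂ) (x : ι → W) {K : ℕ} (hK : ∀ i ∈ I, ∀ k, K ≤ k → divPow T k (x i) = 0) :
    expMul c d T (∑ i ∈ I, Pi.single (t i) (x i))
      = ∑ p ∈ I ×ˢ Finset.range K,
          Pi.single (t p.1 + d * (p.2 : ℕ)) (c ^ p.2 • divPow T p.2 (x p.1)) := by
  funext s
  have e : ∀ k : ℕ, (c ^ k / (k ! : ℂ)) • (T ^ k) ((∑ i ∈ I, Pi.single (t i) (x i) : ℂ → W) (s - d * k))
      = ∑ i ∈ I, (Pi.single (t i + d * k) (c ^ k • divPow T k (x i)) : ℂ → W) s := by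
    intro k
    rw [Finset.sum_apply, map_sum, Finset.smul_sum]
    refine Finset.sum_congr rfl fun i _ => ?_
    by_cases h : s = t i + d * k
    · subst h
      rw [Pi.single_eq_same, add_sub_cancel_right, Pi.single_eq_same, divPow,
        LinearMap.smul_apply, smul_smul, div_eq_mul_inv]
    · rw [Pi.single_eq_of_ne h, Pi.single_eq_of_ne (fun h' => h (by rw [← h']; ring)), map_zero,
        smul_zero]
  rw [expMul, finsum_congr e, finsum_eq_sum_range (N := K), Finset.sum_apply,
    Finset.sum_product_right]
  intro k hk
  refine Finset.sum_eq_zero fun i hi => ?_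
  rw [hK i hi k hk, smul_zero, Pi.single_zero, Pi.zero_apply]

theorem applyInv_sum_single {ι κ : Type*} (𝒴 : W₁ →ₗ[ℂ] W₂ →ₗ[ℂ] (ℂ → W₃)) (I : Finset ι)
    (J : Finset κ) (t : ι → ℂ) (x : ι → W₁) (u : κ → ℂ) (y : κ → W₂) (s : ℂ) :
    applyInv 𝒴 (∑ i ∈ I, Pi.single (t i) (x i)) (∑ j ∈ J, Pi.single (u j) (y j)) s
      = ∑ i ∈ I, ∑ j ∈ J, 𝒴 (x i) (y j) (-(s - t i - u j)) := by
  have e : ∀ p : ℂ × ℂ, 𝒴 ((∑ i ∈ I, Pi.single (t i) (x i) : ℂ → W₁) p.1)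
        ((∑ j ∈ J, Pi.single (u j) (y j) : ℂ → W₂) p.2) (-(s - p.1 - p.2))
      = ∑ q ∈ I ×ˢ J, 𝒴 ((Pi.single (t q.1) (x q.1) : ℂ → W₁) p.1)
        ((Pi.single (u q.2) (y q.2) : ℂ → W₂) p.2) (-(s - p.1 - p.2)) := by
    intro p
    rw [Finset.sum_product]
    simp only [Finset.sum_apply, map_sum, LinearMap.sum_apply]
    exact Finset.sum_comm
  have h0 : ∀ (q : ι × κ) (p : ℂ × ℂ), p ≠ (t q.1, u q.2) →
      𝒴 ((Pi.single (t q.1) (x q.1) : ℂ → W₁) p.1)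
        ((Pi.single (u q.2) (y q.2) : ℂ → W₂) p.2) (-(s - p.1 - p.2)) = 0 := by
    rintro q ⟨a, b⟩ hp
    by_cases h1 : a = t q.1
    · have h2 : b ≠ u q.2 := fun h2 => hp (by rw [h1, h2])
      simp [Pi.single_eq_of_ne h2]
    · simp [Pi.single_eq_of_ne h1]
  rw [applyInv, finsum_congr e, finsum_sum_comm, ← Finset.sum_product']
  · refine Finset.sum_congr rfl fun q _ => ?_
    rw [finsum_eq_single _ _ (h0 q), Pi.single_eq_same, Pi.single_eq_same]
  · intro q _
    refine (Set.finite_singleton (t q.1, u q.2)).subset fun p hp => ?_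
    by_contra hne
    exact hp (h0 q p hne)

theorem pairing_sum_single {ι : Type*} {D : Submodule ℂ (Module.Dual ℂ W)} (I : Finset ι)
    (t : ι → ℂ) (x : ι → D) (g : ℂ → W) (s : ℂ) :
    pairing (∑ i ∈ I, Pi.single (t i) (x i)) g s = ∑ i ∈ I, (x i).1 (g (s - t i)) := by
  have e : ∀ u : ℂ, ((∑ i ∈ I, Pi.single (t i) (x i) : ℂ → D) u).1 (g (s - u))
      = ∑ i ∈ I, ((Pi.single (t i) (x i) : ℂ → D) u).1 (g (s - u)) := by
    intro u
    rw [Finset.sum_apply, AddSubmonoidClass.coe_finsetSum, LinearMap.sum_apply]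
  have h0 : ∀ (i : ι) (u : ℂ), u ≠ t i →
      ((Pi.single (t i) (x i) : ℂ → D) u).1 (g (s - u)) = 0 := by
    intro i u hu
    rw [Pi.single_eq_of_ne hu]
    rfl
  rw [pairing, finsum_congr e, finsum_sum_comm]
  · refine Finset.sum_congr rfl fun i _ => ?_
    rw [finsum_eq_single _ _ (h0 i), Pi.single_eq_same]
  · intro i _
    refine (Set.finite_singleton (t i)).subset fun u hu => ?_
    by_contra hne
    exact hu (h0 i u hne)

theorem const_eq_sum_single {W : Type*} [AddCommGroup W] (w : W) :
    const w = ∑ _i ∈ Finset.range 1, (Pi.single 0 w : ℂ → W) := by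
  rw [Finset.sum_range_one]
  rfl

theorem pairing_const {D : Submodule ℂ (Module.Dual ℂ W)} (f : D) (g : ℂ → W) (s : ℂ) :
    pairing (const f) g s = f.1 (g s) := by
  rw [const_eq_sum_single, pairing_sum_single, Finset.sum_range_one, sub_zero]

theorem expMul_const (c : ℂ) (d : ℤ) (T : Module.End ℂ W) (w : W) {K : ℕ}
    (hK : ∀ k, K ≤ k → divPow T k w = 0) :
    expMul c d T (const w)
      = ∑ k ∈ Finset.range K, Pi.single ((d : ℂ) * (k : ℕ)) (c ^ k • divPow T k w) := by
  rw [const_eq_sum_single, expMul_sum_single (Finset.range 1) c d T (fun _ => 0) (fun _ => w)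
    fun _ _ => hK, Finset.sum_product, Finset.sum_range_one]
  simp only [zero_add]

variable {A : ℂ → Submodule ℂ W}

theorem sum_proj (hA : DirectSum.IsInternal A) (w : W) :
    w = ∑ h ∈ (proj_finite hA w).toFinset, proj hA h w := by
  rw [← sub_eq_zero]
  have h0 : ∀ j, proj hA j (w - ∑ h ∈ (proj_finite hA w).toFinset, proj hA h w) = 0 := by
    intro j
    rw [map_sub, map_sum, sub_eq_zero]
    by_cases hj : j ∈ (proj_finite hA w).toFinset
    · rw [Finset.sum_eq_single_of_mem j hj fun i _ hi => proj_ne hA hi (proj_mem hA i w),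
        proj_self hA j (proj_mem hA j w)]
    · rw [Finset.sum_eq_zero fun i hi =>
        proj_ne hA (fun e : i = j => hj (by rw [← e]; exact hi)) (proj_mem hA i w)]
      by_contra hne
      exact hj ((proj_finite hA w).mem_toFinset.mpr hne)
  rw [← proj_self hA 0 (eq_proj hA 0 fun j _ => h0 j), h0]

theorem weightTwist_eq_sum_single (hA : DirectSum.IsInternal A) (a : ℂ) (w : W) :
    weightTwist hA a w = ∑ h ∈ (proj_finite hA w).toFinset,
      Pi.single (-2 * h) (Complex.exp (a * h) • proj hA h w) := by
  funext s
  rw [weightTwist, Finset.sum_apply]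
  by_cases hs : -s / 2 ∈ (proj_finite hA w).toFinset
  · rw [Finset.sum_eq_single_of_mem _ hs fun h _ hh =>
      Pi.single_eq_of_ne (fun e => hh (by rw [e]; ring)) _,
      show -2 * (-s / 2) = s by ring, Pi.single_eq_same]
  · rw [Finset.sum_eq_zero fun h hh =>
      Pi.single_eq_of_ne (fun e => hs (by rw [e, show -(-2 * h) / 2 = h by ring]; exact hh)) _]
    have : proj hA (-s / 2) w = 0 := by
      by_contra hne
      exact hs ((proj_finite hA w).mem_toFinset.mpr hne)
    rw [this, smul_zero]

end FiniteSeries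

section Formula

variable {V : Type*} [AddCommGroup V] [Module ℂ V] {𝓥 : VertexOperatorAlgebra V}
  {A B C C' : Type*} [AddCommGroup A] [Module ℂ A] [AddCommGroup B] [Module ℂ B]
  [AddCommGroup C] [Module ℂ C] [AddCommGroup C'] [Module ℂ C']

theorem VOAModule.exists_divPow_L_one_proj (M : VOAModule 𝓥 A) (a : A) :
    ∀ᶠ K : ℕ in Filter.atTop, ∀ h ∈ (proj_finite M.isInternal a).toFinset, ∀ k, K ≤ k →
      divPow (M.L 1) k (proj M.isInternal h a) = 0 := by
  rw [Filter.eventually_all_finset]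
  exact fun h _ => M.eventually_divPow_L_one _

theorem expMul_weightTwist (M : VOAModule 𝓥 A) (c ζ : ℂ) (a : A) {K : ℕ}
    (hK : ∀ h ∈ (proj_finite M.isInternal a).toFinset, ∀ k, K ≤ k →
      divPow (M.L 1) k (proj M.isInternal h a) = 0) :
    expMul c 1 (M.L 1) (weightTwist M.isInternal ζ a)
      = ∑ p ∈ (proj_finite M.isInternal a).toFinset ×ˢ Finset.range K,
          Pi.single (-2 * p.1 + (p.2 : ℕ)) ((c ^ p.2 * Complex.exp (ζ * p.1)) •
            divPow (M.L 1) p.2 (proj M.isInternal p.1 a)) := by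
  rw [weightTwist_eq_sum_single, expMul_sum_single _ c 1 (M.L 1) _ _ fun h hh k hk => by
    rw [map_smul, hK h hh k hk, smul_zero]]
  refine Finset.sum_congr rfl fun p _ => ?_
  rw [map_smul, smul_smul, Int.cast_one, one_mul]

theorem contra_eq_sum (M₁ : VOAModule 𝓥 A) (M₃ : VOAModule 𝓥 C) (r : ℤ)
    (𝒴 : A →ₗ[ℂ] B →ₗ[ℂ] (ℂ → C)) (a : A) (c' : M₃.dualSpace) (b : B) (s : ℂ) {K : ℕ}
    (hK : ∀ h ∈ (proj_finite M₁.isInternal a).toFinset, ∀ k, K ≤ k →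
      divPow (M₁.L 1) k (proj M₁.isInternal h a) = 0) :
    contra M₁ M₃ r 𝒴 a c' b s
      = ∑ h ∈ (proj_finite M₁.isInternal a).toFinset, Complex.exp (twist r * h) *
          ∑ k ∈ Finset.range K, c'.1 (𝒴 (divPow (M₁.L 1) k (proj M₁.isInternal h a)) b
            (-(s + 2 * h - k))) := by
  rw [contra, pairing_const, expMul_weightTwist M₁ 1 _ a hK, const_eq_sum_single,
    applyInv_sum_single, Finset.sum_product, map_sum]
  refine Finset.sum_congr rfl fun h _ => ?_
  rw [map_sum, Finset.mul_sum]
  refine Finset.sum_congr rfl fun k _ => ?_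
  rw [Finset.sum_range_one, one_pow, one_mul, map_smul, LinearMap.smul_apply, Pi.smul_apply,
    map_smul, smul_eq_mul, sub_zero, show s - (-2 * h + k) = s + 2 * h - k by ring]

theorem IsContra.eq_contra {M₁ : VOAModule 𝓥 A} {M₂ : VOAModule 𝓥 B} {M₃ : VOAModule 𝓥 C} {r : ℤ}
    {𝒴 : A →ₗ[ℂ] B →ₗ[ℂ] (ℂ → C)} {𝒵 : A →ₗ[ℂ] M₃.dualSpace →ₗ[ℂ] (ℂ → M₂.dualSpace)}
    (H : IsContra M₁ r M₂.dualSpace.subtype M₃.dualSpace.subtype 𝒴 𝒵) (a : A) (c' : M₃.dualSpace)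
    (b : B) (s : ℂ) : (𝒵 a c' s).1 b = contra M₁ M₃ r 𝒴 a c' b s := by
  obtain ⟨K, hK⟩ := (M₁.exists_divPow_L_one_proj a).exists
  rw [contra_eq_sum M₁ M₃ r 𝒴 a c' b s hK]
  conv_lhs => rw [sum_proj M₁.isInternal a]
  rw [map_sum, LinearMap.sum_apply, Finset.sum_apply, AddSubmonoidClass.coe_finsetSum,
    LinearMap.sum_apply]
  refine Finset.sum_congr rfl fun h hh => ?_
  have e := H.eq_sum (proj_mem M₁.isInternal h a) (hK h hh) c' b (-s - 1)
  simp only [cmode, Submodule.subtype_apply] at e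
  rw [show -(-s - 1) - 1 = s by ring] at e
  refine e.trans ?_
  congr 1
  refine Finset.sum_congr rfl fun k _ => ?_
  rw [show -(2 * h - (k : ℂ) - (-s - 1) - 2) - 1 = -(s + 2 * h - k) by ring]

theorem IsOpposite.divPow_vir {YC : V →ₗ[ℂ] VertexOperator ℂ C}
    {YC' : V →ₗ[ℂ] VertexOperator ℂ C'} {pC : C' →ₗ[ℂ] C →ₗ[ℂ] ℂ} (H : IsOpposite 𝓥 YC YC' pC)
    (n : ℤ) (k : ℕ) (f : C') (w : C) :
    pC f (divPow (VOA.vir YC 𝓥.conf (-n)) k w) = pC (divPow (VOA.vir YC' 𝓥.conf n) k f) w := by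
  simp only [divPow, LinearMap.smul_apply, map_smul]
  congr 1
  induction k generalizing f w with
  | zero => rfl
  | succ k ih =>
    rw [pow_succ, pow_succ', Module.End.mul_apply, Module.End.mul_apply, ih, H.vir]

theorem IsOpposite.skew_eq_sum {YC : V →ₗ[ℂ] VertexOperator ℂ C}
    {YC' : V →ₗ[ℂ] VertexOperator ℂ C'} {pC : C' →ₗ[ℂ] C →ₗ[ℂ] ℂ} (H : IsOpposite 𝓥 YC YC' pC)
    (r : ℤ) {𝒴 : A →ₗ[ℂ] B →ₗ[ℂ] (ℂ → C)} (hY : LowerTruncated 𝒴) (a : A) (b : B) (s : ℂ) (f : C')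
    {N : ℕ} (hN : ∀ k, N ≤ k → divPow (VOA.vir YC' 𝓥.conf 1) k f = 0) :
    pC f (skew 𝓥.conf YC r 𝒴 b a s)
      = ∑ i ∈ Finset.range N, Complex.exp (twist r * s) * (-1) ^ i *
          pC (divPow (VOA.vir YC' 𝓥.conf 1) i f) (𝒴 a b (s - i)) := by
  obtain ⟨N', h1, h2⟩ := ((hY.eventually_coeff a b s).and (Filter.eventually_ge_atTop N)).exists
  rw [VOA.skew_eq_sum 𝓥.conf YC r h1, map_sum, sum_range_eq_of_le h2]
  · refine Finset.sum_congr rfl fun i _ => ?_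
    rw [map_smul, smul_eq_mul, H.divPow_vir 1]
  · intro i hi
    rw [hN i hi, map_zero, LinearMap.zero_apply, mul_zero]

theorem VOAModule.eventually_divPow_dual_L_one (M : VOAModule 𝓥 A) (f : M.dualSpace) :
    ∀ᶠ K : ℕ in Filter.atTop, ∀ k, K ≤ k → divPow (vir M.dualY 𝓥.conf 1) k f = 0 := by
  induction f using span_induction M.iSup_dualWeight with
  | h0 => simp
  | hadd x y hx hy =>
    filter_upwards [hx, hy] with K h1 h2 k hk
    rw [map_add, h1 k hk, h2 k hk, add_zero]
  | hom h f hf =>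
    obtain ⟨N, hN⟩ := M.gradedPair.bounded'
    obtain ⟨K, hK⟩ := exists_nat_gt (h.re - N)
    have hmem : ∀ k : ℕ, (vir M.dualY 𝓥.conf 1 ^ k) f ∈ M.dualWeight (h - k) := by
      intro k
      induction k with
      | zero => simpa using hf
      | succ k ih =>
        intro i hi w hw
        rw [pow_succ', Module.End.mul_apply]
        refine (M.isOpposite_dualY.vir 1 _ w).trans ?_
        refine ih (i + 1) (fun e => hi ?_) _ ?_
        · push_cast
          linear_combination e
        · have := M.L_mem hw (-1)
          rwa [show i - ((-1 : ℤ) : ℂ) = i + 1 by push_cast; ring] at this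
    refine Filter.eventually_atTop.mpr ⟨K, fun K' hK' k hk => ?_⟩
    have h1 := hmem k
    have h2 : (K : ℝ) ≤ k := by exact_mod_cast hK'.trans hk
    rw [hN (h - k) (by simp; linarith), Submodule.mem_bot] at h1
    rw [divPow, LinearMap.smul_apply, h1, smul_zero]

variable {W₁ W₂ W₃ : Type*} [AddCommGroup W₁] [Module ℂ W₁]
  [AddCommGroup W₂] [Module ℂ W₂] [AddCommGroup W₃] [Module ℂ W₃]

/-- The composite `Ω_{r₃} ∘ A_{r₂} ∘ Ω_{r₃}`. -/
def braidEquiv (M₁ : VOAModule 𝓥 W₁) (M₂ : VOAModule 𝓥 W₂) (M₃ : VOAModule 𝓥 W₃) (r₂ r₃ : ℤ) :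
    intertwining 𝓥.conf M₁.Y M₂.Y M₃.Y ≃ₗ[ℂ] intertwining 𝓥.conf M₃.dualY M₂.Y M₁.dualY :=
  (skewEquiv 𝓥.conf M₁.Y M₂.Y M₃.Y M₃.isTranslation r₃).trans
    ((contraEquiv M₂ r₂ M₁.gradedPair M₃.gradedPair).trans
      (skewEquiv 𝓥.conf M₂.Y M₃.dualY M₁.dualY M₁.isTranslation_dualY r₃))

theorem braidEquiv_apply (M₁ : VOAModule 𝓥 W₁) (M₂ : VOAModule 𝓥 W₂) (M₃ : VOAModule 𝓥 W₃)
    {r r₂ r₃ : ℤ} (hr : r = r₂ - 2 * r₃ - 1) (𝒴 : intertwining 𝓥.conf M₁.Y M₂.Y M₃.Y)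
    (w₃' : M₃.dualSpace) (w₂ : W₂) (w₁ : W₁) (s : ℂ) :
    ((braidEquiv M₁ M₂ M₃ r₂ r₃ 𝒴).1 w₃' w₂ s).1 w₁
      = pairing (expMul (-1) (-1) (vir M₃.dualY 𝓥.conf 1) (const w₃'))
          (applyInv 𝒴.1 (expMul 1 1 (vir M₁.Y 𝓥.conf 1) (const w₁))
            (expMul (-1) 1 (vir M₂.Y 𝓥.conf 1)
              (weightTwist M₂.isInternal (twist r) w₂))) s := by
  obtain ⟨N, hN3, hN2, hN1⟩ := ((M₃.eventually_divPow_dual_L_one w₃').and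
    ((M₂.exists_divPow_L_one_proj w₂).and (M₁.eventually_divPow_L_one w₁))).exists
  rw [expMul_const (-1) (-1) _ w₃' hN3, expMul_const 1 1 _ w₁ hN1,
    expMul_weightTwist M₂ (-1) _ w₂ hN2, pairing_sum_single]
  simp only [applyInv_sum_single]
  set S := (proj_finite M₂.isInternal w₂).toFinset
  let 𝒳 := skewEquiv 𝓥.conf M₁.Y M₂.Y M₃.Y M₃.isTranslation r₃ 𝒴
  let 𝒵 := contraEquiv M₂ r₂ M₁.gradedPair M₃.gradedPair 𝒳
  have hX : ∀ (a : W₁) (b : W₂) (u : ℂ), w₃'.1 (𝒳.1 b a u)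
      = ∑ i ∈ Finset.range N, Complex.exp (twist r₃ * u) * (-1) ^ i *
          (divPow (vir M₃.dualY 𝓥.conf 1) i w₃').1 (𝒴.1 a b (u - i)) := fun a b u =>
    M₃.isOpposite_dualY.skew_eq_sum r₃ 𝒴.2.truncated a b u w₃' hN3
  have hZ : ∀ (a : W₁) (u : ℂ), (𝒵.1 w₂ w₃' u).1 a
      = ∑ h ∈ S, Complex.exp (twist r₂ * h) * ∑ k ∈ Finset.range N,
          w₃'.1 (𝒳.1 (divPow (M₂.L 1) k (proj M₂.isInternal h w₂)) a (-(u + 2 * h - k))) :=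
    fun a u =>
      ((isContra_contraEquiv M₁.gradedPair M₃.gradedPair 𝒳).eq_contra w₂ w₃' a u).trans
        (contra_eq_sum M₂ M₃ r₂ 𝒳.1 w₂ w₃' a u hN2)
  have hB : ((braidEquiv M₁ M₂ M₃ r₂ r₃ 𝒴).1 w₃' w₂ s).1 w₁
      = ∑ j ∈ Finset.range N, Complex.exp (twist r₃ * s) * (-1) ^ j *
          (𝒵.1 w₂ w₃' (s - j)).1 (divPow (M₁.L 1) j w₁) :=
    M₁.isOpposite_dualY.symm.skew_eq_sum r₃ 𝒵.2.truncated w₂ w₃' s w₁ hN1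
  rw [hB]
  have key : ∀ (h : ℂ) (i j k : ℕ),
      Complex.exp (twist r₃ * s) * (-1) ^ j * (Complex.exp (twist r₂ * h) *
        (Complex.exp (twist r₃ * -(s - j + 2 * h - k)) * (-1) ^ i))
      = (-1) ^ i * ((-1) ^ k * Complex.exp (twist r * h)) := by
    intro h i j k
    have e1 : Complex.exp (twist r₃ * -(s - j + 2 * h - k))
        = (-1) ^ (j + k) * Complex.exp (twist r₃ * -(s + 2 * h)) := by
      have := exp_twist_add_int r₃ (j + k : ℕ) (-(s + 2 * h))
      rw [zpow_natCast] at this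
      rw [← this]
      congr 2
      push_cast
      ring
    have e2 : Complex.exp (twist r₃ * s) * (Complex.exp (twist r₂ * h) *
        Complex.exp (twist r₃ * -(s + 2 * h))) = Complex.exp (twist r * h) := by
      rw [← Complex.exp_add, ← Complex.exp_add, hr]
      congr 1
      simp only [twist]
      push_cast
      ring
    rw [e1, ← e2, pow_add]
    linear_combination (Complex.exp (twist r₃ * s) * (Complex.exp (twist r₂ * h) *
        Complex.exp (twist r₃ * -(s + 2 * h))) * (-1) ^ k * (-1) ^ i) * neg_one_pow_mul_self j
  simp only [hZ, hX, Finset.mul_sum, map_sum, Finset.sum_product]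
  have hR : ∀ i j : ℕ, ∀ h : ℂ, ∀ k : ℕ,
      ((-1 : ℂ) ^ i • divPow (vir M₃.dualY 𝓥.conf 1) i w₃').1
        (𝒴.1 ((1 : ℂ) ^ j • divPow (vir M₁.Y 𝓥.conf 1) j w₁)
          (((-1 : ℂ) ^ k * Complex.exp (twist r * h)) •
            divPow (M₂.L 1) k (proj M₂.isInternal h w₂))
          (-(s - ((-1 : ℤ) : ℂ) * i - ((1 : ℤ) : ℂ) * j - (-2 * h + k))))
      = Complex.exp (twist r₃ * s) * (-1) ^ j * (Complex.exp (twist r₂ * h) *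
        (Complex.exp (twist r₃ * -(s - j + 2 * h - k)) * (-1) ^ i *
          (divPow (vir M₃.dualY 𝓥.conf 1) i w₃').1 (𝒴.1 (divPow (M₁.L 1) j w₁)
            (divPow (M₂.L 1) k (proj M₂.isInternal h w₂)) (-(s - j + 2 * h - k) - i)))) := by
    intro i j h k
    rw [show -(s - ((-1 : ℤ) : ℂ) * i - ((1 : ℤ) : ℂ) * j - (-2 * h + k))
      = -(s - j + 2 * h - k) - i by push_cast; ring, one_pow, one_smul, map_smul, Pi.smul_apply,
      map_smul, ← mul_assoc (Complex.exp (twist r₂ * h)), ← mul_assoc (_ * (-1) ^ j), key]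
    show _ • ((-1 : ℂ) ^ i * _) = _
    rw [smul_eq_mul]
    ring
  simp only [hR]
  refine Eq.trans ?_ Finset.sum_comm
  refine Finset.sum_congr rfl fun j _ => Eq.trans ?_ Finset.sum_comm
  exact Finset.sum_congr rfl fun h _ => Finset.sum_comm

end Formula

end VOA

end

theorem proposition4p9
    {V W₁ W₂ W₃ : Type*} [AddCommGroup V] [Module ℂ V] [AddCommGroup W₁] [Module ℂ W₁]
    [AddCommGroup W₂] [Module ℂ W₂] [AddCommGroup W₃] [Module ℂ W₃]
    (𝓥 : VOA.VertexOperatorAlgebra V) (M₁ : VOA.VOAModule 𝓥 W₁) (M₂ : VOA.VOAModule 𝓥 W₂)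
    (M₃ : VOA.VOAModule 𝓥 W₃) (r : ℤ) :
    ∃ B : VOA.intertwining 𝓥.conf M₁.Y M₂.Y M₃.Y ≃ₗ[ℂ]
        VOA.intertwining 𝓥.conf M₃.dualY M₂.Y M₁.dualY,
      -- `B = Ω_{r₃} ∘ A_{r₂} ∘ Ω_{r₃}`, for every admissible choice of `r₂`, `r₃`
      (∀ r₂ r₃ : ℤ, r = r₂ - 2 * r₃ - 1 →
        ∃ (Ω : VOA.intertwining 𝓥.conf M₁.Y M₂.Y M₃.Y ≃ₗ[ℂ]
              VOA.intertwining 𝓥.conf M₂.Y M₁.Y M₃.Y)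
          (A : VOA.intertwining 𝓥.conf M₂.Y M₁.Y M₃.Y ≃ₗ[ℂ]
              VOA.intertwining 𝓥.conf M₂.Y M₃.dualY M₁.dualY)
          (Ω' : VOA.intertwining 𝓥.conf M₂.Y M₃.dualY M₁.dualY ≃ₗ[ℂ]
              VOA.intertwining 𝓥.conf M₃.dualY M₂.Y M₁.dualY),
          (∀ 𝒴 w₂ w₁, (Ω 𝒴).1 w₂ w₁ = VOA.skew 𝓥.conf M₃.Y r₃ 𝒴.1 w₂ w₁) ∧
          (∀ 𝒴 w₂ w₃' w₁, (fun s => ((A 𝒴).1 w₂ w₃' s).1 w₁)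
            = VOA.contra M₂ M₃ r₂ 𝒴.1 w₂ w₃' w₁) ∧
          (∀ 𝒴 w₃' w₂, (Ω' 𝒴).1 w₃' w₂ = VOA.skew 𝓥.conf M₁.dualY r₃ 𝒴.1 w₃' w₂) ∧
          B = Ω.trans (A.trans Ω')) ∧
      -- the explicit formula for `⟨B(𝒴)(w₃', x)w₂, w₁⟩`
      (∀ 𝒴 w₃' w₂ w₁,
        (fun s => ((B 𝒴).1 w₃' w₂ s).1 w₁)
          = VOA.pairing
              (VOA.expMul (-1) (-1) (VOA.vir M₃.dualY 𝓥.conf 1) (VOA.const w₃'))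
              (VOA.applyInv 𝒴.1
                (VOA.expMul 1 1 (VOA.vir M₁.Y 𝓥.conf 1) (VOA.const w₁))
                (VOA.expMul (-1) 1 (VOA.vir M₂.Y 𝓥.conf 1)
                  (VOA.weightTwist M₂.isInternal ((2 * r + 1) * Real.pi * Complex.I) w₂)))) := by
  refine ⟨VOA.braidEquiv M₁ M₂ M₃ (r + 1) 0, fun r₂ r₃ hr =>
    ⟨VOA.skewEquiv 𝓥.conf M₁.Y M₂.Y M₃.Y M₃.isTranslation r₃,
      VOA.contraEquiv M₂ r₂ M₁.gradedPair M₃.gradedPair,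
      VOA.skewEquiv 𝓥.conf M₂.Y M₃.dualY M₁.dualY M₁.isTranslation_dualY r₃,
      fun 𝒴 w₂ w₁ => VOA.skewEquiv_apply _ 𝒴 w₂ w₁,
      fun 𝒴 w₂ w₃' w₁ => funext fun s =>
        (VOA.isContra_contraEquiv M₁.gradedPair M₃.gradedPair 𝒴).eq_contra w₂ w₃' w₁ s,
      fun 𝒴 w₃' w₂ => VOA.skewEquiv_apply _ 𝒴 w₃' w₂, ?_⟩,
    fun 𝒴 w₃' w₂ w₁ => funext fun s => VOA.braidEquiv_apply M₁ M₂ M₃ (by ring) 𝒴 w₃' w₂ w₁ s⟩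
  refine LinearEquiv.ext fun 𝒴 => Subtype.ext ?_
  refine LinearMap.ext fun w₃' => LinearMap.ext fun w₂ => funext fun s =>
    Subtype.ext (LinearMap.ext fun w₁ => ?_)
  exact (VOA.braidEquiv_apply M₁ M₂ M₃ (r := r) (by ring) 𝒴 w₃' w₂ w₁ s).trans
    (VOA.braidEquiv_apply M₁ M₂ M₃ hr 𝒴 w₃' w₂ w₁ s).symm
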